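/- Let $M$ be a scheme over $\mathbb{C}$, let $P_\bullet$ and $Q_\bullet$ be bounded complexes of vector bundles (locally free $\mathcal{O}_M$-modules of finite rank) on $M$, and let $s\colon P_\bullet\to Q_\bullet$ be a quasi-isomorphism. For a partition $\lambda$ of $n\ge 0$ let $V_\lambda$ be the corresponding irreducible complex representation of the symmetric group $S_n$, and let $$\mathbf{S}_\lambda(P_\bullet)=\left(V_\lambda\otimes P_\bullet^{\otimes n}\right)^{S_n}$$ be the Schur complex, where $P_\bullet^{\otimes n}$ is the $n$-fold tensor power over $\mathcal{O}_M$ of the complex $P_\bullet$, on which $S_n$ acts by permuting the factors with the Koszul signs. Then $\mathbf{S}_\lambda(P_\bullet)$ and $\mathbf{S}_\lambda(Q_\bullet)$ are bounded complexes of vector bundles, and $$[\mathbf{S}_\lambda(P_\bullet)]=[\mathbf{S}_\lambda(Q_\bullet)],\qquad\text{where } [E_\bullet]=\sum_i(-1)^i[E_i],$$ in the Grothendieck group of vector bundles on $M$. If $M$ is locally Noetherian, the same equality holds in the Grothendieck group of coherent sheaves on $M$. -/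

import Mathlib

open CategoryTheory AlgebraicGeometry
open scoped TensorProduct DirectSum

namespace SchurComplex

section Signs

variable {n : ℕ}

/-- The Koszul sign of the permutation `σ` acting on a tensor `x₁ ⊗ ⋯ ⊗ xₙ` of homogeneous elements
of degrees `i 1, …, i n`: each pair of factors whose order is reversed by `σ` contributes
`(-1) ^ (deg x_a * deg x_b)`. -/
def koszulSign (σ : Equiv.Perm (Fin n)) (i : Fin n → ℤ) : ℤˣ :=
  ∏ a, ∏ b, if a < b ∧ σ b < σ a then (i a * i b).negOnePow else 1

/-- The sign `(-1) ^ (i 1 + ⋯ + i (k - 1))` with which the differential reaches the factor `k`. -/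
def prefixSign (i : Fin n → ℤ) (k : Fin n) : ℤˣ :=
  ∏ l, if l < k then (i l).negOnePow else 1

lemma prod_pairs_congr (f g : Fin n → Fin n → ℤˣ) (hd : ∀ a, f a a = g a a)
    (h : ∀ a b, a < b → f a b * f b a = g a b * g b a) :
    ∏ a, ∏ b, f a b = ∏ a, ∏ b, g a b := by
  have key : ∀ F : Fin n → Fin n → ℤˣ, ∏ a, ∏ b, F a b =
      (∏ a, ∏ b, if a < b then F a b * F b a else 1) * ∏ a, F a a := by
    intro F
    have h1 : ∀ a b, F a b = ((if a < b then F a b else 1) * (if b < a then F a b else 1)) *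
        (if a = b then F a b else 1) := by
      intro a b
      rcases lt_trichotomy a b with h | h | h
      · simp [h, h.not_gt, h.ne]
      · simp [h]
      · simp [h, h.not_gt, h.ne']
    conv_lhs => enter [2, a, 2, b]; rw [h1 a b]
    simp only [Finset.prod_mul_distrib, Finset.prod_ite_eq, Finset.mem_univ, if_true]
    congr 1
    rw [Finset.prod_comm (f := fun a b => if b < a then F a b else 1), ← Finset.prod_mul_distrib]
    refine Finset.prod_congr rfl fun a _ => ?_
    rw [← Finset.prod_mul_distrib]
    refine Finset.prod_congr rfl fun b _ => ?_
    split_ifs <;> simp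
  rw [key f, key g]
  congr 1
  · refine Finset.prod_congr rfl fun a _ => Finset.prod_congr rfl fun b _ => ?_
    split_ifs with hab
    · exact h a b hab
    · rfl
  · exact Finset.prod_congr rfl fun a _ => hd a

lemma koszulSign_one (i : Fin n → ℤ) : koszulSign 1 i = 1 := by
  refine Finset.prod_eq_one fun a _ => Finset.prod_eq_one fun b _ => if_neg ?_
  rintro ⟨h, h'⟩
  exact (lt_asymm h h').elim

lemma koszulSign_mul (σ τ : Equiv.Perm (Fin n)) (i : Fin n → ℤ) :
    koszulSign (σ * τ) i = koszulSign σ (fun k => i (τ.symm k)) * koszulSign τ i := by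
  have h : koszulSign σ (fun k => i (τ.symm k)) =
      ∏ a, ∏ b, if τ a < τ b ∧ σ (τ b) < σ (τ a) then (i a * i b).negOnePow else 1 := by
    unfold koszulSign
    rw [← Equiv.prod_comp τ]
    refine Finset.prod_congr rfl fun a _ => ?_
    rw [← Equiv.prod_comp τ]
    simp
  rw [h, koszulSign, koszulSign]
  simp only [← Finset.prod_mul_distrib]
  refine prod_pairs_congr _ _ (by simp) fun a b hab => ?_
  have hba : ¬ b < a := hab.not_gt
  have hs : (i a * i b).negOnePow * (i a * i b).negOnePow = 1 := Int.units_mul_self _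
  have h1 : τ a ≠ τ b := fun h => hab.ne (τ.injective h)
  have h2 : σ (τ a) ≠ σ (τ b) := fun h => h1 (σ.injective h)
  rw [mul_comm (i b) (i a)]
  rcases lt_or_gt_of_ne h1 with h1 | h1 <;> rcases lt_or_gt_of_ne h2 with h2 | h2 <;>
    simp [hab, hba, h1, h1.not_gt, h2, h2.not_gt, hs]

lemma prefixSign_perm (σ : Equiv.Perm (Fin n)) (i : Fin n → ℤ) (k : Fin n) :
    prefixSign (fun l => i (σ.symm l)) (σ k) = ∏ l, if σ l < σ k then (i l).negOnePow else 1 := by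
  unfold prefixSign
  rw [← Equiv.prod_comp σ]
  simp

lemma koszulSign_update (σ : Equiv.Perm (Fin n)) (i : Fin n → ℤ) (k : Fin n) :
    koszulSign σ (Function.update i k (i k + 1)) * prefixSign i k =
      prefixSign (fun l => i (σ.symm l)) (σ k) * koszulSign σ i := by
  have h1 : koszulSign σ (Function.update i k (i k + 1)) = koszulSign σ i *
      ((∏ b, if k < b ∧ σ b < σ k then (i b).negOnePow else 1) *
        ∏ a, if a < k ∧ σ k < σ a then (i a).negOnePow else 1) := by
    have e1 : (∏ b, if k < b ∧ σ b < σ k then (i b).negOnePow else 1) =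
        ∏ a, ∏ b, if a = k then (if a < b ∧ σ b < σ a then (i b).negOnePow else 1) else 1 := by
      rw [Finset.prod_comm]
      simp
    have e2 : (∏ a, if a < k ∧ σ k < σ a then (i a).negOnePow else 1) =
        ∏ a, ∏ b, if b = k then (if a < b ∧ σ b < σ a then (i a).negOnePow else 1) else 1 := by
      simp
    rw [e1, e2]
    unfold koszulSign
    simp only [← Finset.prod_mul_distrib]
    refine Finset.prod_congr rfl fun a _ => Finset.prod_congr rfl fun b _ => ?_
    by_cases hab : a < b ∧ σ b < σ a
    · have hne : a ≠ b := hab.1.ne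
      by_cases ha : a = k
      · have hb : b ≠ k := fun h => hne (ha.trans h.symm)
        subst ha
        simp [hab, hb, add_mul, Int.negOnePow_add]
      · by_cases hb : b = k
        · subst hb
          simp [hab, ha, mul_add, Int.negOnePow_add]
        · simp [hab, ha, hb]
    · simp [hab]
  rw [h1, prefixSign_perm, mul_assoc, mul_comm _ (koszulSign σ i)]
  congr 1
  unfold prefixSign
  simp only [← Finset.prod_mul_distrib]
  refine Finset.prod_congr rfl fun l _ => ?_
  rcases lt_trichotomy l k with h | h | h
  · have h1 : σ l ≠ σ k := fun h' => h.ne (σ.injective h')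
    rcases lt_or_gt_of_ne h1 with h1 | h1 <;> simp [h, h.not_gt, h1, h1.not_gt, Int.units_mul_self]
  · simp [h]
  · have h1 : σ l ≠ σ k := fun h' => h.ne' (σ.injective h')
    rcases lt_or_gt_of_ne h1 with h1 | h1 <;> simp [h, h.not_gt, h1, h1.not_gt]

lemma prefixSign_update (i : Fin n → ℤ) (k l : Fin n) :
    prefixSign (Function.update i k (i k + 1)) l =
      (if k < l then -1 else 1) * prefixSign i l := by
  have : (if k < l then (-1 : ℤˣ) else 1) = ∏ m, if m = k then (if m < l then -1 else 1) else 1 := by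
    simp
  rw [this]
  unfold prefixSign
  rw [← Finset.prod_mul_distrib]
  refine Finset.prod_congr rfl fun m _ => ?_
  by_cases hm : m = k
  · subst hm; by_cases h : m < l <;> simp [h, Int.negOnePow_add]
  · simp [hm]

lemma prefixSign_anticomm (i : Fin n → ℤ) {k l : Fin n} (hkl : k ≠ l) :
    prefixSign (Function.update i k (i k + 1)) l * prefixSign i k =
      - (prefixSign (Function.update i l (i l + 1)) k * prefixSign i l) := by
  rw [prefixSign_update, prefixSign_update]
  rcases lt_or_gt_of_ne hkl with h | h <;> simp [h, h.not_gt, mul_comm]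

end Signs

section TensorPower

variable {R : Type} [CommRing R] (K : CochainComplex (ModuleCat.{0} R) ℤ)

/-- The degree `j` term of the `n`-fold tensor power of a complex `K` of `R`-modules: the direct sum
of the `K^{i 1} ⊗ ⋯ ⊗ K^{i n}` over all `i` with `i 1 + ⋯ + i n = j`. -/
abbrev TensorPower (n : ℕ) (j : ℤ) : Type :=
  ⨁ i : {i : Fin n → ℤ // ∑ k, i k = j}, ⨂[R] k, K.X (i.1 k)

variable {K} {n : ℕ} {j : ℤ}

/-- The tensor `y 1 ⊗ ⋯ ⊗ y n` of homogeneous elements. -/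
noncomputable def homog (y : Fin n → Σ a, K.X a) (h : ∑ k, (y k).1 = j) : TensorPower K n j :=
  DirectSum.lof R _ (fun i : {i : Fin n → ℤ // ∑ k, i k = j} => ⨂[R] k, K.X (i.1 k))
    ⟨fun k => (y k).1, h⟩ (PiTensorProduct.tprod R fun k => (y k).2)

lemma homog_congr {y y' : Fin n → Σ a, K.X a} (e : y = y') (h : ∑ k, (y k).1 = j) :
    homog y h = homog y' (e ▸ h) := by
  subst e; rfl

lemma homog_eq_zero {y : Fin n → Σ a, K.X a} (h : ∑ k, (y k).1 = j) (k : Fin n) {a : ℤ}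
    (hk : y k = ⟨a, 0⟩) : homog y h = 0 := by
  have hk' : ∀ s : Σ a, K.X a, s = ⟨a, 0⟩ → s.2 = 0 := by rintro _ rfl; rfl
  unfold homog
  rw [MultilinearMap.map_coord_zero _ k (hk' _ hk), map_zero]

lemma linearMap_ext {S M : Type} [CommRing S] {φ : R →+* S} [AddCommGroup M] [Module S M]
    {f g : TensorPower K n j →ₛₗ[φ] M}
    (h : ∀ y hy, f (homog y hy) = g (homog y hy)) : f = g := by
  refine LinearMap.ext fun t => ?_
  induction t using DirectSum.induction_on with
  | zero => simp
  | add a b ha hb => rw [map_add, map_add, ha, hb]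
  | of i z =>
    induction z using PiTensorProduct.induction_on with
    | smul_tprod r x =>
      have := h (fun k => ⟨i.1 k, x k⟩) i.2
      have e : DirectSum.of (fun i : {i : Fin n → ℤ // ∑ k, i k = j} => ⨂[R] k, K.X (i.1 k)) i
          (r • PiTensorProduct.tprod R x) = r • homog (fun k => ⟨i.1 k, x k⟩) i.2 :=
        (DirectSum.lof R _ (fun i : {i : Fin n → ℤ // ∑ k, i k = j} => ⨂[R] k, K.X (i.1 k))
          i).map_smul r _
      rw [e, map_smulₛₗ, map_smulₛₗ, this]
    | add a b ha hb => rw [map_add, map_add, map_add, ha, hb]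

lemma sum_perm (σ : Equiv.Perm (Fin n)) {i : Fin n → ℤ} (h : ∑ k, i k = j) :
    ∑ k, i (σ.symm k) = j := by
  rw [Equiv.sum_comp σ.symm i, h]

lemma sum_update {i : Fin n → ℤ} (h : ∑ k, i k = j) (k : Fin n) :
    ∑ l, Function.update i k (i k + 1) l = j + 1 := by
  rw [Finset.sum_update_of_mem (Finset.mem_univ k), ← h,
    ← Finset.add_sum_erase _ _ (Finset.mem_univ k), Finset.sdiff_singleton_eq_erase]
  ring

variable (K j) in
/-- The super action of a permutation on the tensor power:
`σ (x₁ ⊗ ⋯ ⊗ xₙ) = ± x_{σ⁻¹ 1} ⊗ ⋯ ⊗ x_{σ⁻¹ n}`, with the Koszul sign. -/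
noncomputable def permMap (σ : Equiv.Perm (Fin n)) : TensorPower K n j →ₗ[R] TensorPower K n j :=
  DirectSum.toModule R _ _ fun i => (koszulSign σ i.1 : ℤ) •
    (DirectSum.lof R _ (fun i : {i : Fin n → ℤ // ∑ k, i k = j} => ⨂[R] k, K.X (i.1 k))
      ⟨fun k => i.1 (σ.symm k), sum_perm σ i.2⟩ ∘ₗ
        (PiTensorProduct.reindex R (fun k => K.X (i.1 k)) σ).toLinearMap)

lemma permMap_homog (σ : Equiv.Perm (Fin n)) (y : Fin n → Σ a, K.X a) (h : ∑ k, (y k).1 = j) :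
    permMap K j σ (homog y h) = (koszulSign σ (fun k => (y k).1) : ℤ) •
      homog (fun k => y (σ.symm k)) (sum_perm (i := fun k => (y k).1) σ h) := by
  unfold permMap
  conv_lhs => rw [homog, DirectSum.toModule_lof]
  simp only [LinearMap.smul_apply, LinearMap.comp_apply, LinearEquiv.coe_coe,
    PiTensorProduct.reindex_tprod]
  rfl

variable (K n j) in
/-- The super action of the symmetric group on the terms of the tensor power. -/
noncomputable def permRep : Representation R (Equiv.Perm (Fin n)) (TensorPower K n j) where
  toFun := permMap K j
  map_one' := linearMap_ext fun y hy => by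
    rw [permMap_homog, koszulSign_one]
    simp only [Units.val_one, one_smul]
    rfl
  map_mul' σ τ := linearMap_ext fun y hy => by
    rw [Module.End.mul_apply, permMap_homog, permMap_homog, map_zsmul, permMap_homog, smul_smul,
      koszulSign_mul, mul_comm, Units.val_mul]
    rfl

/-- The factor `l` of the map `1 ⊗ ⋯ ⊗ d ⊗ ⋯ ⊗ 1`, with `d` at the place `k`. -/
noncomputable def stepMap (i : Fin n → ℤ) (k l : Fin n) :
    K.X (i l) →ₗ[R] K.X (Function.update i k (i k + 1) l) :=
  if h : l = k then (K.d (i l) (Function.update i k (i k + 1) l)).hom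
  else (K.XIsoOfEq (Function.update_of_ne h (i k + 1) i).symm).hom.hom

variable (K n j) in
/-- The differential of the tensor power:
`d (x₁ ⊗ ⋯ ⊗ xₙ) = ∑ k, (-1) ^ (deg x₁ + ⋯ + deg x_{k-1}) x₁ ⊗ ⋯ ⊗ d x_k ⊗ ⋯ ⊗ xₙ`. -/
noncomputable def diff : TensorPower K n j →ₗ[R] TensorPower K n (j + 1) :=
  DirectSum.toModule R _ _ fun i => ∑ k, (prefixSign i.1 k : ℤ) •
    (DirectSum.lof R _ (fun i : {i : Fin n → ℤ // ∑ k, i k = j + 1} => ⨂[R] k, K.X (i.1 k))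
      ⟨Function.update i.1 k (i.1 k + 1), sum_update i.2 k⟩ ∘ₗ
        PiTensorProduct.map (stepMap i.1 k))

/-- The family `y` with `y k` replaced by its differential. -/
noncomputable def step (y : Fin n → Σ a, K.X a) (k : Fin n) : Fin n → Σ a, K.X a :=
  Function.update y k ⟨(y k).1 + 1, K.d _ _ (y k).2⟩

lemma step_fst (y : Fin n → Σ a, K.X a) (k : Fin n) :
    (fun l => (step y k l).1) = Function.update (fun l => (y l).1) k ((y k).1 + 1) := by
  funext l
  by_cases h : l = k
  · subst h; simp [step]
  · simp [step, h]

lemma sum_step {y : Fin n → Σ a, K.X a} (h : ∑ k, (y k).1 = j) (k : Fin n) :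
    ∑ l, (step y k l).1 = j + 1 := by
  have := sum_update (i := fun l => (y l).1) h k
  rw [← step_fst] at this
  exact this

lemma XIsoOfEq_sigma {a b : ℤ} (e : a = b) (x : K.X a) :
    (⟨b, (K.XIsoOfEq e).hom.hom x⟩ : Σ a, K.X a) = ⟨a, x⟩ := by
  subst e; simp

lemma d_sigma {a b c : ℤ} (e : b = c) (x : K.X a) :
    (⟨b, (K.d a b).hom x⟩ : Σ a, K.X a) = ⟨c, (K.d a c).hom x⟩ := by
  subst e; rfl

lemma diff_homog (y : Fin n → Σ a, K.X a) (h : ∑ k, (y k).1 = j) :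
    diff K n j (homog y h) =
      ∑ k, (prefixSign (fun k => (y k).1) k : ℤ) • homog (step y k) (sum_step h k) := by
  unfold diff
  conv_lhs => rw [homog, DirectSum.toModule_lof]
  simp only [LinearMap.sum_apply, LinearMap.smul_apply, LinearMap.comp_apply,
    PiTensorProduct.map_tprod]
  refine Finset.sum_congr rfl fun k _ => congrArg _ ?_
  refine homog_congr (y := fun l => ⟨Function.update (fun l => (y l).1) k ((y k).1 + 1) l,
    stepMap (fun l => (y l).1) k l (y l).2⟩) ?_ _
  funext l
  by_cases hl : l = k
  · subst hl
    simp only [step, stepMap, dif_pos, Function.update_self]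
    exact d_sigma (by simp) _
  · simp only [step, stepMap, dif_neg hl, Function.update_of_ne hl]
    exact XIsoOfEq_sigma (Function.update_of_ne hl _ (fun l => (y l).1)).symm _

lemma diff_diff : diff K n (j + 1) ∘ₗ diff K n j = 0 := linearMap_ext fun y hy => by
  rw [LinearMap.comp_apply, diff_homog, map_sum, LinearMap.zero_apply]
  simp only [map_zsmul, diff_homog, Finset.smul_sum, smul_smul]
  rw [← Finset.sum_product']
  have hdiag : ∀ k : Fin n, homog (step (step y k) k) (sum_step (sum_step hy k) k) = 0 := by
    intro k
    have h1 : step y k k = ⟨(y k).1 + 1, K.d _ _ (y k).2⟩ := Function.update_self _ _ _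
    have h2 : step (step y k) k k = ⟨(step y k k).1 + 1, K.d _ _ (step y k k).2⟩ :=
      Function.update_self _ _ _
    rw [h1] at h2
    refine homog_eq_zero _ k (h2.trans (congrArg (Sigma.mk _) ?_))
    rw [← ConcreteCategory.comp_apply, K.d_comp_d]
    rfl
  refine Finset.sum_ninvolution Prod.swap ?_ ?_ (by simp) (by simp)
  · rintro ⟨k, l⟩
    by_cases hkl : k = l
    · subst hkl
      simp [hdiag]
    · have hs : step (step y k) l = step (step y l) k := by
        unfold step
        rw [Function.update_of_ne (Ne.symm hkl), Function.update_of_ne hkl,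
          Function.update_comm hkl]
      have e := prefixSign_anticomm (fun m => (y m).1) hkl
      simp only [Prod.swap_prod_mk, step_fst]
      rw [homog_congr hs, ← add_smul]
      have e' := congrArg (Units.val) e
      simp only [Units.val_mul, Units.val_neg] at e'
      rw [mul_comm, e', mul_comm (prefixSign _ _ : ℤ), mul_comm (prefixSign _ _ : ℤ)]
      simp [mul_comm]
  · rintro ⟨k, l⟩ h e
    obtain rfl : l = k := congrArg Prod.fst e
    exact h (by simp [hdiag])

lemma diff_permMap (σ : Equiv.Perm (Fin n)) :
    diff K n j ∘ₗ permMap K j σ = permMap K (j + 1) σ ∘ₗ diff K n j := linearMap_ext fun y hy => by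
  simp only [LinearMap.comp_apply, permMap_homog, diff_homog, map_zsmul, map_sum, Finset.smul_sum,
    smul_smul]
  rw [← Equiv.sum_comp σ]
  refine Finset.sum_congr rfl fun k _ => ?_
  have hs : step (fun l => y (σ.symm l)) (σ k) = fun l => step y k (σ.symm l) := by
    funext l
    by_cases hl : l = σ k
    · subst hl
      unfold step
      rw [Function.update_self, Equiv.symm_apply_apply, Function.update_self]
      exact congrArg (fun s : Σ a, K.X a => (⟨s.1 + 1, K.d _ _ s.2⟩ : Σ a, K.X a))
        (congrArg y (σ.symm_apply_apply k))
    · have : σ.symm l ≠ k := fun h => hl (by rw [← h, Equiv.apply_symm_apply])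
      simp [step, hl, this]
  have e := congrArg Units.val (koszulSign_update σ (fun m => (y m).1) k)
  simp only [Units.val_mul] at e
  rw [← step_fst] at e
  rw [homog_congr hs, mul_comm (koszulSign _ _ : ℤ), ← e, mul_comm]

end TensorPower

section Restriction

variable {R S T : Type} [CommRing R] [CommRing S] [CommRing T]
  {K : CochainComplex (ModuleCat.{0} R) ℤ} {L : CochainComplex (ModuleCat.{0} S) ℤ}
  {Q : CochainComplex (ModuleCat.{0} T) ℤ} {n : ℕ} {j : ℤ}

/-- The map `K^{i 1} ⊗ ⋯ ⊗ K^{i n} → L^{i 1} ⊗ ⋯ ⊗ L^{i n}` induced by maps `K^a → L^a` which are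
semilinear over a ring homomorphism. -/
noncomputable def piMap {φ : R →+* S} (r : ∀ a, K.X a →ₛₗ[φ] L.X a) (i : Fin n → ℤ) :
    (⨂[R] k, K.X (i k)) →ₛₗ[φ] ⨂[S] k, L.X (i k) :=
  letI := Module.compHom (⨂[S] k, L.X (i k)) φ
  let f : MultilinearMap R (fun k => K.X (i k)) (⨂[S] k, L.X (i k)) :=
    { toFun := fun x => PiTensorProduct.tprod S fun k => r (i k) (x k)
      map_update_add' := fun x k a b => by
        classical
        have e : ∀ c, (fun l => r (i l) (Function.update x k c l)) =
            Function.update (fun l => r (i l) (x l)) k (r (i k) c) := fun c => by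
          funext l
          by_cases h : l = k
          · subst h; simp
          · simp [h]
        convert (PiTensorProduct.tprod S).map_update_add (fun l => r (i l) (x l)) k
          (r (i k) a) (r (i k) b) using 2
        · exact (e _).trans (by rw [map_add])
        · exact congrArg _ (e a)
        · exact congrArg _ (e b)
      map_update_smul' := fun x k c a => by
        classical
        have e : ∀ c, (fun l => r (i l) (Function.update x k c l)) =
            Function.update (fun l => r (i l) (x l)) k (r (i k) c) := fun c => by
          funext l
          by_cases h : l = k
          · subst h; simp
          · simp [h]
        convert (PiTensorProduct.tprod S).map_update_smul (fun l => r (i l) (x l)) k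
          (φ c) (r (i k) a) using 2
        · exact (e _).trans (by rw [map_smulₛₗ])
        · exact congrArg (fun z => φ c • PiTensorProduct.tprod S z) (e a) }
  { PiTensorProduct.liftAux f with
    map_smul' := fun c x => (PiTensorProduct.lift f).map_smul c x }

lemma piMap_tprod {φ : R →+* S} (r : ∀ a, K.X a →ₛₗ[φ] L.X a) (i : Fin n → ℤ)
    (x : ∀ k, K.X (i k)) : piMap r i (PiTensorProduct.tprod R x) =
      PiTensorProduct.tprod S fun k => r (i k) (x k) := by
  let _ := Module.compHom (⨂[S] k, L.X (i k)) φ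
  exact PiTensorProduct.liftAux_tprod _ _

variable (n j) in
/-- The map on the terms of tensor powers induced by semilinear maps `K^a → L^a`. -/
noncomputable def tensorPowerMap {φ : R →+* S} (r : ∀ a, K.X a →ₛₗ[φ] L.X a) :
    TensorPower K n j →ₛₗ[φ] TensorPower L n j :=
  let f : TensorPower K n j →+ TensorPower L n j :=
    DirectSum.map fun i : {i : Fin n → ℤ // ∑ k, i k = j} => (piMap r i.1).toAddMonoidHom
  { f with
    map_smul' := fun c x => by
      change f (c • x) = φ c • f x
      ext i
      simp only [f, DirectSum.map_apply, DirectSum.smul_apply]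
      exact (piMap r i.1).map_smulₛₗ c _ }

lemma tensorPowerMap_homog {φ : R →+* S} (r : ∀ a, K.X a →ₛₗ[φ] L.X a)
    (y : Fin n → Σ a, K.X a) (h : ∑ k, (y k).1 = j) :
    tensorPowerMap n j r (homog y h) = homog (fun k => ⟨(y k).1, r _ (y k).2⟩) h := by
  refine (DirectSum.map_of _ _ _).trans ?_
  exact congrArg _ (piMap_tprod r _ _)

lemma tensorPowerMap_permMap {φ : R →+* S} (r : ∀ a, K.X a →ₛₗ[φ] L.X a)
    (σ : Equiv.Perm (Fin n)) (t : TensorPower K n j) :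
    tensorPowerMap n j r (permMap K j σ t) = permMap L j σ (tensorPowerMap n j r t) := by
  refine LinearMap.congr_fun (f := (tensorPowerMap n j r).comp (permMap K j σ))
    (g := (permMap L j σ).comp (tensorPowerMap n j r)) (linearMap_ext fun y hy => ?_) t
  simp only [LinearMap.comp_apply, permMap_homog, map_zsmul, tensorPowerMap_homog]

lemma tensorPowerMap_diff {φ : R →+* S} (r : ∀ a, K.X a →ₛₗ[φ] L.X a)
    (hr : ∀ a b x, r b (K.d a b x) = L.d a b (r a x)) (t : TensorPower K n j) :
    tensorPowerMap n (j + 1) r (diff K n j t) = diff L n j (tensorPowerMap n j r t) := by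
  refine LinearMap.congr_fun (f := (tensorPowerMap n (j + 1) r).comp (diff K n j))
    (g := (diff L n j).comp (tensorPowerMap n j r)) (linearMap_ext fun y hy => ?_) t
  simp only [LinearMap.comp_apply, diff_homog, map_sum, map_zsmul, tensorPowerMap_homog]
  refine Finset.sum_congr rfl fun k _ => congrArg _ (homog_congr ?_ _)
  let g : (Σ a, K.X a) → Σ a, L.X a := fun s => ⟨s.1, r _ s.2⟩
  change (fun l => g (step y k l)) = step (fun l => g (y l)) k
  funext l
  by_cases hl : l = k
  · subst hl
    unfold step
    rw [Function.update_self, Function.update_self]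
    exact congrArg (Sigma.mk _) (hr _ _ _)
  · unfold step
    rw [Function.update_of_ne hl, Function.update_of_ne hl]

lemma tensorPowerMap_id (t : TensorPower K n j) :
    tensorPowerMap n j (fun a => (LinearMap.id : K.X a →ₗ[R] K.X a)) t = t := by
  refine LinearMap.congr_fun (g := LinearMap.id) (linearMap_ext fun y hy => ?_) t
  rw [tensorPowerMap_homog]
  rfl

lemma tensorPowerMap_comp {φ : R →+* S} {ψ : S →+* T} {χ : R →+* T} [RingHomCompTriple φ ψ χ]
    (r : ∀ a, K.X a →ₛₗ[φ] L.X a) (s : ∀ a, L.X a →ₛₗ[ψ] Q.X a) (t : TensorPower K n j) :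
    tensorPowerMap n j (fun a => (s a).comp (r a)) t =
      tensorPowerMap n j s (tensorPowerMap n j r t) := by
  refine LinearMap.congr_fun (f := tensorPowerMap n j (fun a => (s a).comp (r a)))
    (g := (tensorPowerMap n j s).comp (tensorPowerMap n j r)) (linearMap_ext fun y hy => ?_) t
  simp only [LinearMap.comp_apply, tensorPowerMap_homog]

end Restriction

section Schur

variable {n : ℕ} {V : Type} [AddCommGroup V] [Module ℂ V]
  (ρ : Representation ℂ (Equiv.Perm (Fin n)) V)

/-- The extension of scalars `R ⊗_ℂ V` of a complex representation `V`. -/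
noncomputable def baseChangeRep (R : Type) [CommRing R] [Algebra ℂ R] :
    Representation R (Equiv.Perm (Fin n)) (R ⊗[ℂ] V) where
  toFun σ := (ρ σ).baseChange R
  map_one' := by rw [map_one]; exact LinearMap.baseChange_id
  map_mul' σ τ := by rw [map_mul]; exact LinearMap.baseChange_comp _ _

variable {R : Type} [CommRing R] [Algebra ℂ R] (K : CochainComplex (ModuleCat.{0} R) ℤ) (j : ℤ)

/-- The degree `j` term of `V ⊗ K^{⊗ n}`. -/
abbrev TwistedPower (V : Type) [AddCommGroup V] [Module ℂ V]
    (K : CochainComplex (ModuleCat.{0} R) ℤ) (n : ℕ) (j : ℤ) : Type :=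
  (R ⊗[ℂ] V) ⊗[R] TensorPower K n j

/-- The diagonal action of the symmetric group on the terms of `V ⊗ K^{⊗ n}`. -/
noncomputable def twistedRep :
    Representation R (Equiv.Perm (Fin n)) (TwistedPower V K n j) :=
  (baseChangeRep ρ R).tprod (permRep K n j)

/-- The degree `j` term of `(V ⊗ K^{⊗ n})^{S_n}`, for a complex `K` of modules over a commutative
`ℂ`-algebra `R` and a complex representation `V` of the symmetric group `S_n`. -/
noncomputable def schurTerm : Submodule R (TwistedPower V K n j) :=
  { carrier := {x | ∀ σ, twistedRep ρ K j σ x = x}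
    add_mem' := fun hx hy σ => by rw [map_add, hx σ, hy σ]
    zero_mem' := fun σ => map_zero _
    smul_mem' := fun c x hx σ => by rw [map_smul, hx σ] }

noncomputable instance schurTermAddCommGroup : AddCommGroup (schurTerm ρ K j) :=
  Submodule.addCommGroup (M := TwistedPower V K n j) (schurTerm ρ K j)

/-- The differential of `(V ⊗ K^{⊗ n})^{S_n}`. -/
noncomputable def schurDiff : schurTerm ρ K j →ₗ[R] schurTerm ρ K (j + 1) :=
  (TensorProduct.map LinearMap.id (diff K n j)).restrict fun x hx σ => by
    have h : twistedRep ρ K (j + 1) σ ∘ₗ TensorProduct.map LinearMap.id (diff K n j) =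
        TensorProduct.map LinearMap.id (diff K n j) ∘ₗ twistedRep ρ K j σ :=
      TensorProduct.ext' fun v t => congrArg (fun z => _ ⊗ₜ[R] z)
        (LinearMap.congr_fun (diff_permMap σ) t).symm
    exact (LinearMap.congr_fun h x).trans (congrArg _ (hx σ))

lemma schurDiff_schurDiff (x : schurTerm ρ K j) :
    schurDiff ρ K (j + 1) (schurDiff ρ K j x) = 0 := by
  refine Subtype.ext ?_
  change TensorProduct.map LinearMap.id (diff K n (j + 1))
    (TensorProduct.map LinearMap.id (diff K n j) x.1) = 0
  rw [← LinearMap.comp_apply, ← TensorProduct.map_comp, diff_diff, TensorProduct.map_zero_right]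
  rfl

variable {K} {S T : Type} [CommRing S] [Algebra ℂ S] [CommRing T] [Algebra ℂ T]
  {L : CochainComplex (ModuleCat.{0} S) ℤ} {Q : CochainComplex (ModuleCat.{0} T) ℤ}

variable (V) in
/-- The map `R ⊗_ℂ V → S ⊗_ℂ V` induced by a homomorphism of `ℂ`-algebras. -/
noncomputable def scalarMap (φ : R →ₐ[ℂ] S) : R ⊗[ℂ] V →ₛₗ[(φ : R →+* S)] S ⊗[ℂ] V :=
  { TensorProduct.map φ.toLinearMap LinearMap.id with
    map_smul' := fun c x => by
      change TensorProduct.map φ.toLinearMap LinearMap.id (c • x) =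
        φ c • TensorProduct.map φ.toLinearMap LinearMap.id x
      induction x using TensorProduct.induction_on with
      | zero => simp
      | tmul a v => simp [TensorProduct.smul_tmul']
      | add a b ha hb => rw [smul_add, map_add, map_add, ha, hb, smul_add] }

/-- The map on the terms of `(V ⊗ K^{⊗ n})^{S_n}` induced by a homomorphism of `ℂ`-algebras
`R → S` and semilinear maps `K^a → L^a`. -/
noncomputable def schurMap (φ : R →ₐ[ℂ] S) (r : ∀ a, K.X a →ₛₗ[(φ : R →+* S)] L.X a) :
    schurTerm ρ K j →ₛₗ[(φ : R →+* S)] schurTerm ρ L j :=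
  ((TensorProduct.map (scalarMap V φ) (tensorPowerMap n j r)).domRestrict
    (schurTerm ρ K j)).codRestrict _ fun x σ => by
      have h : (twistedRep ρ L j σ).comp (TensorProduct.map (scalarMap V φ) (tensorPowerMap n j r)) =
          (TensorProduct.map (scalarMap V φ) (tensorPowerMap n j r)).comp (twistedRep ρ K j σ) := by
        refine TensorProduct.ext' fun v t => ?_
        change _ ⊗ₜ[S] _ = _ ⊗ₜ[S] _
        congr 1
        · induction v using TensorProduct.induction_on with
          | zero => simp
          | tmul a v => rfl
          | add a b ha hb => simp only [map_add, ha, hb]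
        · exact (tensorPowerMap_permMap r σ t).symm
      exact (LinearMap.congr_fun h x.1).trans (congrArg _ (x.2 σ))

lemma schurMap_diff (φ : R →ₐ[ℂ] S) (r : ∀ a, K.X a →ₛₗ[(φ : R →+* S)] L.X a)
    (hr : ∀ a b x, r b (K.d a b x) = L.d a b (r a x)) (x : schurTerm ρ K j) :
    schurMap ρ (j + 1) φ r (schurDiff ρ K j x) = schurDiff ρ L j (schurMap ρ j φ r x) := by
  refine Subtype.ext ?_
  have h : (TensorProduct.map (scalarMap V φ) (tensorPowerMap n (j + 1) r)).comp
        (TensorProduct.map LinearMap.id (diff K n j)) =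
      (TensorProduct.map LinearMap.id (diff L n j)).comp
        (TensorProduct.map (scalarMap V φ) (tensorPowerMap n j r)) :=
    TensorProduct.ext' fun v t => congrArg (fun z => _ ⊗ₜ[S] z) (tensorPowerMap_diff r hr t)
  exact LinearMap.congr_fun h x.1

lemma schurMap_id (φ : R →ₐ[ℂ] R) (hφ : φ = AlgHom.id ℂ R)
    (r : ∀ a, K.X a →ₛₗ[(φ : R →+* R)] K.X a) (hr : ∀ a x, r a x = x) (x : schurTerm ρ K j) :
    schurMap ρ j φ r x = x := by
  subst hφ
  obtain rfl : r = fun a => (LinearMap.id : K.X a →ₗ[R] K.X a) :=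
    funext fun a => LinearMap.ext (hr a)
  refine Subtype.ext ?_
  have h : TensorProduct.map (scalarMap V (AlgHom.id ℂ R))
      (tensorPowerMap n j (fun a => (LinearMap.id : K.X a →ₗ[R] K.X a))) = LinearMap.id := by
    refine TensorProduct.ext' fun v t => ?_
    exact congrArg₂ (fun a b => a ⊗ₜ[R] b) (LinearMap.congr_fun TensorProduct.map_id v)
      (tensorPowerMap_id t)
  exact LinearMap.congr_fun h x.1

lemma schurMap_comp (φ : R →ₐ[ℂ] S) (ψ : S →ₐ[ℂ] T) (χ : R →ₐ[ℂ] T) (hχ : χ = ψ.comp φ)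
    (r : ∀ a, K.X a →ₛₗ[(φ : R →+* S)] L.X a) (s : ∀ a, L.X a →ₛₗ[(ψ : S →+* T)] Q.X a)
    (t : ∀ a, K.X a →ₛₗ[(χ : R →+* T)] Q.X a)
    (ht : ∀ a x, t a x = s a (r a x)) (x : schurTerm ρ K j) :
    schurMap ρ j χ t x = schurMap ρ j ψ s (schurMap ρ j φ r x) := by
  subst hχ
  have : RingHomCompTriple (φ : R →+* S) (ψ : S →+* T) ((ψ.comp φ : R →ₐ[ℂ] T) : R →+* T) :=
    ⟨rfl⟩
  obtain rfl : t = fun a => (s a).comp (r a) := funext fun a => LinearMap.ext (ht a)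
  refine Subtype.ext ?_
  have h : TensorProduct.map (scalarMap V (ψ.comp φ))
        (tensorPowerMap n j fun a => (s a).comp (r a)) =
      (TensorProduct.map (scalarMap V ψ) (tensorPowerMap n j s)).comp
        (TensorProduct.map (scalarMap V φ) (tensorPowerMap n j r)) := by
    refine TensorProduct.ext' fun v t => ?_
    change _ ⊗ₜ[T] _ = _ ⊗ₜ[T] _
    rw [tensorPowerMap_comp]
    congr 1
    induction v using TensorProduct.induction_on with
    | zero => simp
    | tmul a v => rfl
    | add a b ha hb => simp only [map_add, ha, hb]
  exact LinearMap.congr_fun h x.1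

end Schur

section Young

/-- The box numbered `a` of a Young diagram with `n` boxes: the boxes are numbered consecutively,
row by row, and given as pairs (row, column). -/
noncomputable def box (μ : YoungDiagram) (a : Fin μ.card) : ℕ × ℕ :=
  ofLex ((μ.cells.map toLex.toEmbedding).orderEmbOfFin (Finset.card_map _) a)

open Classical in
/-- The Young symmetrizer `c = a * b` in the group algebra of `S_n`, where `a` is the sum of all
permutations preserving the rows of the diagram, and `b` is the sum of all permutations preserving
its columns, weighted by their signs. -/
noncomputable def youngSymmetrizer (μ : YoungDiagram) :
    MonoidAlgebra ℂ (Equiv.Perm (Fin μ.card)) :=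
  (∑ g with ∀ a, (box μ (g a)).1 = (box μ a).1, MonoidAlgebra.single g 1) *
    ∑ g with ∀ a, (box μ (g a)).2 = (box μ a).2,
      MonoidAlgebra.single g ((Equiv.Perm.sign g : ℤ) : ℂ)

/-- The irreducible representation `V_μ = ℂ[S_n] c` of the symmetric group attached to a
partition `μ` of `n`, with `c` the Young symmetrizer. -/
abbrev Specht (μ : YoungDiagram) : Type := Ideal.span {youngSymmetrizer μ}

/-- The symmetric group acts on `V_μ = ℂ[S_n] c` by multiplication on the left. -/
noncomputable def spechtRep (μ : YoungDiagram) :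
    Representation ℂ (Equiv.Perm (Fin μ.card)) (Specht μ) where
  toFun g := ((Module.toModuleEnd ℂ (S := MonoidAlgebra ℂ (Equiv.Perm (Fin μ.card))) (Specht μ))
    (MonoidAlgebra.single g 1))
  map_one' := map_one _
  map_mul' g h := by rw [← map_mul, MonoidAlgebra.single_mul_single, one_mul]

end Young

section Sheaf

open Opposite

variable {M : Scheme.{0}} [M.Over (Spec (CommRingCat.of ℂ))]

/-- The functions on an open subset of a scheme over `ℂ` form a `ℂ`-algebra. -/
noncomputable instance sectionsAlgebra (U : M.Opens) : Algebra ℂ Γ(M, U) :=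
  ((Scheme.ΓSpecIso (CommRingCat.of ℂ)).inv ≫ (M ↘ Spec (CommRingCat.of ℂ)).appTop ≫
    M.presheaf.map (homOfLE le_top : U ⟶ ⊤).op).hom.toAlgebra

/-- The restriction of functions to a smaller open subset. -/
noncomputable def resAlgHom {U V : M.Opens} (i : U ⟶ V) : Γ(M, V) →ₐ[ℂ] Γ(M, U) :=
  { (M.presheaf.map i.op).hom with
    commutes' := fun c => by
      change (((Scheme.ΓSpecIso (CommRingCat.of ℂ)).inv ≫ (M ↘ Spec (CommRingCat.of ℂ)).appTop ≫
        M.presheaf.map (homOfLE le_top : V ⟶ ⊤).op) ≫ M.presheaf.map i.op).hom c = _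
      rw [Category.assoc, Category.assoc, ← M.presheaf.map_comp]
      rfl }

variable {n : ℕ} {V : Type} [AddCommGroup V] [Module ℂ V]
  (ρ : Representation ℂ (Equiv.Perm (Fin n)) V) (P : CochainComplex M.Modules ℤ)

/-- The sections over `U` of a complex of sheaves of modules. -/
noncomputable def sections (U : M.Opens) : CochainComplex (ModuleCat.{0} Γ(M, U)) ℤ where
  X a := ModuleCat.of Γ(M, U) Γ(P.X a, U)
  d a b := ModuleCat.ofHom
    { toFun := (P.d a b).app U
      map_add' := map_add _
      map_smul' := fun r x => Scheme.Modules.Hom.app_smul _ r x }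
  shape a b h := by
    ext x
    change (P.d a b).app U x = 0
    rw [P.shape a b h]
    rfl
  d_comp_d' a b c _ _ := by
    ext x
    change ((P.d a b) ≫ (P.d b c)).app U x = 0
    rw [P.d_comp_d]
    rfl

/-- The restriction maps of the terms of a complex of sheaves of modules. -/
noncomputable def sectionsRes {U V : M.Opens} (i : U ⟶ V) (a : ℤ) :
    (sections P V).X a →ₛₗ[(resAlgHom i : Γ(M, V) →+* Γ(M, U))] (sections P U).X a where
  toFun := (P.X a).presheaf.map i.op
  map_add' := map_add _
  map_smul' := fun r x => Scheme.Modules.map_smul _ i r x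

lemma sectionsRes_d {U V : M.Opens} (i : U ⟶ V) (a b : ℤ) (x : (sections P V).X a) :
    sectionsRes P i b ((sections P V).d a b x) = (sections P U).d a b (sectionsRes P i a x) :=
  (ConcreteCategory.congr_hom ((P.d a b).mapPresheaf.naturality i.op) x).symm

/-- The presheaf `U ↦ (V ⊗ P(U)^{⊗ n})^{S_n}` in degree `j`, as a presheaf of abelian groups. -/
noncomputable def presheafAb (j : ℤ) : M.Opensᵒᵖ ⥤ Ab.{0} where
  obj U := AddCommGrpCat.of (schurTerm ρ (sections P U.unop) j)
  map i := AddCommGrpCat.ofHom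
    (schurMap ρ j (resAlgHom i.unop) (sectionsRes P i.unop)).toAddMonoidHom
  map_id U := AddCommGrpCat.hom_ext <| AddMonoidHom.ext fun x =>
    schurMap_id ρ j (resAlgHom (𝟙 U).unop)
      (AlgHom.ext fun r => ConcreteCategory.congr_hom (M.presheaf.map_id U) r) _
      (fun a x => ConcreteCategory.congr_hom ((P.X a).presheaf.map_id U) x) x
  map_comp i k := AddCommGrpCat.hom_ext <| AddMonoidHom.ext fun x =>
    schurMap_comp ρ j (resAlgHom i.unop) (resAlgHom k.unop) (resAlgHom (i ≫ k).unop)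
      (AlgHom.ext fun r => ConcreteCategory.congr_hom (M.presheaf.map_comp i k) r)
      (sectionsRes P i.unop) (sectionsRes P k.unop) (sectionsRes P (i ≫ k).unop)
      (fun a x => ConcreteCategory.congr_hom ((P.X a).presheaf.map_comp i k) x) x

/-- The presheaf of modules `U ↦ (V ⊗ P(U)^{⊗ n})^{S_n}` in degree `j`. -/
noncomputable def presheafTerm (j : ℤ) : M.PresheafOfModules :=
  letI : ∀ U, Module (M.ringCatSheaf.obj.obj U) ((presheafAb ρ P j).obj U) := fun U =>
    inferInstanceAs (Module Γ(M, U.unop) (schurTerm ρ (sections P U.unop) j))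
  PresheafOfModules.ofPresheaf (presheafAb ρ P j) fun _ _ i r x =>
    (schurMap ρ j (resAlgHom i.unop) (sectionsRes P i.unop)).map_smulₛₗ r x

/-- The differential of the complex of presheaves of modules `U ↦ (V ⊗ P(U)^{⊗ n})^{S_n}`. -/
noncomputable def presheafDiff (j : ℤ) : presheafTerm ρ P j ⟶ presheafTerm ρ P (j + 1) :=
  PresheafOfModules.homMk
    { app := fun U => AddCommGrpCat.ofHom (schurDiff ρ (sections P U.unop) j).toAddMonoidHom
      naturality := fun _ _ i => AddCommGrpCat.hom_ext <| AddMonoidHom.ext fun x =>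
        (schurMap_diff ρ j (resAlgHom i.unop) (sectionsRes P i.unop)
          (fun a b x => sectionsRes_d P i.unop a b x) x).symm }
    fun U r x => (schurDiff ρ (sections P U.unop) j).map_smul r x

/-- The complex of presheaves of modules `U ↦ (V ⊗ P(U)^{⊗ n})^{S_n}`. -/
noncomputable def presheafComplex : CochainComplex M.PresheafOfModules ℤ :=
  CochainComplex.of (presheafTerm ρ P) (presheafDiff ρ P) fun j => by
    ext U x
    exact schurDiff_schurDiff ρ (sections P U.unop) j x

variable (M) in
/-- The sheafification of presheaves of modules on a scheme. -/
noncomputable def sheafify : M.PresheafOfModules ⥤ M.Modules :=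
  PresheafOfModules.sheafification (𝟙 M.ringCatSheaf.obj)

instance sheafify_isLeftAdjoint : (sheafify M).IsLeftAdjoint :=
  inferInstanceAs (PresheafOfModules.sheafification (𝟙 M.ringCatSheaf.obj)).IsLeftAdjoint

/-- The complex of sheaves of modules `(V ⊗ P^{⊗ n})^{S_n}`. As sheafification commutes with tensor
products, direct sums and invariants, it is obtained by applying the construction to the sections
of `P` over open subsets and sheafifying the result. -/
noncomputable def invariantComplex : CochainComplex M.Modules ℤ :=
  ((sheafify M).mapHomologicalComplex _).obj (presheafComplex ρ P)

/-- The Schur complex `S_μ(P) = (V_μ ⊗ P^{⊗ n})^{S_n}` of a complex `P` of sheaves of modules, where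
`μ` is a partition of `n`. -/
noncomputable def schurComplex (μ : YoungDiagram) (P : CochainComplex M.Modules ℤ) :
    CochainComplex M.Modules ℤ :=
  invariantComplex (spechtRep μ) P

end Sheaf

end SchurComplex

section KGroup

variable {C : Type*} [Category* C] [Abelian C] (A : ObjectProperty C)

/-- The Grothendieck group of a full subcategory of an abelian category: the abelian group generated
by the objects, with a relation `[Y] = [X] + [Z]` for each short exact sequence `0 → X → Y → Z → 0`
with terms in the subcategory. -/
def KGroup : Type _ :=
  FreeAbelianGroup A.FullSubcategory ⧸ AddSubgroup.closure
    {x | ∃ (S : ShortComplex C) (_ : S.ShortExact) (h₁ : A S.X₁) (h₂ : A S.X₂) (h₃ : A S.X₃),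
      x = .of ⟨S.X₂, h₂⟩ - (.of ⟨S.X₁, h₁⟩ + .of ⟨S.X₃, h₃⟩)}

instance : AddCommGroup (KGroup A) :=
  inferInstanceAs (AddCommGroup (FreeAbelianGroup A.FullSubcategory ⧸ _))

variable {A}

/-- The class of an object in the Grothendieck group. -/
def KGroup.mk (X : C) (hX : A X) : KGroup A :=
  QuotientAddGroup.mk (FreeAbelianGroup.of ⟨X, hX⟩)

/-- The complex `K` has only finitely many nonzero terms. -/
def IsBoundedComplex (K : CochainComplex C ℤ) : Prop :=
  ∃ a b : ℤ, ∀ i, i < a ∨ b < i → Limits.IsZero (K.X i)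

/-- The class `∑ (-1) ^ i [K^i]` of a bounded complex with terms in the subcategory. -/
noncomputable def KGroup.ofComplex (K : CochainComplex C ℤ) (hK : ∀ i, A (K.X i)) : KGroup A :=
  ∑ᶠ i : ℤ, (i.negOnePow : ℤ) • KGroup.mk (K.X i) (hK i)

end KGroup

/-- The sheaf of modules `E` is a vector bundle, i.e. locally free of finite rank: each point has an
open neighborhood over which `E` is isomorphic to a finite direct sum of copies of the structure
sheaf. -/
def isVectorBundle (M : Scheme.{0}) : ObjectProperty M.Modules := fun E =>
  ∀ x : M, ∃ (U : M.Opens) (_ : x ∈ U) (r : ℕ),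
    Nonempty (E.restrict U.ι ≅ (SheafOfModules.free (Fin r) : (U : Scheme.{0}).Modules))

/-- The sheaf of modules `E` is quasi-coherent and of finite type. On a locally noetherian scheme,
this means that `E` is coherent. -/
def isCoherent (M : Scheme.{0}) : ObjectProperty M.Modules := fun E =>
  E.IsQuasicoherent ∧ E.IsFiniteType

/-! The class of a complex forgets its differential, and the terms of a Schur complex depend only on
the terms of the given complex. So it is enough to replace `P` and `Q` by complexes with isomorphic
terms without changing the classes of their Schur complexes. Such complexes are `P ⊞ cone s` and `Q
⊞ cone (𝟙 P)`: in degree `i` both are sums of `P^i`, `P^{i+1}` and `Q^i`, and both added cones are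
acyclic (`ofComplex_schurComplex_eq`).

It remains to add an acyclic bounded complex of vector bundles `C` to `P`. The cycles of `C` are
vector bundles, so `C` is locally contractible (`exists_contraction`). Hence the idempotent of `P ⊞
C` with image `P` is locally homotopic to the identity. Such a homotopy extends to tensor powers
(`diff_homotopy_add`), and averaging over `S_n`, possible in characteristic zero, carries it to the
invariants (`exists_schurDiff_eq`). The local homotopies need not glue, but they suffice to show
that the idempotent acts as the identity on the homology sheaves (`homologyMap_invariantMap_eq_id`).
So the inclusion of `P` induces a quasi-isomorphism of Schur complexes. A quasi-isomorphism of
bounded complexes of vector bundles preserves the class, since the class of its acyclic cone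
telescopes to zero (`KGroup.ofComplex_eq_of_quasiIso`).

The terms of Schur complexes are vector bundles because averaging makes the invariants a direct
summand of a locally free module, and such a summand is locally free
(`IsFrame.exists_isFrame_of_idempotent`). The equality for coherent sheaves is the image of the one
for vector bundles under the natural map of Grothendieck groups. -/

namespace SchurComplex

/-! ### Extending a homotopy to tensor powers -/

section Contraction

variable {R : Type} [CommRing R] {K : CochainComplex (ModuleCat.{0} R) ℤ} {n : ℕ} {j : ℤ}

/-- Replacing an entry by another of the same degree stays in the same summand of the tensor power,
so this is multilinearity of the pure tensor. -/
lemma homog_update_add (y : Fin n → Σ a, K.X a) (k : Fin n) (u v : K.X (y k).1)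
    (h : ∀ w : K.X (y k).1, ∑ l, (Function.update y k ⟨(y k).1, w⟩ l).1 = j) :
    homog (Function.update y k ⟨(y k).1, u + v⟩) (h _) =
      homog (Function.update y k ⟨(y k).1, u⟩) (h _) +
        homog (Function.update y k ⟨(y k).1, v⟩) (h _) := by
  have e : ∀ w : K.X (y k).1, Function.update y k ⟨(y k).1, w⟩ =
      fun l => ⟨(y l).1, Function.update (fun l => (y l).2) k w l⟩ := fun w => by
    funext l
    by_cases hl : l = k
    · subst hl; simp
    · simp [hl]
  have hs : ∑ l, (y l).1 = j := by
    have := h 0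
    simp only [e] at this
    exact this
  rw [homog_congr (e _), homog_congr (e _), homog_congr (e _)]
  unfold homog
  rw [MultilinearMap.map_update_add, map_add]

lemma sum_update_sub {i : Fin n → ℤ} (h : ∑ k, i k = j + 1) (k : Fin n) :
    ∑ l, Function.update i k (i k - 1) l = j := by
  have := Finset.add_sum_erase Finset.univ i (Finset.mem_univ k)
  rw [Finset.sum_update_of_mem (Finset.mem_univ k), Finset.sdiff_singleton_eq_erase]
  linarith

variable (e : ∀ a, K.X a →ₗ[R] K.X a) (h : ∀ a b, K.X a →ₗ[R] K.X b)

/-- The factor `l` of the map `e ⊗ ⋯ ⊗ e ⊗ h ⊗ 1 ⊗ ⋯ ⊗ 1`, with `h` at the place `k`. -/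
noncomputable def lowerMap (i : Fin n → ℤ) (k l : Fin n) :
    K.X (i l) →ₗ[R] K.X (Function.update i k (i k - 1) l) :=
  if hl : l = k then h _ _
  else (K.XIsoOfEq (Function.update_of_ne hl (i k - 1) i).symm).hom.hom ∘ₗ
    (if l < k then e (i l) else LinearMap.id)

variable (n j) in
/-- The homotopy `∑ k, ± e ⊗ ⋯ ⊗ e ⊗ h ⊗ 1 ⊗ ⋯ ⊗ 1`, with `h` at the place `k`, on the tensor
power of a complex. -/
noncomputable def homotopy : TensorPower K n (j + 1) →ₗ[R] TensorPower K n j :=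
  DirectSum.toModule R _ _ fun i => ∑ k, (prefixSign i.1 k : ℤ) •
    (DirectSum.lof R _ (fun i : {i : Fin n → ℤ // ∑ k, i k = j} => ⨂[R] k, K.X (i.1 k))
      ⟨Function.update i.1 k (i.1 k - 1), sum_update_sub i.2 k⟩ ∘ₗ
        PiTensorProduct.map (lowerMap e h i.1 k))

/-- The family `y` with `e` applied to the first `m` entries. -/
noncomputable def initial (y : Fin n → Σ a, K.X a) (m : ℕ) : Fin n → Σ a, K.X a :=
  fun l => if l.1 < m then ⟨(y l).1, e _ (y l).2⟩ else y l

/-- The family `y` with `h` applied to the entry `k` and `e` applied to the preceding entries. -/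
noncomputable def lower (y : Fin n → Σ a, K.X a) (k : Fin n) : Fin n → Σ a, K.X a :=
  Function.update (initial e y k) k ⟨(y k).1 - 1, h _ _ (y k).2⟩

lemma initial_fst (y : Fin n → Σ a, K.X a) (m : ℕ) (l : Fin n) :
    (initial e y m l).1 = (y l).1 := by
  unfold initial
  split_ifs <;> rfl

lemma lower_fst (y : Fin n → Σ a, K.X a) (k : Fin n) :
    (fun l => (lower e h y k l).1) = Function.update (fun l => (y l).1) k ((y k).1 - 1) := by
  funext l
  by_cases hl : l = k
  · subst hl; simp [lower]
  · simp [lower, hl, initial_fst]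

lemma sum_lower {y : Fin n → Σ a, K.X a} (hy : ∑ k, (y k).1 = j + 1) (k : Fin n) :
    ∑ l, (lower e h y k l).1 = j := by
  have := sum_update_sub (i := fun l => (y l).1) hy k
  rw [← lower_fst e h] at this
  exact this

lemma map_sigma {a b c : ℤ} (hbc : b = c) (x : K.X a) :
    (⟨b, h a b x⟩ : Σ a, K.X a) = ⟨c, h a c x⟩ := by
  subst hbc; rfl

lemma homotopy_homog (y : Fin n → Σ a, K.X a) (hy : ∑ k, (y k).1 = j + 1) :
    homotopy n j e h (homog y hy) =
      ∑ k, (prefixSign (fun k => (y k).1) k : ℤ) • homog (lower e h y k) (sum_lower e h hy k) := by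
  unfold homotopy
  conv_lhs => rw [homog, DirectSum.toModule_lof]
  simp only [LinearMap.sum_apply, LinearMap.smul_apply, LinearMap.comp_apply,
    PiTensorProduct.map_tprod]
  refine Finset.sum_congr rfl fun k _ => congrArg _ ?_
  refine homog_congr (y := fun l => ⟨Function.update (fun l => (y l).1) k ((y k).1 - 1) l,
    lowerMap e h (fun l => (y l).1) k l (y l).2⟩) ?_ _
  funext l
  by_cases hl : l = k
  · subst hl
    simp only [lower, lowerMap, dif_pos, Function.update_self]
    exact map_sigma h (by simp) _
  · simp only [lower, lowerMap, dif_neg hl, Function.update_of_ne hl, LinearMap.comp_apply]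
    refine (XIsoOfEq_sigma (Function.update_of_ne hl _ (fun l => (y l).1)).symm _).trans ?_
    unfold initial
    by_cases hlk : l < k
    · rw [if_pos hlk, if_pos (Fin.lt_def.mp hlk)]
    · rw [if_neg hlk, if_neg (mt Fin.lt_def.mpr hlk)]; rfl

/-- Lowering a degree changes its parity just as raising it does; the formula for raising is applied
to the lowered degrees. -/
lemma prefixSign_update_sub (i : Fin n → ℤ) (k l : Fin n) :
    prefixSign (Function.update i k (i k - 1)) l =
      (if k < l then -1 else 1) * prefixSign i l := by
  have := prefixSign_update (Function.update i k (i k - 1)) k l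
  simp only [Function.update_self, Function.update_idem, sub_add_cancel,
    Function.update_eq_self] at this
  rw [this, ← mul_assoc]
  split_ifs <;> simp

/-- The maps `d` and `h` act on different factors. If `l` precedes `k`, the factor `l` also carries
`e`, which is where `he` enters. -/
lemma step_lower (he : ∀ a b x, e b (K.d a b x) = K.d a b (e a x)) (y : Fin n → Σ a, K.X a)
    {k l : Fin n} (hkl : k ≠ l) : step (lower e h y k) l = lower e h (step y l) k := by
  unfold step lower
  rw [Function.update_of_ne hkl, Function.update_of_ne hkl.symm, Function.update_comm hkl]
  congr 1
  funext m
  by_cases hm : m = l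
  · subst hm
    rw [Function.update_self]
    by_cases hmk : m.1 < k.1
    · have h1 : initial e y k m = ⟨(y m).1, e _ (y m).2⟩ := if_pos hmk
      rw [h1]
      unfold initial
      rw [if_pos hmk, Function.update_self, he]
    · have h1 : initial e y k m = y m := if_neg hmk
      rw [h1]
      unfold initial
      rw [if_neg hmk, Function.update_self]
  · rw [Function.update_of_ne hm]
    unfold initial
    rw [Function.update_of_ne hm]

lemma sum_initial {y : Fin n → Σ a, K.X a} (hy : ∑ k, (y k).1 = j) (m : ℕ) :
    ∑ l, (initial e y m l).1 = j := by
  simp only [initial_fst, hy]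

variable (hh : ∀ a x, K.d (a - 1) a (h a (a - 1) x) + h (a + 1) a (K.d a (a + 1) x) = x - e a x)

include hh in
-- In the factor `k`, the sum `dh + hd` is `1 - e`, while the preceding factors carry `e` already.
-- The result is one step of a telescope from `x₁ ⊗ ⋯ ⊗ xₙ` to `e x₁ ⊗ ⋯ ⊗ e xₙ`.
lemma homog_step_lower_add (y : Fin n → Σ a, K.X a) (hy : ∑ k, (y k).1 = j + 1) (k : Fin n) :
    homog (step (lower e h y k) k) (sum_step (sum_lower e h hy k) k) +
      homog (lower e h (step y k) k) (sum_lower e h (sum_step hy k) k) =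
    homog (initial e y k) (sum_initial e hy k) -
      homog (initial e y (k + 1)) (sum_initial e hy (k + 1)) := by
  have h0 : initial e y k k = y k := by simp [initial]
  have hs : ∀ w : K.X (initial e y k k).1,
      ∑ l, (Function.update (initial e y k) k ⟨(initial e y k k).1, w⟩ l).1 = j + 1 := by
    intro w
    rw [← hy]
    refine Finset.sum_congr rfl fun l _ => ?_
    by_cases hl : l = k
    · subst hl; simp [h0]
    · simp [hl, initial_fst]
  have h1 : step (lower e h y k) k = Function.update (initial e y k) k ⟨(y k).1,
      K.d ((y k).1 - 1) (y k).1 (h _ _ (y k).2)⟩ := by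
    unfold step lower
    rw [Function.update_self, Function.update_idem]
    congr 1
    exact d_sigma (by simp) _
  have h2 : lower e h (step y k) k = Function.update (initial e y k) k ⟨(y k).1,
      h _ _ (K.d (y k).1 ((y k).1 + 1) (y k).2)⟩ := by
    have : step y k k = ⟨(y k).1 + 1, K.d _ _ (y k).2⟩ := Function.update_self _ _ _
    unfold lower
    rw [this]
    refine funext fun l => ?_
    by_cases hl : l = k
    · subst hl
      rw [Function.update_self, Function.update_self]
      exact map_sigma h (by simp) _
    · rw [Function.update_of_ne hl, Function.update_of_ne hl]
      unfold initial step
      rw [Function.update_of_ne hl]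
  have h3 : initial e y (k + 1) = Function.update (initial e y k) k ⟨(y k).1, e _ (y k).2⟩ := by
    funext l
    by_cases hl : l = k
    · subst hl; simp [initial]
    · have : l.1 ≠ k.1 := fun h => hl (Fin.ext h)
      have h' : l.1 < k.1 + 1 ↔ l.1 < k.1 := by omega
      simp [initial, hl, h']
  have h4 : initial e y k = Function.update (initial e y k) k ⟨(y k).1, (y k).2⟩ := by
    conv_lhs => rw [← Function.update_eq_self k (initial e y k), h0]
  have key := fun u v => homog_update_add (initial e y k) k u v hs
  rw [eq_sub_iff_add_eq]
  rw [homog_congr h1, homog_congr h2, homog_congr h3]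
  refine Eq.trans ?_ (homog_congr h4.symm (h4 ▸ sum_initial e hy k))
  have hx := hh _ (y k).2
  rw [eq_sub_iff_add_eq] at hx
  -- The type of the new entry involves the degree of `initial e y k k`; `h0` can replace it by that
  -- of `y k` only after reverting.
  revert hs key
  rw [h0]
  intro hs key
  rw [← key, ← key, hx]

lemma tensorPowerMap_homog_id {y : Fin n → Σ a, K.X a} (hy : ∑ k, (y k).1 = j) :
    tensorPowerMap n j e (homog y hy) = homog (initial e y n) (sum_initial e hy n) := by
  rw [tensorPowerMap_homog]
  refine homog_congr ?_ _
  funext l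
  simp [initial]

include hh in
/-- If `h` is a homotopy from `e` to the identity, then the homotopy on the tensor power is a
homotopy from `e ⊗ ⋯ ⊗ e` to the identity. -/
lemma diff_homotopy_add (he : ∀ a b x, e b (K.d a b x) = K.d a b (e a x))
    (t : TensorPower K n (j + 1)) :
    diff K n j (homotopy n j e h t) + homotopy n (j + 1) e h (diff K n (j + 1) t) =
      t - tensorPowerMap n (j + 1) e t := by
  refine LinearMap.congr_fun (f := diff K n j ∘ₗ homotopy n j e h +
    homotopy n (j + 1) e h ∘ₗ diff K n (j + 1))
    (g := LinearMap.id - tensorPowerMap n (j + 1) e) (linearMap_ext fun y hy => ?_) t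
  simp only [LinearMap.add_apply, LinearMap.comp_apply, LinearMap.sub_apply, LinearMap.id_apply,
    diff_homog, homotopy_homog, map_sum, map_zsmul, Finset.smul_sum, smul_smul]
  rw [Finset.sum_comm (γ := Fin n) (s := Finset.univ) (t := Finset.univ) (f := fun l k =>
    (((prefixSign (fun k => (y k).1) l : ℤˣ) : ℤ) *
      ((prefixSign (fun k => (step y l k).1) k : ℤˣ) : ℤ)) •
      homog (lower e h (step y l) k) (sum_lower e h (sum_step hy l) k)), ← Finset.sum_add_distrib]
  -- For a fixed place `k` of `h`, the terms with `d` at another place cancel by the Koszul signs,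
  -- and only `d` at `k` contributes.
  have key : ∀ k, (∑ l, (((prefixSign (fun k => (y k).1) k : ℤˣ) : ℤ) *
        ((prefixSign (fun l => (lower e h y k l).1) l : ℤˣ) : ℤ)) •
          homog (step (lower e h y k) l) (sum_step (sum_lower e h hy k) l)) +
      (∑ l, (((prefixSign (fun k => (y k).1) l : ℤˣ) : ℤ) *
        ((prefixSign (fun k => (step y l k).1) k : ℤˣ) : ℤ)) •
          homog (lower e h (step y l) k) (sum_lower e h (sum_step hy l) k)) =
      homog (initial e y k) (sum_initial e hy k) -
        homog (initial e y (k + 1)) (sum_initial e hy (k + 1)) := by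
    intro k
    rw [← Finset.sum_add_distrib, Finset.sum_eq_single k]
    · rw [← homog_step_lower_add e h hh y hy]
      simp only [lower_fst, step_fst, prefixSign_update_sub, prefixSign_update]
      simp [← Units.val_mul]
    · intro l _ hlk
      rw [homog_congr (step_lower e h he y hlk.symm), ← add_smul]
      simp only [lower_fst, step_fst, prefixSign_update_sub, prefixSign_update]
      rcases lt_or_gt_of_ne hlk with hl | hl <;> simp [hl, hl.not_gt, mul_comm]
    · simp
  rw [Finset.sum_congr rfl fun k _ => key k, tensorPowerMap_homog_id]
  -- The sum over `k` telescopes: at `m = 0` no entry carries `e`, at `m = n` all of them do.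
  have hf := Finset.sum_range_sub' (fun m => homog (initial e y m) (sum_initial e hy m)) n
  rw [← Fin.sum_univ_eq_sum_range (fun m => homog (initial e y m) (sum_initial e hy m) -
    homog (initial e y (m + 1)) (sum_initial e hy (m + 1)))] at hf
  rw [hf]
  congr 1

end Contraction

/-! ### Averaging over the symmetric group -/

section Average

variable {n : ℕ} {V : Type} [AddCommGroup V] [Module ℂ V]
  (ρ : Representation ℂ (Equiv.Perm (Fin n)) V)
  {R : Type} [CommRing R] [Algebra ℂ R] (K : CochainComplex (ModuleCat.{0} R) ℤ) (j : ℤ)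

/-- The projection of `V ⊗ K^{⊗ n}` onto its invariants. -/
noncomputable def average (x : TwistedPower V K n j) : TwistedPower V K n j :=
  algebraMap ℂ R ((n.factorial : ℂ)⁻¹) • ∑ σ, twistedRep ρ K j σ x

lemma average_mem (x : TwistedPower V K n j) : average ρ K j x ∈ schurTerm ρ K j := by
  intro τ
  unfold average
  rw [map_smul, map_sum]
  congr 1
  rw [← Equiv.sum_comp (Equiv.mulLeft τ) fun σ => twistedRep ρ K j σ x]
  simp [map_mul]

lemma average_of_mem {x : TwistedPower V K n j} (hx : x ∈ schurTerm ρ K j) :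
    average ρ K j x = x := by
  have h : (n.factorial : R) = algebraMap ℂ R n.factorial := by simp
  unfold average
  rw [Finset.sum_congr rfl fun σ _ => hx σ, Finset.sum_const, Finset.card_univ,
    Fintype.card_perm, Fintype.card_fin, ← Nat.cast_smul_eq_nsmul R, smul_smul, h, ← map_mul,
    inv_mul_cancel₀ (by exact_mod_cast n.factorial_ne_zero), map_one, one_smul]

lemma average_add (x y : TwistedPower V K n j) :
    average ρ K j (x + y) = average ρ K j x + average ρ K j y := by
  simp only [average, map_add, Finset.sum_add_distrib, smul_add]

lemma average_smul (c : R) (x : TwistedPower V K n j) :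
    average ρ K j (c • x) = c • average ρ K j x := by
  simp only [average, map_smul, ← Finset.smul_sum]
  rw [smul_comm]

lemma map_diff_twistedRep (σ : Equiv.Perm (Fin n)) (x : TwistedPower V K n j) :
    TensorProduct.map LinearMap.id (diff K n j) (twistedRep ρ K j σ x) =
      twistedRep ρ K (j + 1) σ (TensorProduct.map LinearMap.id (diff K n j) x) := by
  have h : twistedRep ρ K (j + 1) σ ∘ₗ TensorProduct.map LinearMap.id (diff K n j) =
      TensorProduct.map LinearMap.id (diff K n j) ∘ₗ twistedRep ρ K j σ :=
    TensorProduct.ext' fun v t => congrArg (fun z => _ ⊗ₜ[R] z)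
      (LinearMap.congr_fun (diff_permMap σ) t).symm
  exact (LinearMap.congr_fun h x).symm

lemma map_diff_average (x : TwistedPower V K n j) :
    TensorProduct.map LinearMap.id (diff K n j) (average ρ K j x) =
      average ρ K (j + 1) (TensorProduct.map LinearMap.id (diff K n j) x) := by
  simp only [average, map_smul, map_sum, map_diff_twistedRep]

variable {K}

/-- The homotopy `H` on `V ⊗ K^{⊗ n}` treats the factors asymmetrically and need not preserve
invariants, so `H x` is averaged. Since `x` is a cycle, `D (H x) = x - E x`; averaging commutes with
`D` and fixes the invariant elements `x` and `E x`. -/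
lemma exists_schurDiff_eq (e : ∀ a, K.X a →ₗ[R] K.X a)
    (r : ∀ a, K.X a →ₛₗ[((AlgHom.id ℂ R : R →ₐ[ℂ] R) : R →+* R)] K.X a) (hr : ∀ a x, r a x = e a x)
    (he : ∀ a b x, e b (K.d a b x) = K.d a b (e a x)) (h : ∀ a b, K.X a →ₗ[R] K.X b)
    (hh : ∀ a x, K.d (a - 1) a (h a (a - 1) x) + h (a + 1) a (K.d a (a + 1) x) = x - e a x)
    (x : schurTerm ρ K (j + 1)) (hx : schurDiff ρ K (j + 1) x = 0) :
    ∃ y, schurDiff ρ K j y = x - schurMap ρ (j + 1) (AlgHom.id ℂ R) r x := by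
  -- The maps `e` and `r` agree; `r` is only typed as semilinear over the identity homomorphism of
  -- algebras, as `schurMap` requires.
  obtain rfl : e = r := funext fun a => LinearMap.ext fun x => (hr a x).symm
  let H := TensorProduct.map (LinearMap.id : R ⊗[ℂ] V →ₗ[R] R ⊗[ℂ] V) (homotopy n j e h)
  let H' := TensorProduct.map (LinearMap.id : R ⊗[ℂ] V →ₗ[R] R ⊗[ℂ] V) (homotopy n (j + 1) e h)
  let D := TensorProduct.map (LinearMap.id : R ⊗[ℂ] V →ₗ[R] R ⊗[ℂ] V) (diff K n j)
  let D' := TensorProduct.map (LinearMap.id : R ⊗[ℂ] V →ₗ[R] R ⊗[ℂ] V) (diff K n (j + 1))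
  let E := TensorProduct.map (LinearMap.id : R ⊗[ℂ] V →ₗ[R] R ⊗[ℂ] V) (tensorPowerMap n (j + 1) e)
  have h1 : D ∘ₗ H + H' ∘ₗ D' + E = LinearMap.id := by
    refine TensorProduct.ext' fun v t => ?_
    simp only [D, H, D', H', E, LinearMap.add_apply, LinearMap.comp_apply, TensorProduct.map_tmul,
      LinearMap.id_apply, ← TensorProduct.tmul_add, diff_homotopy_add e h hh he, sub_add_cancel]
  have h2 : ∀ x, TensorProduct.map (scalarMap V (AlgHom.id ℂ R)) (tensorPowerMap n (j + 1) e) x =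
      E x := by
    intro x
    have : TensorProduct.map (scalarMap V (AlgHom.id ℂ R)) (tensorPowerMap n (j + 1) e) = E :=
      TensorProduct.ext' fun v t => congrArg (fun a => a ⊗ₜ[R] tensorPowerMap n (j + 1) e t)
        (LinearMap.congr_fun TensorProduct.map_id v)
    exact LinearMap.congr_fun this x
  have hD : D' x.1 = 0 := congrArg Subtype.val hx
  refine ⟨⟨average ρ K j (H x.1), average_mem ρ K j _⟩, eq_sub_of_add_eq (Subtype.ext ?_)⟩
  have h3 : D (H x.1) + E x.1 = x.1 := by
    have := LinearMap.congr_fun h1 x.1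
    simp only [LinearMap.add_apply, LinearMap.comp_apply, hD, map_zero, add_zero] at this
    exact this
  have h4 : E x.1 ∈ schurTerm ρ K (j + 1) := by
    rw [← h2]
    exact (schurMap ρ (j + 1) (AlgHom.id ℂ R) e x).2
  change D (average ρ K j (H x.1)) +
    TensorProduct.map (scalarMap V (AlgHom.id ℂ R)) (tensorPowerMap n (j + 1) e) x.1 = x.1
  rw [h2, map_diff_average ρ K j (H x.1)]
  conv_lhs => rw [← average_of_mem ρ K (j + 1) h4, ← average_add]
  exact (congrArg _ h3).trans (average_of_mem ρ K (j + 1) x.2)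

end Average

end SchurComplex

/-! ### Frames of presheaves of modules, and direct summands -/

lemma Matrix.exists_det_ne_zero_of_span_eq_top {k ι κ : Type*} [Field k] [Fintype ι]
    [DecidableEq ι] (v : κ → ι → k) (hv : Submodule.span k (Set.range v) = ⊤) :
    ∃ a : ι → κ, (Matrix.of fun l m => v (a m) l).det ≠ 0 := by
  -- A basis extracted from the spanning family can be indexed by `ι`; its members are the columns
  -- of an invertible matrix.
  obtain ⟨κ', a, -, hs, hli⟩ := exists_linearIndependent' k v
  let b := Module.Basis.mk hli (hs.trans hv).ge
  let e := (Pi.basisFun k ι).indexEquiv b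
  refine ⟨a ∘ e, ?_⟩
  rw [← isUnit_iff_ne_zero, ← Matrix.isUnit_iff_isUnit_det,
    ← Matrix.linearIndependent_cols_iff_isUnit]
  exact hli.comp e e.injective

section ModuleFamily

variable {M : Scheme.{0}}

/-- The restriction of functions to a smaller open subset. -/
noncomputable def AlgebraicGeometry.Scheme.resHom {U V : M.Opens} (h : V ≤ U) :
    Γ(M, U) →+* Γ(M, V) :=
  (M.presheaf.map (homOfLE h).op).hom

lemma AlgebraicGeometry.Scheme.resHom_resHom {U V W : M.Opens} (h : V ≤ U) (h' : W ≤ V)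
    (f : Γ(M, U)) : Scheme.resHom h' (Scheme.resHom h f) = Scheme.resHom (h'.trans h) f :=
  (ConcreteCategory.congr_hom (M.presheaf.map_comp (homOfLE h).op (homOfLE h').op) f).symm

variable (M) in
/-- A presheaf of modules on a scheme, given by its modules of sections and its restriction
maps. -/
structure ModuleFamily where
  obj : M.Opens → Type
  addCommGroup : ∀ U, AddCommGroup (obj U)
  module : ∀ U, Module Γ(M, U) (obj U)
  res : ∀ {U V : M.Opens} (_ : V ≤ U), obj U →+ obj V
  res_smul : ∀ {U V : M.Opens} (h : V ≤ U) (r : Γ(M, U)) (x : obj U),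
    res h (r • x) = Scheme.resHom h r • res h x
  res_res : ∀ {U V W : M.Opens} (h : V ≤ U) (h' : W ≤ V) (x : obj U),
    res h' (res h x) = res (h'.trans h) x

namespace ModuleFamily

attribute [instance] addCommGroup module

variable (F G : ModuleFamily M)

/-- The sections `e` form a basis of the module of sections over each open subset of `U`. -/
def IsFrame (U : M.Opens) {ι : Type} [Fintype ι] (e : ι → F.obj U) : Prop :=
  ∀ (V : M.Opens) (h : V ≤ U),
    Function.Bijective fun c : ι → Γ(M, V) => ∑ k, c k • F.res h (e k)

variable {F G} {U V : M.Opens} {ι κ : Type} [Fintype ι] [Fintype κ] {e : ι → F.obj U}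

lemma IsFrame.res (he : F.IsFrame U e) (h : V ≤ U) : F.IsFrame V fun k => F.res h (e k) := by
  intro W hW
  simp only [F.res_res]
  exact he W (hW.trans h)

/-- The basis of the module of sections over an open subset given by a frame. -/
noncomputable def IsFrame.basis (he : F.IsFrame U e) (h : V ≤ U) :
    Module.Basis ι Γ(M, V) (F.obj V) :=
  Module.Basis.ofEquivFun (LinearEquiv.ofBijective
    (Fintype.linearCombination Γ(M, V) fun k => F.res h (e k)) (he V h)).symm

lemma IsFrame.basis_apply (he : F.IsFrame U e) (h : V ≤ U) (k : ι) :
    he.basis h k = F.res h (e k) := by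
  classical
  rw [IsFrame.basis, Module.Basis.coe_ofEquivFun]
  refine (Fintype.linearCombination_apply_single Γ(M, V) (fun k => F.res h (e k)) k 1).trans ?_
  rw [one_smul]

lemma isFrame_of_basis (b : ∀ V (_ : V ≤ U), Module.Basis ι Γ(M, V) (F.obj V))
    (hb : ∀ V h k, b V h k = F.res h (e k)) : F.IsFrame U e := by
  intro V h
  convert (b V h).equivFun.symm.bijective using 2 with c
  simp [Module.Basis.equivFun_symm_apply, hb]

lemma IsFrame.reindex (he : F.IsFrame U e) (f : κ ≃ ι) : F.IsFrame U (e ∘ f) :=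
  isFrame_of_basis (fun _ h => (he.basis h).reindex f.symm) fun V h k => by
    simp [he.basis_apply]

/-- The new coordinate map is the old one composed with multiplication by the restricted matrix,
whose determinant stays a unit on every smaller open set. -/
lemma IsFrame.of_isUnit_det [DecidableEq ι] (he : F.IsFrame U e) (B : Matrix ι ι Γ(M, U))
    (hB : IsUnit B.det) : F.IsFrame U fun m => ∑ l, B l m • e l := by
  intro V h
  have hB' : IsUnit ((Scheme.resHom h).mapMatrix B) := by
    rw [Matrix.isUnit_iff_isUnit_det, ← RingHom.map_det]
    exact hB.map _
  have hbij : Function.Bijective ((Scheme.resHom h).mapMatrix B).mulVec :=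
    ⟨Matrix.mulVec_injective_of_isUnit hB', Matrix.mulVec_surjective_iff_isUnit.mpr hB'⟩
  convert (he V h).comp hbij using 2 with c
  simp only [Function.comp_apply, Matrix.mulVec, dotProduct, map_sum, F.res_smul, Finset.smul_sum,
    Finset.sum_smul]
  rw [Finset.sum_comm]
  refine Finset.sum_congr rfl fun l _ => Finset.sum_congr rfl fun m _ => ?_
  rw [smul_smul, mul_comm]
  rfl

/-- A subfamily which is the image of an idempotent endomorphism of a family with a frame locally
has a frame. -/
lemma IsFrame.exists_isFrame_of_idempotent (he : F.IsFrame U e)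
    (i : ∀ V, V ≤ U → G.obj V →ₗ[Γ(M, V)] F.obj V) (q : ∀ V, V ≤ U → F.obj V →ₗ[Γ(M, V)] F.obj V)
    (hi : ∀ V h, Function.Injective (i V h)) (hqi : ∀ V h x, q V h (i V h x) = i V h x)
    (hq : ∀ V h x, ∃ y, i V h y = q V h x)
    (ires : ∀ V (h : V ≤ U) W (h' : W ≤ V) x,
      i W (h'.trans h) (G.res h' x) = F.res h' (i V h x))
    (qres : ∀ V (h : V ≤ U) W (h' : W ≤ V) x,
      q W (h'.trans h) (F.res h' x) = F.res h' (q V h x))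
    (x : M) (hx : x ∈ U) :
    ∃ W : M.Opens, x ∈ W ∧ W ≤ U ∧ ∃ (r : ℕ) (g : Fin r → G.obj W), G.IsFrame W g := by
  classical
  have hqq : ∀ V h y, q V h (q V h y) = q V h y := fun V h y => by
    obtain ⟨z, hz⟩ := hq V h y
    rw [← hz, hqi]
  let b := he.basis le_rfl
  let q₀ := q U le_rfl
  -- As `b k` is the sum of `q₀ (b k)` and `b k - q₀ (b k)`, these sections span the fiber at `x`.
  -- Each of them is either fixed or killed by `q₀`.
  let f : ι ⊕ ι → F.obj U := Sum.elim (fun k => q₀ (b k)) (fun k => b k - q₀ (b k))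
  let ev := (M.evaluation U x hx).hom
  let v : ι ⊕ ι → ι → M.residueField x := fun s l => ev (b.repr (f s) l)
  have hv : Submodule.span (M.residueField x) (Set.range v) = ⊤ := by
    rw [eq_top_iff, ← (Pi.basisFun (M.residueField x) ι).span_eq, Submodule.span_le]
    rintro _ ⟨k, rfl⟩
    have : Pi.basisFun (M.residueField x) ι k = v (.inl k) + v (.inr k) := by
      funext l
      simp only [v, f, Sum.elim_inl, Sum.elim_inr, Pi.add_apply, ← map_add, ← Finsupp.add_apply]
      simp [Finsupp.single_apply, Pi.single_apply, eq_comm, apply_ite ev]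
    rw [this]
    exact add_mem (Submodule.subset_span ⟨_, rfl⟩) (Submodule.subset_span ⟨_, rfl⟩)
  -- Some of these sections form a basis of the fiber at `x`; where their determinant is invertible
  -- they form a frame of `F`.
  obtain ⟨a, ha⟩ := Matrix.exists_det_ne_zero_of_span_eq_top v hv
  let B : Matrix ι ι Γ(M, U) := Matrix.of fun l m => b.repr (f (a m)) l
  have hdet : ev B.det ≠ 0 := by
    rw [RingHom.map_det]
    exact ha
  let W := M.basicOpen B.det
  have hW : W ≤ U := M.basicOpen_le _
  have hxW : x ∈ W := (Scheme.evaluation_ne_zero_iff_mem_basicOpen M x hx _).mp hdet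
  have hfr : F.IsFrame W fun m => F.res hW (f (a m)) := by
    have h1 := (he.res hW).of_isUnit_det ((Scheme.resHom hW).mapMatrix B) (by
      rw [← RingHom.map_det]
      exact RingedSpace.isUnit_res_basicOpen _ _)
    convert h1 using 2 with m
    have h2 := b.sum_repr (f (a m))
    have h3 : ∀ l, F.res hW (b l) = F.res hW (e l) := fun l => by
      rw [he.basis_apply, F.res_res]
    rw [← h2, map_sum]
    refine Finset.sum_congr rfl fun l _ => ?_
    rw [F.res_smul, h3]
    rfl
  -- The chosen sections in the image of the idempotent will form the frame of `G`; the others are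
  -- killed by it.
  let κ := {m // (a m).isLeft}
  have hleft : ∀ m : κ, ∃ g : G.obj U, i U le_rfl g = f (a m) := by
    rintro ⟨m, hm⟩
    obtain ⟨k, hk⟩ := Sum.isLeft_iff.mp hm
    rw [show a (Subtype.mk m hm).1 = _ from hk]
    exact hq _ _ _
  choose g hg using hleft
  have hqf : ∀ m, q₀ (f (a m)) = if (a m).isLeft then f (a m) else 0 := by
    intro m
    rcases a m with k | k
    · simp [f, q₀, hqq]
    · simp [f, q₀, hqq]
  -- A combination of sections of `G` becomes a combination of the frame of `F`, with coefficients
  -- extended by zero.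
  have hsum : ∀ V (h : V ≤ W) (c : κ → Γ(M, V)),
      i V (h.trans hW) (∑ m, c m • G.res h (G.res hW (g m))) =
        ∑ m, (if hm : (a m).isLeft then c ⟨m, hm⟩ else 0) • F.res h (F.res hW (f (a m))) := by
    intro V h c
    rw [map_sum, ← Fintype.sum_subtype_add_sum_subtype (fun m => (a m).isLeft = true)]
    refine (Eq.trans ?_ (add_zero _).symm).trans (congrArg _ (Eq.symm ?_))
    · refine Finset.sum_congr rfl fun m _ => ?_
      rw [map_smul, dif_pos m.2, G.res_res, ires U le_rfl, hg, F.res_res]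
    · exact Finset.sum_eq_zero fun m _ => by rw [dif_neg m.2, zero_smul]
  have hG : G.IsFrame W fun m : κ => G.res hW (g m) := by
    intro V h
    constructor
    · intro c c' hcc
      have h1 := congrArg (i V (h.trans hW)) hcc
      simp only [hsum] at h1
      have h2 := (hfr V h).1 h1
      funext m
      simpa [m.2] using congrFun h2 m.1
    · intro y
      obtain ⟨c, hc⟩ := (hfr V h).2 (i V (h.trans hW) y)
      refine ⟨fun m => c m.1, hi V (h.trans hW) ?_⟩
      simp only [hsum]
      -- Applying `q` to the expansion of `i y` removes the terms outside `κ` and leaves `i y`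
      -- unchanged.
      rw [← hqi, ← hc]
      simp only [map_sum, map_smul, F.res_res]
      refine Finset.sum_congr rfl fun m _ => ?_
      have : q V (h.trans hW) (F.res (h.trans hW) (f (a m))) =
        F.res (h.trans hW) (q₀ (f (a m))) := qres U le_rfl V (h.trans hW) _
      rw [this, hqf]
      split_ifs <;> simp
  exact ⟨W, hxW, hW, _, _, hG.reindex (Fintype.equivFin κ).symm⟩

end ModuleFamily

end ModuleFamily

/-! ### Frames and sheafification -/

section ModuleFamily

variable {M : Scheme.{0}}

lemma AlgebraicGeometry.Scheme.eq_of_locally_eq {V : M.Opens} {f g : Γ(M, V)}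
    (h : ∀ p ∈ V, ∃ (W : M.Opens) (hW : W ≤ V), p ∈ W ∧ Scheme.resHom hW f = Scheme.resHom hW g) :
    f = g := by
  choose W hW hp he using h
  refine TopCat.Sheaf.eq_of_locally_eq' M.sheaf (fun p : V => W p.1 p.2) V
    (fun p => homOfLE (hW p.1 p.2)) (fun p hp' => ?_) f g fun p => he p.1 p.2
  exact TopologicalSpace.Opens.mem_iSup.mpr ⟨⟨p, hp'⟩, hp p hp'⟩

lemma AlgebraicGeometry.Scheme.exists_resHom_eq {V : M.Opens} (W : V → M.Opens)
    (hW : ∀ p, W p ≤ V) (hp : ∀ p : V, p.1 ∈ W p) (f : ∀ p, Γ(M, W p))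
    (hf : ∀ p q W' (h : W' ≤ W p) (h' : W' ≤ W q), Scheme.resHom h (f p) = Scheme.resHom h' (f q)) :
    ∃ g, ∀ p, Scheme.resHom (hW p) g = f p := by
  obtain ⟨g, hg, -⟩ := TopCat.Sheaf.existsUnique_gluing' M.sheaf W V (fun p => homOfLE (hW p))
    (fun p hp' => TopologicalSpace.Opens.mem_iSup.mpr ⟨⟨p, hp'⟩, hp ⟨p, hp'⟩⟩) f
    (fun p q => hf p q (W p ⊓ W q) inf_le_left inf_le_right)
  exact ⟨g, hg⟩

namespace ModuleFamily

variable {F F' : ModuleFamily M} {U : M.Opens} {ι : Type} [Fintype ι] {e : ι → F.obj U}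

/-- A frame remains a frame under passage to the associated sheaf. -/
lemma IsFrame.map_of_locally_bijective (he : F.IsFrame U e)
    (η : ∀ V, F.obj V →ₗ[Γ(M, V)] F'.obj V)
    (ηres : ∀ V W (h : W ≤ V) x, η W (F.res h x) = F'.res h (η V x))
    (hinj : ∀ V x, η V x = 0 → ∀ p ∈ V, ∃ (W : M.Opens) (hW : W ≤ V), p ∈ W ∧ F.res hW x = 0)
    (hsurj : ∀ V y, ∀ p ∈ V, ∃ (W : M.Opens) (hW : W ≤ V), p ∈ W ∧ ∃ x, η W x = F'.res hW y)
    (hsep : ∀ V (y : F'.obj V), (∀ p ∈ V, ∃ (W : M.Opens) (hW : W ≤ V), p ∈ W ∧ F'.res hW y = 0) →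
      y = 0) :
    F'.IsFrame U fun k => η U (e k) := by
  have hsum : ∀ V (h : V ≤ U) (c : ι → Γ(M, V)),
      ∑ k, c k • F'.res h (η U (e k)) = η V (∑ k, c k • F.res h (e k)) := by
    intro V h c
    simp only [map_sum, map_smul, ηres]
  have hres : ∀ V (h : V ≤ U) W (h' : W ≤ V) (c : ι → Γ(M, V)),
      F.res h' (∑ k, c k • F.res h (e k)) =
        ∑ k, Scheme.resHom h' (c k) • F.res (h'.trans h) (e k) := by
    intro V h W h' c
    simp only [map_sum, F.res_smul, F.res_res]
  -- A section killed by `η` vanishes locally, hence so do its coordinates; these are functions,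
  -- which form a sheaf, so they vanish.
  have inj : ∀ V, V ≤ U → ∀ x, η V x = 0 → x = 0 := by
    intro V h x hx
    obtain ⟨c, rfl⟩ := (he V h).2 x
    have hc : c = 0 := by
      funext k
      refine Scheme.eq_of_locally_eq fun p hp => ?_
      obtain ⟨W, hW, hpW, hW0⟩ := hinj V _ hx p hp
      refine ⟨W, hW, hpW, ?_⟩
      rw [hres] at hW0
      have := (he W (hW.trans h)).1 (a₁ := fun k => Scheme.resHom hW (c k)) (a₂ := 0) (by
        simpa using hW0)
      simpa using congrFun this k
    simp [hc]
  have inj' : ∀ V, V ≤ U → Function.Injective (η V) := fun V h =>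
    (injective_iff_map_eq_zero _).mpr (inj V h)
  intro V h
  simp only [hsum]
  refine ((inj' V h).comp (he V h).1 : _) |> fun h1 => ⟨h1, fun y => ?_⟩
  have h2 : ∀ p : V, ∃ (W : M.Opens) (hW : W ≤ V), p.1 ∈ W ∧ ∃ c : ι → Γ(M, W),
      η W (∑ k, c k • F.res (hW.trans h) (e k)) = F'.res hW y := by
    intro p
    obtain ⟨W, hW, hpW, x, hx⟩ := hsurj V y p.1 p.2
    obtain ⟨c, rfl⟩ := (he W (hW.trans h)).2 x
    exact ⟨W, hW, hpW, c, hx⟩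
  choose W hW hp c hc using h2
  -- The local coordinates of `y` agree on overlaps, because `η` is injective there and coordinates
  -- in a frame are unique; so they glue.
  have h3 : ∀ k, ∃ g, ∀ p, Scheme.resHom (hW p) g = c p k := by
    intro k
    refine Scheme.exists_resHom_eq W hW hp (fun p => c p k) fun p q W' h' h'' => ?_
    have h4 : ∀ p (h' : W' ≤ W p), η W' (∑ k, Scheme.resHom h' (c p k) •
        F.res ((h'.trans (hW p)).trans h) (e k)) = F'.res (h'.trans (hW p)) y := by
      intro p h'
      rw [← hres _ ((hW p).trans h) _ h', ηres, hc, F'.res_res]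
    have h5 := inj' W' ((h'.trans (hW p)).trans h) ((h4 p h').trans (h4 q h'').symm)
    exact congrFun ((he W' ((h'.trans (hW p)).trans h)).1 h5) k
  choose g hg using h3
  refine ⟨g, ?_⟩
  refine sub_eq_zero.mp (hsep V _ fun p hpV => ⟨W ⟨p, hpV⟩, hW _, hp ⟨p, hpV⟩, ?_⟩)
  rw [map_sub, sub_eq_zero, ← hc ⟨p, hpV⟩, ← ηres, hres]
  simp only [hg]

open Opposite in
/-- The family of sections of a presheaf of modules. -/
noncomputable def ofPresheaf (G : M.PresheafOfModules) : ModuleFamily M where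
  obj U := G.obj (op U)
  addCommGroup _ := inferInstance
  module U := (G.obj (op U)).isModule
  res h := (G.presheaf.map (homOfLE h).op).hom
  res_smul h r x := G.map_smul (homOfLE h).op r x
  res_res h h' x := (G.map_comp_apply (homOfLE h).op (homOfLE h').op x).symm

/-- The family of sections of a sheaf of modules. -/
noncomputable abbrev ofModules (E : M.Modules) : ModuleFamily M :=
  ofPresheaf ((Scheme.Modules.toPresheafOfModules M).obj E)

variable (F) in
/-- Each point has a neighborhood over which the family has a finite frame. -/
def IsLocallyFree : Prop :=
  ∀ x : M, ∃ U : M.Opens, x ∈ U ∧ ∃ (r : ℕ) (e : Fin r → F.obj U), F.IsFrame U e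

lemma ofModules_eq_zero (E : M.Modules) {V : M.Opens} (y : (ofModules E).obj V)
    (h : ∀ p ∈ V, ∃ (W : M.Opens) (hW : W ≤ V), p ∈ W ∧ (ofModules E).res hW y = 0) : y = 0 := by
  choose W hW hp he using h
  refine TopCat.Sheaf.eq_of_locally_eq' (⟨E.presheaf, E.isSheaf⟩ : TopCat.Sheaf Ab M)
    (fun p : V => W p.1 p.2) V
    (fun p => homOfLE (hW p.1 p.2)) (fun p hp' => ?_) y 0 fun p => (he p.1 p.2).trans ?_
  · exact TopologicalSpace.Opens.mem_iSup.mpr ⟨⟨p, hp'⟩, hp p hp'⟩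
  · exact (map_zero _).symm

/-- The unit of the sheafification of presheaves of modules. -/
noncomputable def toSheafify (G : M.PresheafOfModules) :
    G ⟶ (Scheme.Modules.toPresheafOfModules M).obj ((SchurComplex.sheafify M).obj G) :=
  PresheafOfModules.sheafificationHomEquiv (𝟙 M.ringCatSheaf.obj) (𝟙 _)

/-- On underlying presheaves of abelian groups, `toSheafify G` is the usual sheafification map,
which is locally injective. -/
lemma exists_res_eq_zero_of_toSheafify (G : M.PresheafOfModules) {V : M.Opens}
    (x : (ofPresheaf G).obj V) (hx : (toSheafify G).app (.op V) x = 0) (p : M) (hp : p ∈ V) :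
    ∃ (W : M.Opens) (hW : W ≤ V), p ∈ W ∧ (ofPresheaf G).res hW x = 0 := by
  have : Presheaf.IsLocallyInjective (Opens.grothendieckTopology M)
      (CategoryTheory.toSheafify (Opens.grothendieckTopology M) G.presheaf) := inferInstance
  have h := Presheaf.equalizerSieve_mem (Opens.grothendieckTopology M)
      (CategoryTheory.toSheafify (Opens.grothendieckTopology M) G.presheaf) x 0
      (hx.trans (map_zero _).symm)
  obtain ⟨W, f, hf, hpW⟩ := h p hp
  exact ⟨W, leOfHom f, hpW, hf.trans (map_zero _)⟩

lemma exists_toSheafify_eq (G : M.PresheafOfModules) {V : M.Opens}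
    (y : (ofModules ((SchurComplex.sheafify M).obj G)).obj V) (p : M) (hp : p ∈ V) :
    ∃ (W : M.Opens) (hW : W ≤ V), p ∈ W ∧
      ∃ x, (toSheafify G).app (.op W) x = (ofModules ((SchurComplex.sheafify M).obj G)).res hW y := by
  have : Presheaf.IsLocallySurjective (Opens.grothendieckTopology M)
      (CategoryTheory.toSheafify (Opens.grothendieckTopology M) G.presheaf) := inferInstance
  have h := Presheaf.imageSieve_mem (Opens.grothendieckTopology M)
      (CategoryTheory.toSheafify (Opens.grothendieckTopology M) G.presheaf) y
  obtain ⟨W, f, ⟨x, hx⟩, hpW⟩ := h p hp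
  exact ⟨W, leOfHom f, hpW, x, hx⟩

lemma IsLocallyFree.sheafify {G : M.PresheafOfModules} (hG : (ofPresheaf G).IsLocallyFree) :
    (ofModules ((SchurComplex.sheafify M).obj G)).IsLocallyFree := by
  intro x
  obtain ⟨U, hx, r, e, he⟩ := hG x
  refine ⟨U, hx, r, _, he.map_of_locally_bijective
    (F' := ofModules ((SchurComplex.sheafify M).obj G))
    (fun V => ((toSheafify G).app (.op V)).hom) ?_ ?_ ?_ ?_⟩
  · intro V W h x
    exact PresheafOfModules.naturality_apply (toSheafify G) (homOfLE h).op x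
  · exact fun V x hx => exists_res_eq_zero_of_toSheafify G x hx
  · exact fun V y => exists_toSheafify_eq G y
  · exact fun V y => ofModules_eq_zero _ y

end ModuleFamily

end ModuleFamily

/-! ### Local freeness of the presheaf terms -/

section TwistedFrames

variable {M : Scheme.{0}}

namespace ModuleFamily

lemma subsingleton_of_isZero {E : M.Modules} (hE : Limits.IsZero E) (V : M.Opens) :
    Subsingleton ((ofModules E).obj V) := by
  refine subsingleton_of_forall_eq 0 fun x => ?_
  have h : (𝟙 E : E ⟶ E) = 0 := hE.eq_of_src _ _
  exact congrArg (fun f : E ⟶ E => Scheme.Modules.Hom.app f V x) h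

lemma isFrame_of_subsingleton {F : ModuleFamily M} {U : M.Opens} {ι : Type} [Fintype ι] [IsEmpty ι]
    (h : ∀ V, Subsingleton (F.obj V)) (e : ι → F.obj U) : F.IsFrame U e := fun V _ =>
  ⟨fun _ _ _ => Subsingleton.elim _ _, fun _ => ⟨0, (h V).elim _ _⟩⟩

/-- Only finitely many terms are nonzero, so finitely many neighborhoods are intersected. The rank
`0` elsewhere is recorded because it later makes the index set of the tensor frame finite. -/
lemma IsLocallyFree.exists_frames {E : ℤ → M.Modules} {a b : ℤ}
    (hE : ∀ i, i < a ∨ b < i → Limits.IsZero (E i)) (h : ∀ i, (ofModules (E i)).IsLocallyFree)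
    (x : M) : ∃ U : M.Opens, x ∈ U ∧ ∃ (r : ℤ → ℕ) (_ : ∀ i, i < a ∨ b < i → r i = 0)
      (e : ∀ i, Fin (r i) → (ofModules (E i)).obj U), ∀ i, (ofModules (E i)).IsFrame U (e i) := by
  choose W hW r e he using fun i => h i x
  let U : M.Opens := (Finset.Icc a b).inf W
  have hU : ∀ i, ¬ (i < a ∨ b < i) → U ≤ W i := fun i hi =>
    Finset.inf_le (Finset.mem_Icc.mpr (by omega))
  have hx : x ∈ U := by
    have : ∀ s : Finset ℤ, x ∈ (s.inf W : M.Opens) := by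
      intro s
      induction s using Finset.induction_on with
      | empty => trivial
      | insert i s hi ih => rw [Finset.inf_insert]; exact ⟨hW i, ih⟩
    exact this _
  have key : ∀ i, ∃ (r : ℕ) (_ : i < a ∨ b < i → r = 0) (e : Fin r → (ofModules (E i)).obj U),
      (ofModules (E i)).IsFrame U e := by
    intro i
    by_cases hi : i < a ∨ b < i
    · exact ⟨0, fun _ => rfl, Fin.elim0,
        isFrame_of_subsingleton (fun V => subsingleton_of_isZero (hE i hi) V) _⟩
    · exact ⟨r i, fun h => (hi h).elim, _, (he i).res (hU i hi)⟩
  choose r hr e he using key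
  exact ⟨U, hx, r, hr, e, he⟩

end ModuleFamily

namespace SchurComplex

open ModuleFamily

section

variable {n : ℕ} {V : Type} [AddCommGroup V] [Module ℂ V]
  {R S T : Type} [CommRing R] [Algebra ℂ R] [CommRing S] [Algebra ℂ S] [CommRing T] [Algebra ℂ T]
  {K : CochainComplex (ModuleCat.{0} R) ℤ} {L : CochainComplex (ModuleCat.{0} S) ℤ}
  {Q : CochainComplex (ModuleCat.{0} T) ℤ} (j : ℤ)

variable (V n) in
/-- The map on the terms of `V ⊗ K^{⊗ n}` induced by a homomorphism of `ℂ`-algebras `R → S` and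
semilinear maps `K^a → L^a`. -/
noncomputable def twistedMap (φ : R →ₐ[ℂ] S) (r : ∀ a, K.X a →ₛₗ[(φ : R →+* S)] L.X a) :
    TwistedPower V K n j →ₛₗ[(φ : R →+* S)] TwistedPower V L n j :=
  TensorProduct.map (scalarMap V φ) (tensorPowerMap n j r)

/-- The basis of a term of a tensor power of a complex with free terms. -/
noncomputable def tensorPowerBasis {ι : ℤ → Type} [∀ a, Fintype (ι a)]
    (b : ∀ a, Module.Basis (ι a) R (K.X a)) :
    Module.Basis (Σ i : {i : Fin n → ℤ // ∑ k, i k = j}, ∀ k, ι (i.1 k)) R (TensorPower K n j) :=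
  DFinsupp.basis fun i => Basis.piTensorProduct fun k => b (i.1 k)

omit [Algebra ℂ R] in
lemma tensorPowerBasis_apply {ι : ℤ → Type} [∀ a, Fintype (ι a)]
    (b : ∀ a, Module.Basis (ι a) R (K.X a))
    (x : Σ i : {i : Fin n → ℤ // ∑ k, i k = j}, ∀ k, ι (i.1 k)) :
    tensorPowerBasis j b x = homog (fun k => ⟨x.1.1 k, b _ (x.2 k)⟩) x.1.2 := by
  obtain ⟨i, p⟩ := x
  classical
  refine (tensorPowerBasis j b).repr.injective ?_
  rw [Module.Basis.repr_self]
  refine Finsupp.ext fun ⟨i', p'⟩ => ?_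
  change _ = (Basis.piTensorProduct fun k => b (i'.1 k)).repr (DirectSum.lof R _
    (fun i : {i : Fin n → ℤ // ∑ k, i k = j} => ⨂[R] k, K.X (i.1 k)) i
      (PiTensorProduct.tprod R fun k => b (i.1 k) (p k)) i') p'
  by_cases h : i = i'
  · subst h
    rw [DirectSum.lof_apply, ← Basis.piTensorProduct_apply (fun k => b (i.1 k)),
      Module.Basis.repr_self]
    by_cases h : p = p'
    · subst h; simp
    · rw [Finsupp.single_eq_of_ne' h, Finsupp.single_eq_of_ne' (by simpa using h)]
  · rw [DirectSum.lof_eq_of, DirectSum.of_eq_of_ne _ _ _ (Ne.symm h), map_zero, Finsupp.zero_apply,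
      Finsupp.single_eq_of_ne' (fun hh => h (congrArg Sigma.fst hh))]

/-- The basis of a term of `V ⊗ K^{⊗ n}` for a complex with free terms. -/
noncomputable def twistedBasis {κ : Type} (c : Module.Basis κ ℂ V) {ι : ℤ → Type}
    [∀ a, Fintype (ι a)] (b : ∀ a, Module.Basis (ι a) R (K.X a)) :
    Module.Basis (κ × Σ i : {i : Fin n → ℤ // ∑ k, i k = j}, ∀ k, ι (i.1 k)) R
      (TwistedPower V K n j) :=
  (Algebra.TensorProduct.basis R c).tensorProduct (tensorPowerBasis j b)

lemma twistedBasis_apply {κ : Type} (c : Module.Basis κ ℂ V) {ι : ℤ → Type}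
    [∀ a, Fintype (ι a)] (b : ∀ a, Module.Basis (ι a) R (K.X a))
    (x : κ × Σ i : {i : Fin n → ℤ // ∑ k, i k = j}, ∀ k, ι (i.1 k)) :
    twistedBasis j c b x = ((1 : R) ⊗ₜ[ℂ] c x.1) ⊗ₜ[R]
      homog (fun k => ⟨x.2.1.1 k, b _ (x.2.2 k)⟩) x.2.1.2 := by
  rw [← tensorPowerBasis_apply]
  exact (Module.Basis.tensorProduct_apply _ _ _ _).trans
    (by rw [Algebra.TensorProduct.basis_apply])

lemma twistedMap_comp (φ : R →ₐ[ℂ] S) (ψ : S →ₐ[ℂ] T) (χ : R →ₐ[ℂ] T) (hχ : χ = ψ.comp φ)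
    (r : ∀ a, K.X a →ₛₗ[(φ : R →+* S)] L.X a) (s : ∀ a, L.X a →ₛₗ[(ψ : S →+* T)] Q.X a)
    (t : ∀ a, K.X a →ₛₗ[(χ : R →+* T)] Q.X a)
    (ht : ∀ a x, t a x = s a (r a x)) (x : TwistedPower V K n j) :
    twistedMap n V j χ t x = twistedMap n V j ψ s (twistedMap n V j φ r x) := by
  subst hχ
  have : RingHomCompTriple (φ : R →+* S) (ψ : S →+* T) ((ψ.comp φ : R →ₐ[ℂ] T) : R →+* T) :=
    ⟨rfl⟩
  obtain rfl : t = fun a => (s a).comp (r a) := funext fun a => LinearMap.ext (ht a)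
  have h : twistedMap n V j (ψ.comp φ) (fun a => (s a).comp (r a)) =
      (twistedMap n V j ψ s).comp (twistedMap n V j φ r) := by
    refine TensorProduct.ext' fun v t => ?_
    change _ ⊗ₜ[T] _ = _ ⊗ₜ[T] _
    rw [tensorPowerMap_comp]
    congr 1
    induction v using TensorProduct.induction_on with
    | zero => simp
    | tmul a v => rfl
    | add a b ha hb => simp only [map_add, ha, hb]
  exact LinearMap.congr_fun h x

lemma twistedMap_twistedRep (ρ : Representation ℂ (Equiv.Perm (Fin n)) V) (φ : R →ₐ[ℂ] S)
    (r : ∀ a, K.X a →ₛₗ[(φ : R →+* S)] L.X a) (σ : Equiv.Perm (Fin n)) (x : TwistedPower V K n j) :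
    twistedMap n V j φ r (twistedRep ρ K j σ x) = twistedRep ρ L j σ (twistedMap n V j φ r x) := by
  have h : (twistedRep ρ L j σ).comp (twistedMap n V j φ r) =
      (twistedMap n V j φ r).comp (twistedRep ρ K j σ) := by
    refine TensorProduct.ext' fun v t => ?_
    change _ ⊗ₜ[S] _ = _ ⊗ₜ[S] _
    congr 1
    · induction v using TensorProduct.induction_on with
      | zero => simp
      | tmul a v => rfl
      | add a b ha hb => simp only [map_add, ha, hb]
    · exact (tensorPowerMap_permMap r σ t).symm
  exact (LinearMap.congr_fun h x).symm

lemma twistedMap_average (ρ : Representation ℂ (Equiv.Perm (Fin n)) V) (φ : R →ₐ[ℂ] S)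
    (r : ∀ a, K.X a →ₛₗ[(φ : R →+* S)] L.X a) (x : TwistedPower V K n j) :
    twistedMap n V j φ r (average ρ K j x) = average ρ L j (twistedMap n V j φ r x) := by
  unfold average
  rw [map_smulₛₗ, map_sum]
  simp only [twistedMap_twistedRep]
  congr 1
  exact φ.commutes _

end

variable [M.Over (Spec (CommRingCat.of ℂ))] (P : CochainComplex M.Modules ℤ) {n : ℕ} {V : Type}
  [AddCommGroup V] [Module ℂ V] (ρ : Representation ℂ (Equiv.Perm (Fin n)) V) (j : ℤ)

variable (n V) in
/-- The family `U ↦ V ⊗ P(U)^{⊗ n}` in degree `j`. -/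
noncomputable def twistedFamily : ModuleFamily M where
  obj U := TwistedPower V (sections P U) n j
  addCommGroup _ := inferInstance
  module _ := inferInstance
  res h := (twistedMap n V j (resAlgHom (homOfLE h)) (sectionsRes P (homOfLE h))).toAddMonoidHom
  res_smul h r x := (twistedMap n V j (resAlgHom (homOfLE h))
    (sectionsRes P (homOfLE h))).map_smulₛₗ r x
  res_res h h' x := (twistedMap_comp j (resAlgHom (homOfLE h)) (resAlgHom (homOfLE h'))
    (resAlgHom (homOfLE (h'.trans h)))
    (AlgHom.ext fun r => (Scheme.resHom_resHom h h' r).symm)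
    (sectionsRes P (homOfLE h)) (sectionsRes P (homOfLE h')) (sectionsRes P (homOfLE (h'.trans h)))
    (fun a x => ((ofModules (P.X a)).res_res h h' x).symm) x).symm

variable {P} in
-- Over each smaller open set the restricted frames are bases, and restriction acts factor by factor
-- on homogeneous tensors, so it yields the tensor basis there.
lemma isFrame_twistedFamily {U : M.Opens} {ι : ℤ → Type} [∀ a, Fintype (ι a)]
    {e : ∀ a, ι a → (ofModules (P.X a)).obj U} (he : ∀ a, (ofModules (P.X a)).IsFrame U (e a))
    {κ : Type} [Fintype κ] (b : Module.Basis κ ℂ V)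
    [Fintype (Σ i : {i : Fin n → ℤ // ∑ k, i k = j}, ∀ k, ι (i.1 k))] :
    (twistedFamily P n V j).IsFrame U
      fun x : κ × Σ i : {i : Fin n → ℤ // ∑ k, i k = j}, ∀ k, ι (i.1 k) =>
        (((1 : Γ(M, U)) ⊗ₜ[ℂ] b x.1) ⊗ₜ[Γ(M, U)] homog (K := sections P U)
          (fun k => ⟨x.2.1.1 k, e _ (x.2.2 k)⟩) x.2.1.2 : TwistedPower V (sections P U) n j) := by
  classical
  refine isFrame_of_basis (F := twistedFamily P n V j)
    (fun W h => twistedBasis j b (K := sections P W) fun a => (he a).basis h) fun W h x => ?_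
  refine (twistedBasis_apply j b (K := sections P W) (fun a => (he a).basis h) x).trans ?_
  refine Eq.trans ?_ (TensorProduct.map_tmul _ _ _ _).symm
  refine congrArg₂ (fun s t => s ⊗ₜ[Γ(M, W)] t) (congrArg (fun t => t ⊗ₜ[ℂ] b x.1)
    (map_one (resAlgHom (homOfLE h))).symm)
    ((homog_congr ?_ _).trans (tensorPowerMap_homog _ _ _).symm)
  funext k
  exact congrArg (Sigma.mk _) ((he _).basis_apply h _)

/-- The average as an endomorphism of the modules of sections. -/
noncomputable def averageHom {R : Type} [CommRing R] [Algebra ℂ R]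
    (K : CochainComplex (ModuleCat.{0} R) ℤ) :
    TwistedPower V K n j →ₗ[R] TwistedPower V K n j where
  toFun := average ρ K j
  map_add' := average_add ρ K j
  map_smul' := average_smul ρ K j

/-- Averaging is an idempotent of `V ⊗ P^{⊗ n}` with image the invariants and commutes with
restriction, so the invariants inherit local frames. -/
lemma isLocallyFree_presheafTerm [Module.Finite ℂ V] (hP : IsBoundedComplex P)
    (h : ∀ a, (ofModules (P.X a)).IsLocallyFree) :
    (ofPresheaf (presheafTerm ρ P j)).IsLocallyFree := by
  classical
  obtain ⟨a, b, hab⟩ := hP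
  intro x
  obtain ⟨U, hx, r, hr, e, he⟩ := IsLocallyFree.exists_frames hab h x
  -- Infinitely many multi-indices have sum `j`, but those involving a degree of rank `0` contribute
  -- no basis elements.
  have : Finite (Σ a, Fin (r a)) := by
    refine Finite.of_injective (β := Σ i : Finset.Icc a b, Fin (r i))
      (fun s => ⟨⟨s.1, ?_⟩, s.2⟩) ?_
    · by_contra hs
      have := hr s.1 (by rw [Finset.mem_Icc] at hs; omega)
      exact (this ▸ s.2).elim0
    · rintro ⟨i, k⟩ ⟨i', k'⟩ hh
      simp only [Sigma.mk.injEq, Subtype.mk.injEq] at hh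
      obtain ⟨rfl, hh⟩ := hh
      simpa using hh
  have : Finite (Σ i : {i : Fin n → ℤ // ∑ k, i k = j}, ∀ k, Fin (r (i.1 k))) := by
    refine Finite.of_injective (β := Fin n → Σ a, Fin (r a)) (fun s k => ⟨s.1.1 k, s.2 k⟩) ?_
    rintro ⟨⟨i, hi⟩, k⟩ ⟨⟨i', hi'⟩, k'⟩ hh
    obtain rfl : i = i' := funext fun l => congrArg Sigma.fst (congrFun hh l)
    congr 1
    funext l
    simpa using congrFun hh l
  have := Fintype.ofFinite (Σ i : {i : Fin n → ℤ // ∑ k, i k = j}, ∀ k, Fin (r (i.1 k)))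
  have hfr := isFrame_twistedFamily (n := n) j he (Module.finBasis ℂ V)
  obtain ⟨W, hxW, -, hW⟩ := hfr.exists_isFrame_of_idempotent
    (G := ofPresheaf (presheafTerm ρ P j))
    (fun V _ => (schurTerm ρ (sections P V) j).subtype)
    (fun V _ => averageHom ρ j (sections P V)) (fun V _ => Subtype.val_injective)
    (fun V _ x => average_of_mem ρ _ j x.2) (fun V _ x => ⟨⟨_, average_mem ρ _ j x⟩, rfl⟩)
    (fun V h W h' x => rfl) (fun V h W h' x => (twistedMap_average j ρ _ _ x).symm) x hx
  exact ⟨W, hxW, hW⟩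

end SchurComplex

end TwistedFrames

/-! ### Vector bundles in terms of local frames -/

section VectorBundle

variable {M : Scheme.{0}}

namespace ModuleFamily

/-- The map on sections of a morphism of sheaves of modules. -/
noncomputable def mapSections {E E' : M.Modules} (f : E ⟶ E') (V : M.Opens) :
    (ofModules E).obj V →ₗ[Γ(M, V)] (ofModules E').obj V :=
  (f.val.app (.op V)).hom

variable {E E' E'' : M.Modules}

lemma mapSections_res (f : E ⟶ E') {V W : M.Opens} (h : W ≤ V) (x : (ofModules E).obj V) :
    mapSections f W ((ofModules E).res h x) = (ofModules E').res h (mapSections f V x) :=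
  PresheafOfModules.naturality_apply f.val (homOfLE h).op x

lemma mapSections_comp (f : E ⟶ E') (g : E' ⟶ E'') (V : M.Opens) (x : (ofModules E).obj V) :
    mapSections (f ≫ g) V x = mapSections g V (mapSections f V x) := rfl

lemma mapSections_zero (V : M.Opens) (x : (ofModules E).obj V) :
    mapSections (0 : E ⟶ E') V x = 0 := rfl

lemma mapSections_add (f g : E ⟶ E') (V : M.Opens) (x : (ofModules E).obj V) :
    mapSections (f + g) V x = mapSections f V x + mapSections g V x := rfl

lemma mapSections_sum {κ : Type} (s : Finset κ) (f : κ → (E ⟶ E')) (V : M.Opens)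
    (x : (ofModules E).obj V) :
    mapSections (∑ k ∈ s, f k) V x = ∑ k ∈ s, mapSections (f k) V x := by
  classical
  induction s using Finset.induction_on with
  | empty => rw [Finset.sum_empty, Finset.sum_empty]; rfl
  | insert a s ha ih => rw [Finset.sum_insert ha, Finset.sum_insert ha, mapSections_add, ih]

lemma isIso_of_mapSections_bijective (f : E ⟶ E')
    (h : ∀ V, Function.Bijective (mapSections f V)) : IsIso f := by
  refine Scheme.Modules.Hom.isIso_iff_isIso_app.mpr fun V => ?_
  rw [ConcreteCategory.isIso_iff_bijective]
  exact h V

lemma mapSections_bijective (f : E ⟶ E') [IsIso f] (V : M.Opens) :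
    Function.Bijective (mapSections f V) := by
  have := (Scheme.Modules.Hom.isIso_iff_isIso_app (φ := f)).mp inferInstance V
  rw [ConcreteCategory.isIso_iff_bijective] at this
  exact this

lemma IsFrame.map_of_isIso {U : M.Opens} {ι : Type} [Fintype ι] {e : ι → (ofModules E).obj U}
    (he : (ofModules E).IsFrame U e) (f : E ⟶ E') [IsIso f] :
    (ofModules E').IsFrame U fun k => mapSections f U (e k) := by
  intro V h
  have h1 : (fun c : ι → Γ(M, V) => ∑ k, c k • (ofModules E').res h (mapSections f U (e k))) =
      mapSections f V ∘ fun c => ∑ k, c k • (ofModules E).res h (e k) := by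
    funext c
    simp only [Function.comp_apply, map_sum, map_smul, mapSections_res]
  rw [h1]
  exact (mapSections_bijective f V).comp (he V h)

lemma IsLocallyFree.of_iso (h : (ofModules E).IsLocallyFree) (f : E ≅ E') :
    (ofModules E').IsLocallyFree := by
  intro x
  obtain ⟨U, hx, r, e, he⟩ := h x
  exact ⟨U, hx, r, _, he.map_of_isIso f.hom⟩

variable (M) in
/-- The structure sheaf, as a sheaf of modules. -/
noncomputable def structureSheaf : M.Modules := SheafOfModules.unit M.ringCatSheaf

variable (M) in
/-- The free sheaf of modules. -/
noncomputable def freeModules (ι : Type) : M.Modules := SheafOfModules.free ι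

/-- A function, as a section of the structure sheaf. -/
def ofFunction {V : M.Opens} (f : Γ(M, V)) : (ofModules (structureSheaf M)).obj V := f

lemma ofFunction_eq_smul {V : M.Opens} (f : Γ(M, V)) : ofFunction f = f • ofFunction 1 :=
  (mul_one f).symm

/-- The relations exhibit `E` as a direct sum of copies of the structure sheaf, so the projections
`p j` compute the coordinates of a section. -/
lemma isFrame_of_sum_eq_id {ι : Type} [Fintype ι] [DecidableEq ι]
    (i : ι → (structureSheaf M ⟶ E)) (p : ι → (E ⟶ structureSheaf M))
    (hip : ∀ k j, i k ≫ p j = if k = j then 𝟙 _ else 0) (hpi : ∑ j, p j ≫ i j = 𝟙 E)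
    (e : ι → (ofModules E).obj ⊤)
    (he : ∀ V (h : V ≤ ⊤) k, (ofModules E).res h (e k) = mapSections (i k) V (ofFunction 1)) :
    (ofModules E).IsFrame ⊤ e := by
  intro V h
  have h1 : ∀ c : ι → Γ(M, V), ∑ k, c k • (ofModules E).res h (e k) =
      ∑ k, mapSections (i k) V (ofFunction (c k)) := fun c =>
    Finset.sum_congr rfl fun k _ => by rw [he, ofFunction_eq_smul (c k), map_smul]
  have h3 : ∀ j k c, mapSections (p j) V (mapSections (i k) V c) = if k = j then c else 0 := by
    intro j k c
    rw [← mapSections_comp, hip]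
    split_ifs <;> rfl
  simp only [h1]
  refine Function.bijective_iff_has_inverse.mpr
    ⟨fun y j => (mapSections (p j) V y : Γ(M, V)), fun c => ?_, fun y => ?_⟩
  · funext j
    simp only [map_sum, h3]
    exact (Finset.sum_eq_single j (fun k _ hk => if_neg hk) (by simp)).trans (if_pos rfl)
  · have h4 := mapSections_sum Finset.univ (fun j => p j ≫ i j) V y
    rw [hpi] at h4
    exact h4.symm

/-- The tautological frame of a free sheaf of modules. -/
noncomputable def freeFrame (ι : Type) (k : ι) : (ofModules (freeModules M ι)).obj ⊤ :=
  (SheafOfModules.freeSection (R := M.ringCatSheaf) k).eval (.op ⊤)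

lemma isFrame_freeFrame (ι : Type) [Fintype ι] :
    (ofModules (freeModules M ι)).IsFrame ⊤ (freeFrame ι) := by
  classical
  let i : ι → (structureSheaf M ⟶ freeModules M ι) := SheafOfModules.ιFree
  -- The projections come from the universal property of the coproduct, applied to the Kronecker
  -- delta.
  let δ (k j : ι) : structureSheaf M ⟶ structureSheaf M := if k = j then 𝟙 _ else 0
  let p (j : ι) : freeModules M ι ⟶ structureSheaf M :=
    Limits.Cofan.IsColimit.desc (SheafOfModules.isColimitFreeCofan ι)
      fun k => δ k j
  have hip : ∀ k j, i k ≫ p j = if k = j then 𝟙 _ else 0 := fun k j =>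
    Limits.Cofan.IsColimit.fac (SheafOfModules.isColimitFreeCofan ι)
      (fun k => δ k j) k
  refine isFrame_of_sum_eq_id i p hip ?_ _ fun V h k =>
    PresheafOfModules.sections_property (SheafOfModules.freeSection (R := M.ringCatSheaf) k)
      (homOfLE h).op
  refine Limits.Cofan.IsColimit.hom_ext (SheafOfModules.isColimitFreeCofan ι) _ _ fun k => ?_
  change i k ≫ ∑ j, p j ≫ i j = i k ≫ 𝟙 _
  rw [Preadditive.comp_sum, Category.comp_id]
  simp only [← Category.assoc, hip]
  rw [Finset.sum_eq_single k]
  · simp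
  · intro j _ hj; simp [hj.symm]
  · simp

/-- A sheaf of modules with a global frame is free. -/
lemma IsFrame.nonempty_iso_free {r : ℕ} {e : Fin r → (ofModules E).obj ⊤}
    (he : (ofModules E).IsFrame ⊤ e) :
    Nonempty (E ≅ freeModules M (Fin r)) := by
  let s : Fin r → SheafOfModules.sections E := fun k =>
    PresheafOfModules.sectionsMk (fun V => (ofModules E).res (le_top : V.unop ≤ ⊤) (e k))
      fun V W f => (ofModules E).res_res (le_top : V.unop ≤ ⊤) (leOfHom f.unop) (e k)
  let φ : freeModules M (Fin r) ⟶ E := (SheafOfModules.freeHomEquiv E).symm s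
  have hφ : ∀ k, mapSections φ ⊤ (freeFrame (Fin r) k) = e k := by
    intro k
    have h := congrArg (fun t : SheafOfModules.sections E => t.eval (.op ⊤))
      (SheafOfModules.sectionsMap_freeHomEquiv_symm_freeSection (R := M.ringCatSheaf) s k)
    refine h.trans ?_
    change (ofModules E).res le_rfl (e k) = e k
    exact ConcreteCategory.congr_hom (E.presheaf.map_id (.op ⊤)) (e k)
  have : IsIso φ := by
    refine isIso_of_mapSections_bijective φ fun V => ?_
    -- The coordinate map of `e` is the bijective one of the tautological frame followed by `φ`, so
    -- `φ` is bijective on sections.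
    have h1 : (fun c : Fin r → Γ(M, V) => ∑ k, c k • (ofModules E).res le_top (e k)) =
        mapSections φ V ∘ fun c => ∑ k, c k • (ofModules
          (freeModules M (Fin r))).res le_top (freeFrame (Fin r) k) := by
      funext c
      simp only [Function.comp_apply, map_sum, map_smul, mapSections_res, hφ]
    exact ((isFrame_freeFrame (M := M) (Fin r)) V le_top).of_comp_iff _ |>.mp (h1 ▸ he V le_top)
  exact ⟨(asIso φ).symm⟩

/-- Sections of the restriction are sections of `E` over the image, and the identification `appIso`
of functions is the identity for the inclusion of an open subscheme. -/
lemma restrict_smul (E : M.Modules) {U : M.Opens} {V : (U : Scheme.{0}).Opens}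
    (c : Γ((U : Scheme.{0}), V)) (x : (ofModules (E.restrict U.ι)).obj V) :
    c • x = (show (ofModules E).obj (U.ι ''ᵁ V) from
      (show Γ(M, U.ι ''ᵁ V) from c) • (show (ofModules E).obj (U.ι ''ᵁ V) from x)) := by
  have h1 : (U.ι.appIso V).inv c = (show Γ(M, U.ι ''ᵁ V) from c) := by
    rw [Scheme.Opens.ι_appIso]; rfl
  have h2 := Scheme.Modules.smul_restrictAppIso_hom_apply U.ι E V c x
  refine h2.trans ?_
  rw [h1]
  rfl

lemma IsFrame.restrict {U : M.Opens} {ι : Type} [Fintype ι] (e : ι → (ofModules E).obj (U.ι ''ᵁ ⊤))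
    (he : (ofModules E).IsFrame (U.ι ''ᵁ ⊤) e) :
    (ofModules (E.restrict U.ι)).IsFrame ⊤ e := by
  intro V h
  simp only [restrict_smul]
  exact he (U.ι ''ᵁ V) (Scheme.Hom.image_mono _ h)

lemma IsFrame.of_restrict {U : M.Opens} {ι : Type} [Fintype ι]
    (e : ι → (ofModules (E.restrict U.ι)).obj ⊤)
    (he : (ofModules (E.restrict U.ι)).IsFrame ⊤ e) :
    (ofModules E).IsFrame (U.ι ''ᵁ ⊤) e := by
  intro V h
  -- Every open subset of `M` inside `U` is the image of its preimage in `U`.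
  obtain ⟨W, rfl⟩ : ∃ W, V = U.ι ''ᵁ W := by
    refine ⟨U.ι ⁻¹ᵁ V, ?_⟩
    rw [Scheme.Hom.image_preimage_eq_opensRange_inf, Scheme.Opens.opensRange_ι]
    rw [Scheme.Hom.image_top_eq_opensRange, Scheme.Opens.opensRange_ι] at h
    exact (inf_eq_right.mpr h).symm
  have h1 := he W le_top
  simp only [restrict_smul] at h1
  exact h1

end ModuleFamily

open ModuleFamily in
-- This reduces all questions about vector bundles to linear algebra with bases of sections.
lemma isVectorBundle_iff (E : M.Modules) :
    isVectorBundle M E ↔ (ofModules E).IsLocallyFree := by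
  constructor
  · intro h x
    obtain ⟨U, hx, r, ⟨f⟩⟩ := h x
    let g : E.restrict U.ι ≅ freeModules U.toScheme (Fin r) := f
    have h1 := ((isFrame_freeFrame (M := U.toScheme) (Fin r)).map_of_isIso g.inv).of_restrict
    exact ⟨U.ι ''ᵁ ⊤, by simpa using hx, r, _, h1⟩
  · intro h x
    obtain ⟨U, hx, r, e, he⟩ := h x
    have h1 := he.res (V := U.ι ''ᵁ ⊤) (by simp)
    exact ⟨U, hx, r, (IsFrame.restrict _ h1).nonempty_iso_free⟩

/-! ### Vector bundles are coherent -/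

section Coherent

open SheafOfModules

variable {C : Type*} [Category* C] {J : GrothendieckTopology C} {R : Sheaf J RingCat.{0}}

lemma SheafOfModules.QuasicoherentData.isQuasicoherent_and_isFiniteType
    [∀ X, HasWeakSheafify (J.over X) AddCommGrpCat.{0}]
    [∀ X, (J.over X).WEqualsLocallyBijective AddCommGrpCat.{0}]
    {E : SheafOfModules R} (q : QuasicoherentData E) (hq : ∀ i, (q.presentation i).IsFinite) :
    E.IsQuasicoherent ∧ E.IsFiniteType := by
  have : q.shrink.IsFinitePresentation := ⟨fun i => hq _⟩
  have : E.IsFinitePresentation := ⟨q.shrink, this⟩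
  exact ⟨inferInstance, inferInstance⟩

variable [HasSheafify J AddCommGrpCat.{0}] [J.WEqualsLocallyBijective AddCommGrpCat.{0}]

/-- The presentation of a free sheaf of modules without relations. -/
noncomputable def SheafOfModules.freePresentation (ι : Type) :
    (free (R := R) ι).Presentation where
  generators := free.generatingSections ι
  relations.I := ULift Empty
  relations.s j := Empty.rec _ j.down
  relations.epi := Limits.IsZero.epi (Limits.IsZero.of_iso (Limits.isZero_zero _)
    (Limits.kernel.ofMono _)) _

instance SheafOfModules.isFinite_freePresentation (ι : Type) [Finite ι] :
    (freePresentation (R := R) ι).IsFinite where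
  isFiniteType_generators := ⟨inferInstanceAs (Finite ι)⟩
  isFiniteType_relations := ⟨inferInstanceAs (Finite (ULift Empty))⟩

variable {C' : Type*} [Category* C'] {J' : GrothendieckTopology C'} {S : Sheaf J' RingCat.{0}}
  [HasSheafify J' AddCommGrpCat.{0}] [J'.WEqualsLocallyBijective AddCommGrpCat.{0}]

/-- An equivalence preserving the unit preserves free sheaves of modules. -/
noncomputable def SheafOfModules.mapFreeIsoOfIsEquivalence
    (F : SheafOfModules.{0} R ⥤ SheafOfModules.{0} S) [F.IsEquivalence] (ι : Type)
    (η : F.obj (unit R) ≅ unit S) :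
    free (R := S) ι ≅ F.obj (free ι) :=
  mapFreeIso F ι η.symm

end Coherent

open SheafOfModules in
-- Local trivializations are finite presentations without relations.
lemma isVectorBundle.isCoherent {E : M.Modules} (h : isVectorBundle M E) : isCoherent M E := by
  choose U hU r hr using h
  -- The trivialization lives on the open subscheme, whereas presentations refer to the slice site
  -- over `U x`; equivalences between the two module categories transport it.
  let e (x : M) : free (Fin (r x)) ≅ SheafOfModules.over E (U x) :=
    mapFreeIsoOfIsEquivalence ((U x).sheafOfModulesEquivOver M.ringCatSheaf).inverse (Fin (r x))
        ((U x).sheafOfModulesEquivOverInverseUnit M.ringCatSheaf) ≪≫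
      (Scheme.Modules.overEquiv (U x)).inverse.mapIso
        ((hr x).some.symm ≪≫ ((Scheme.Modules.overFunctorEquiv (U x)).app E).symm) ≪≫
      ((Scheme.Modules.overEquiv (U x)).unitIso.app _).symm
  let q : QuasicoherentData E :=
    { I := M
      X := U
      coversTop := (Opens.coversTop_iff _ _).mpr (.mk (top_unique fun x _ =>
        TopologicalSpace.Opens.mem_iSup.mpr ⟨x, hU x⟩))
      presentation := fun x => (freePresentation (Fin (r x))).ofIsIso (e x).hom }
  exact q.isQuasicoherent_and_isFiniteType fun x => inferInstanceAs
    ((freePresentation (Fin (r x))).ofIsIso (e x).hom).IsFinite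

end VectorBundle

/-! ### Local splitting of short exact sequences -/

section Exactness

variable {M : Scheme.{0}}

namespace ModuleFamily

variable (M) in
/-- The functor of sections over an open subset. -/
noncomputable def sectionsFunctor (V : M.Opens) : M.Modules ⥤ Ab.{0} :=
  Scheme.Modules.toPresheaf M ⋙ (evaluation _ _).obj (.op V)

noncomputable instance (V : M.Opens) : Limits.PreservesLimits (sectionsFunctor M V) :=
  have : Limits.PreservesLimits ((evaluation M.Opensᵒᵖ Ab.{0}).obj (.op V)) :=
    ⟨fun {_} _ => ⟨inferInstance⟩⟩
  Limits.comp_preservesLimits _ _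

instance (V : M.Opens) : (sectionsFunctor M V).PreservesZeroMorphisms := ⟨fun _ _ => rfl⟩

variable {E E' : M.Modules}

lemma mapSections_injective (f : E ⟶ E') [Mono f] (V : M.Opens) :
    Function.Injective (mapSections f V) := by
  have : Mono ((sectionsFunctor M V).map f) := inferInstance
  exact (AddCommGrpCat.mono_iff_injective _).mp this

/-- Taking sections preserves limits, hence is left exact. -/
lemma exists_mapSections_eq {S : ShortComplex M.Modules} (hS : S.Exact) [Mono S.f] (V : M.Opens)
    (x : (ofModules S.X₂).obj V) (hx : mapSections S.g V x = 0) :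
    ∃ y, mapSections S.f V y = x :=
  (ShortComplex.ab_exact_iff _).mp
    (hS.map_of_mono_of_preservesKernel (sectionsFunctor M V) ‹_› inferInstance) x hx

/-- An epimorphism of sheaves of modules is locally surjective. -/
lemma exists_mapSections_eq_res (f : E ⟶ E') [Epi f] {V : M.Opens} (y : (ofModules E').obj V)
    (p : M) (hp : p ∈ V) :
    ∃ (W : M.Opens) (hW : W ≤ V), p ∈ W ∧ ∃ x, mapSections f W x = (ofModules E').res hW y := by
  let F := Scheme.Modules.toPresheafOfModules M
  let π := Limits.cokernel.π (F.map f)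
  -- The map from `E'` to the sheafified presheaf cokernel of `f` vanishes since `f` is an
  -- epimorphism. So the class of `y` in the presheaf cokernel is locally zero, and `y` is locally
  -- in the image.
  let t : E' ⟶ (SchurComplex.sheafify M).obj (Limits.cokernel (F.map f)) :=
    F.preimage (π ≫ toSheafify _)
  have ht : t = 0 := by
    rw [← cancel_epi f, Limits.comp_zero]
    refine F.map_injective ?_
    rw [F.map_comp, F.map_preimage, Limits.cokernel.condition_assoc, Limits.zero_comp]
    rfl
  have ht' : π ≫ toSheafify _ = 0 := by
    have := F.map_preimage (π ≫ toSheafify _)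
    rw [← this]
    exact (congrArg F.map ht)
  obtain ⟨W, hW, hpW, h0⟩ := exists_res_eq_zero_of_toSheafify (Limits.cokernel (F.map f))
    (π.app (.op V) y) (congrArg (fun g => (g.app (.op V)) y) ht') p hp
  refine ⟨W, hW, hpW, ?_⟩
  have h1 : π.app (.op W) ((ofModules E').res hW y) = 0 :=
    (PresheafOfModules.naturality_apply π (homOfLE hW).op y).trans h0
  have h2 := (ShortComplex.exact_of_g_is_cokernel (.mk (F.map f) π (by simp [π]))
    (Limits.cokernelIsCokernel (F.map f))).map (PresheafOfModules.evaluation _ (.op W))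
  exact (ShortComplex.moduleCat_exact_iff _).mp h2 _ h1

/-- The section sends the frame to its lift `y`. Using restrictions of one and the same `y` over all
smaller open sets makes it compatible with restriction. -/
lemma IsFrame.exists_section {S : ShortComplex M.Modules} {W : M.Opens} {ι : Type} [Fintype ι]
    {e : ι → (ofModules S.X₃).obj W} (he : (ofModules S.X₃).IsFrame W e)
    (y : ι → (ofModules S.X₂).obj W) (hy : ∀ k, mapSections S.g W (y k) = e k) :
    ∃ s : ∀ V, V ≤ W → (ofModules S.X₃).obj V →ₗ[Γ(M, V)] (ofModules S.X₂).obj V,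
      (∀ V h x, mapSections S.g V (s V h x) = x) ∧
      ∀ V (h : V ≤ W) V' (h' : V' ≤ V) x,
        s V' (h'.trans h) ((ofModules S.X₃).res h' x) = (ofModules S.X₂).res h' (s V h x) := by
  refine ⟨fun V h => (he.basis h).constr Γ(M, V) fun k => (ofModules S.X₂).res h (y k),
    fun V h x => ?_, fun V h V' h' x => ?_⟩
  · have h1 : mapSections S.g V ∘ₗ ((he.basis h).constr Γ(M, V) fun k =>
        (ofModules S.X₂).res h (y k)) = LinearMap.id := (he.basis h).ext fun k => by
      rw [LinearMap.comp_apply, Module.Basis.constr_basis, mapSections_res, hy, he.basis_apply]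
      rfl
    exact LinearMap.congr_fun h1 x
  · obtain ⟨c, rfl⟩ := (he V h).2 x
    simp only [map_sum, ModuleFamily.res_smul, map_smul, ModuleFamily.res_res]
    refine Finset.sum_congr rfl fun k _ => ?_
    rw [← he.basis_apply, ← he.basis_apply, Module.Basis.constr_basis, Module.Basis.constr_basis,
      ModuleFamily.res_res]

lemma exists_open_of_forall {ι : Type} [Finite ι] (x : M) (p : ι → M.Opens → Prop)
    (hp : ∀ i U V, V ≤ U → p i U → p i V) (h : ∀ i, ∃ U, x ∈ U ∧ p i U) :
    ∃ U, x ∈ U ∧ ∀ i, p i U := by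
  classical
  cases nonempty_fintype ι
  choose U hU hpU using h
  refine ⟨Finset.univ.inf U, ?_, fun i => hp i _ _ (Finset.inf_le (Finset.mem_univ i)) (hpU i)⟩
  have : ∀ s : Finset ι, x ∈ (s.inf U : M.Opens) := by
    intro s
    induction s using Finset.induction_on with
    | empty => trivial
    | insert i s hi ih => rw [Finset.inf_insert]; exact ⟨hU i, ih⟩
  exact this _

/-- A short exact sequence of sheaves of modules with free cokernel locally splits. -/
lemma exists_section {S : ShortComplex M.Modules} (hS : S.ShortExact)
    (h₃ : (ofModules S.X₃).IsLocallyFree) (x : M) :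
    ∃ W, x ∈ W ∧
      ∃ s : ∀ V, V ≤ W → (ofModules S.X₃).obj V →ₗ[Γ(M, V)] (ofModules S.X₂).obj V,
      (∀ V h x, mapSections S.g V (s V h x) = x) ∧
      ∀ V (h : V ≤ W) V' (h' : V' ≤ V) x,
        s V' (h'.trans h) ((ofModules S.X₃).res h' x) = (ofModules S.X₂).res h' (s V h x) := by
  obtain ⟨U, hx, r, e, he⟩ := h₃ x
  have := hS.epi_g
  obtain ⟨W, hxW, hW⟩ := exists_open_of_forall x
    (fun k W => ∃ (h : W ≤ U) (y : _), mapSections S.g W y = (ofModules S.X₃).res h (e k))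
    (fun k W W' h' ⟨h, y, hy⟩ => ⟨h'.trans h, (ofModules S.X₂).res h' y, by
      rw [mapSections_res, hy, ModuleFamily.res_res]⟩)
    (fun k => by
      obtain ⟨W, hW, hxW, y, hy⟩ := exists_mapSections_eq_res S.g (e k) x hx
      exact ⟨W, hxW, hW, y, hy⟩)
  choose hWU y hy using hW
  obtain ⟨s, hs⟩ := (he.res (V := U ⊓ W) inf_le_left).exists_section
    (fun k => (ofModules S.X₂).res inf_le_right (y k)) (fun k => by
      rw [mapSections_res, hy, ModuleFamily.res_res])
  exact ⟨U ⊓ W, ⟨hx, hxW⟩, s, hs⟩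

/-- With a local section `s` of `S.g`, the map `1 - s ∘ S.g` is an idempotent of `S.X₂` with image
`S.X₁`. -/
lemma IsLocallyFree.of_shortExact {S : ShortComplex M.Modules} (hS : S.ShortExact)
    (h₂ : (ofModules S.X₂).IsLocallyFree) (h₃ : (ofModules S.X₃).IsLocallyFree) :
    (ofModules S.X₁).IsLocallyFree := by
  intro x
  have := hS.mono_f
  obtain ⟨U, hxU, r, e, he⟩ := h₂ x
  obtain ⟨W, hxW, s, hs, sres⟩ := exists_section hS h₃ x
  have hgf : ∀ V (z : (ofModules S.X₁).obj V), mapSections S.g V (mapSections S.f V z) = 0 :=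
    fun V z => by rw [← mapSections_comp, S.zero]; rfl
  obtain ⟨W', hx, -, r', e', he'⟩ := (he.res (V := U ⊓ W) inf_le_left).exists_isFrame_of_idempotent
    (fun V _ => mapSections S.f V)
    (fun V h => LinearMap.id - s V (h.trans inf_le_right) ∘ₗ mapSections S.g V)
    (fun V _ => mapSections_injective S.f V)
    (fun V h z => by simp [hgf])
    (fun V h z => exists_mapSections_eq hS.exact V _ (by simp [hs]))
    (fun V h V' h' z => mapSections_res _ _ _)
    (fun V h V' h' z => by
      simp only [LinearMap.sub_apply, LinearMap.id_apply, LinearMap.comp_apply, map_sub,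
        mapSections_res, sres V (h.trans inf_le_right)])
    x ⟨hxU, hxW⟩
  exact ⟨W', hx, r', e', he'⟩

/-- Locally the sequence splits, and a frame of `S.X₁` together with a lifted frame of `S.X₃` is a
frame of `S.X₂`. -/
lemma IsLocallyFree.extension {S : ShortComplex M.Modules} (hS : S.ShortExact)
    (h₁ : (ofModules S.X₁).IsLocallyFree) (h₃ : (ofModules S.X₃).IsLocallyFree) :
    (ofModules S.X₂).IsLocallyFree := by
  intro x
  have := hS.mono_f
  obtain ⟨U₁, hx₁, r₁, e₁, he₁⟩ := h₁ x
  obtain ⟨U₃, hx₃, r₃, e₃, he₃⟩ := h₃ x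
  obtain ⟨W, hxW, s, hs, sres⟩ := exists_section hS h₃ x
  have hgf : ∀ V (z : (ofModules S.X₁).obj V), mapSections S.g V (mapSections S.f V z) = 0 :=
    fun V z => by rw [← mapSections_comp, S.zero]; rfl
  let U := U₁ ⊓ U₃ ⊓ W
  have hU₁ : U ≤ U₁ := inf_le_left.trans inf_le_left
  have hU₃ : U ≤ U₃ := inf_le_left.trans inf_le_right
  have hU : U ≤ W := inf_le_right
  let e : Fin r₁ ⊕ Fin r₃ → (ofModules S.X₂).obj U := Sum.elim
    (fun k => mapSections S.f U ((ofModules S.X₁).res hU₁ (e₁ k)))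
    (fun k => s U hU ((ofModules S.X₃).res hU₃ (e₃ k)))
  have he : (ofModules S.X₂).IsFrame U e := by
    intro V h
    have h1 : ∀ c : Fin r₁ ⊕ Fin r₃ → Γ(M, V), ∑ k, c k • (ofModules S.X₂).res h (e k) =
        mapSections S.f V (∑ k, c (.inl k) • (ofModules S.X₁).res (h.trans hU₁) (e₁ k)) +
          s V (h.trans hU) (∑ k, c (.inr k) • (ofModules S.X₃).res (h.trans hU₃) (e₃ k)) := by
      intro c
      rw [Fintype.sum_sum_type]
      simp only [map_sum, map_smul, e, Sum.elim_inl, Sum.elim_inr]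
      simp only [← mapSections_res, ← sres U hU V h, ModuleFamily.res_res]
    simp only [h1]
    constructor
    · intro c c' hcc
      have h2 := congrArg (mapSections S.g V) hcc
      simp only [map_add, hgf, zero_add, hs] at h2
      have h3 := (he₃ V (h.trans hU₃)).1 h2
      simp only [h2, add_left_inj] at hcc
      have h4 := (he₁ V (h.trans hU₁)).1 (mapSections_injective S.f V hcc)
      funext k
      rcases k with k | k
      · exact congrFun h4 k
      · exact congrFun h3 k
    · intro y
      obtain ⟨c₃, hc₃⟩ := (he₃ V (h.trans hU₃)).2 (mapSections S.g V y)
      obtain ⟨z, hz⟩ := exists_mapSections_eq hS.exact V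
        (y - s V (h.trans hU) (mapSections S.g V y)) (by simp [hs])
      obtain ⟨c₁, hc₁⟩ := (he₁ V (h.trans hU₁)).2 z
      refine ⟨Sum.elim c₁ c₃, ?_⟩
      simp only [Sum.elim_inl, Sum.elim_inr]
      simp only at hc₁ hc₃
      rw [hc₁, hc₃, hz]
      abel
  exact ⟨U, ⟨⟨hx₁, hx₃⟩, hxW⟩, _, _, he.reindex finSumFinEquiv.symm⟩

lemma isLocallyFree_of_isZero {E : M.Modules} (hE : Limits.IsZero E) :
    (ofModules E).IsLocallyFree := fun _ =>
  ⟨⊤, trivial, 0, Fin.elim0, isFrame_of_subsingleton (subsingleton_of_isZero hE) _⟩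

/-! ### Local contractibility of acyclic complexes -/

section Acyclic

variable {K : CochainComplex M.Modules ℤ}

lemma shortExact_cycles (hK : K.Acyclic) (i j : ℤ) (hij : i + 1 = j) :
    (ShortComplex.mk (K.iCycles i) (K.toCycles i j) (by
      rw [← cancel_mono (K.iCycles j)]; simp)).ShortExact := by
  -- The cokernel of `K.toCycles i j` is the homology in degree `j`, which vanishes.
  have hepi : Epi (K.toCycles i j) := Preadditive.epi_of_isZero_cokernel' _
    (K.homologyIsCokernel i j (by simp [← hij])) (hK j).isZero_homology
  refine { exact := ?_, mono_f := inferInstanceAs (Mono (K.iCycles i)), epi_g := hepi }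
  refine ShortComplex.exact_of_f_is_kernel _ ?_
  exact Limits.isKernelOfComp (K.iCycles j) (K.d i j) (K.cyclesIsKernel i j (by simp [hij])) _
    (K.toCycles_i i j)

lemma isZero_cycles {i : ℤ} (h : Limits.IsZero (K.X i)) : Limits.IsZero (K.cycles i) :=
  Limits.IsZero.of_mono (K.iCycles i) h

lemma isLocallyFree_cycles (hK : K.Acyclic) (hb : IsBoundedComplex K)
    (h : ∀ i, (ofModules (K.X i)).IsLocallyFree) (i : ℤ) :
    (ofModules (K.cycles i)).IsLocallyFree := by
  obtain ⟨a, b, hab⟩ := hb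
  -- Descending induction from the upper bound, where the cycles vanish: the cycles in degree `i`
  -- are the kernel of an epimorphism from `K.X i` to those in degree `i + 1`.
  have key : ∀ (n : ℕ) (i : ℤ), b < i + n → (ofModules (K.cycles i)).IsLocallyFree := by
    intro n
    induction n with
    | zero =>
      exact fun i hi => isLocallyFree_of_isZero (isZero_cycles (hab i (Or.inr (by simpa using hi))))
    | succ n ih =>
      exact fun i hi => IsLocallyFree.of_shortExact (shortExact_cycles hK i (i + 1) rfl) (h i)
        (ih (i + 1) (by push_cast at hi; linarith))
  exact key (b + 1 - i).toNat i (by omega)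

/-- Sections are chosen for all pairs `i j`, with `0` when `i + 1 ≠ j`, so that they can be used
between the degrees `a - 1` and `a` without casts. -/
lemma exists_section_cycles (hK : K.Acyclic) (hb : IsBoundedComplex K)
    (h : ∀ i, (ofModules (K.X i)).IsLocallyFree) (x : M) :
    ∃ U, x ∈ U ∧ ∀ W ≤ U, ∀ i j, ∃ s : (ofModules (K.cycles j)).obj W →ₗ[Γ(M, W)]
      (ofModules (K.X i)).obj W, i + 1 = j → ∀ z, mapSections (K.toCycles i j) W (s z) = z := by
  have hZ := isLocallyFree_cycles hK hb h
  obtain ⟨a, b, hab⟩ := hb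
  let p (i : ℤ) (U : M.Opens) : Prop := ∀ W ≤ U, ∃ s : (ofModules (K.cycles (i + 1))).obj W
    →ₗ[Γ(M, W)] (ofModules (K.X i)).obj W, ∀ z, mapSections (K.toCycles i (i + 1)) W (s z) = z
  -- The range starts at `a - 1`, because the section in degree `i` is defined on the cycles in
  -- degree `i + 1`.
  obtain ⟨U, hxU, hU⟩ := exists_open_of_forall (ι := Finset.Icc (a - 1) b) x (fun i => p i)
    (fun i U V hVU hp W hW => hp W (hW.trans hVU)) (fun i => by
      obtain ⟨U, hx, s, hs, -⟩ := exists_section (shortExact_cycles hK i.1 (i.1 + 1) rfl)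
        (hZ _) x
      exact ⟨U, hx, fun W hW => ⟨s W hW, hs W hW⟩⟩)
  have hp : ∀ i, p i U := by
    intro i
    by_cases hi : i ∈ Finset.Icc (a - 1) b
    · exact hU ⟨i, hi⟩
    · intro W _
      have := subsingleton_of_isZero (isZero_cycles (hab (i + 1) (by
        rw [Finset.mem_Icc] at hi; omega))) W
      exact ⟨0, fun z => Subsingleton.elim _ _⟩
  refine ⟨U, hxU, fun W hW i j => ?_⟩
  by_cases hij : i + 1 = j
  · subst hij
    obtain ⟨s, hs⟩ := hp i W hW
    exact ⟨s, fun _ => hs⟩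
  · exact ⟨0, fun h => (hij h).elim⟩

lemma _root_.LinearMap.exists_comp_eq {R A B C : Type*} [Ring R] [AddCommGroup A] [AddCommGroup B]
    [AddCommGroup C] [Module R A] [Module R B] [Module R C] (i : A →ₗ[R] B) (f : C →ₗ[R] B)
    (hi : Function.Injective i) (hf : ∀ c, ∃ a, i a = f c) : ∃ g : C →ₗ[R] A, ∀ c, i (g c) = f c :=
  ⟨(LinearEquiv.ofInjective i hi).symm.toLinearMap ∘ₗ f.codRestrict (LinearMap.range i) hf,
    fun c => congrArg Subtype.val
      ((LinearEquiv.ofInjective i hi).apply_symm_apply (f.codRestrict (LinearMap.range i) hf c))⟩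

/-- An acyclic bounded complex of vector bundles is locally contractible. -/
lemma exists_contraction [M.Over (Spec (CommRingCat.of ℂ))]
    (hK : K.Acyclic) (hb : IsBoundedComplex K)
    (h : ∀ i, (ofModules (K.X i)).IsLocallyFree) (x : M) :
    ∃ U, x ∈ U ∧ ∀ W ≤ U, ∃ h : ∀ a b, (SchurComplex.sections K W).X a →ₗ[Γ(M, W)]
      (SchurComplex.sections K W).X b, ∀ a z,
        (SchurComplex.sections K W).d (a - 1) a (h a (a - 1) z) +
          h (a + 1) a ((SchurComplex.sections K W).d a (a + 1) z) = z := by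
  obtain ⟨U, hxU, hU⟩ := exists_section_cycles hK hb h x
  refine ⟨U, hxU, fun W hW => ?_⟩
  choose s hs using hU W hW
  -- The section `s` splits off the cycles; `p` is the resulting projection onto them.
  have hp : ∀ a, ∃ p : (ofModules (K.X a)).obj W →ₗ[Γ(M, W)] (ofModules (K.cycles a)).obj W,
      ∀ z, mapSections (K.iCycles a) W (p z) =
        z - s a (a + 1) (mapSections (K.toCycles a (a + 1)) W z) := by
    intro a
    obtain ⟨p, hp⟩ := LinearMap.exists_comp_eq (mapSections (K.iCycles a) W)
      (LinearMap.id - s a (a + 1) ∘ₗ mapSections (K.toCycles a (a + 1)) W)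
      (mapSections_injective _ W) (fun z => by
        have := (shortExact_cycles hK a (a + 1) rfl).mono_f
        exact exists_mapSections_eq (shortExact_cycles hK a (a + 1) rfl).exact W _ (by simp [hs]))
    exact ⟨p, hp⟩
  choose p hp using hp
  -- The contraction is `s ∘ p`: then `dh` is the projection to the cycles, and `hd` is the
  -- complementary projection `s ∘ toCycles`.
  suffices key : ∀ a (z : (ofModules (K.X a)).obj W),
      mapSections (K.d (a - 1) a) W (s (a - 1) a (p a z)) +
        s a (a + 1) (p (a + 1) (mapSections (K.d a (a + 1)) W z)) = z from
    ⟨fun a b => s b a ∘ₗ p a, key⟩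
  intro a z
  have hd : ∀ a b (z : (ofModules (K.X a)).obj W), mapSections (K.d a b) W z =
      mapSections (K.iCycles b) W (mapSections (K.toCycles a b) W z) := by
    intro a b z
    rw [← mapSections_comp, K.toCycles_i]
  have h1 : mapSections (K.d (a - 1) a) W (s (a - 1) a (p a z)) =
      z - s a (a + 1) (mapSections (K.toCycles a (a + 1)) W z) := by
    rw [hd, hs _ _ (by ring), hp]
  have h2 : p (a + 1) (mapSections (K.d a (a + 1)) W z) =
      mapSections (K.toCycles a (a + 1)) W z := by
    refine mapSections_injective (K.iCycles (a + 1)) W ?_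
    rw [hp, ← mapSections_comp, K.d_toCycles, mapSections_zero, map_zero, sub_zero, hd]
  rw [h1, h2, sub_add_cancel]

end Acyclic

end ModuleFamily

end Exactness

/-! ### Classes in the Grothendieck group -/

namespace KGroup

variable {C : Type*} [Category* C] [Abelian C] {A B : ObjectProperty C}

lemma mk_eq_add {S : ShortComplex C} (hS : S.ShortExact) (h₁ : A S.X₁) (h₂ : A S.X₂)
    (h₃ : A S.X₃) : mk S.X₂ h₂ = mk S.X₁ h₁ + mk S.X₃ h₃ := by
  refine sub_eq_zero.mp ((QuotientAddGroup.eq_zero_iff _).mpr ?_)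
  exact AddSubgroup.subset_closure ⟨S, hS, h₁, h₂, h₃, rfl⟩

/-- The sequence `0 → X → X → X → 0` with zero maps is exact for a zero object, and gives `[X] = [X]
+ [X]`. -/
lemma mk_eq_zero {X : C} (hX : A X) (h : Limits.IsZero X) : mk X hX = 0 := by
  have hS : (ShortComplex.mk (0 : X ⟶ X) (0 : X ⟶ X) (by simp)).ShortExact :=
    { exact := ShortComplex.exact_of_isZero_X₂ _ h
      mono_f := ⟨fun _ _ _ => h.eq_of_tgt _ _⟩
      epi_g := ⟨fun _ _ _ => h.eq_of_src _ _⟩ }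
  simpa using mk_eq_add hS hX hX hX

/-- An isomorphism is a short exact sequence with zero third term. A zero object `Z` satisfying `A`
is part of the data, as a general `A` need not have one. -/
lemma mk_congr {X Y Z : C} (hX : A X) (hY : A Y) (hZ : A Z) (h : Limits.IsZero Z) (e : X ≅ Y) :
    mk X hX = mk Y hY := by
  have hS : (ShortComplex.mk e.hom (0 : Y ⟶ Z) (by simp)).ShortExact :=
    { exact := (ShortComplex.exact_iff_epi _ rfl).mpr (inferInstanceAs (Epi e.hom))
      mono_f := inferInstanceAs (Mono e.hom)
      epi_g := ⟨fun _ _ _ => h.eq_of_src _ _⟩ }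
  have h1 := mk_eq_add hS hX hY hZ
  rw [mk_eq_zero hZ h, add_zero] at h1
  exact h1.symm

lemma mk_biprod {X Y : C} (hX : A X) (hY : A Y) (h : A (X ⊞ Y)) : mk (X ⊞ Y) h = mk X hX + mk Y hY :=
  mk_eq_add (ShortComplex.Splitting.ofHasBinaryBiproduct X Y).shortExact hX h hY

/-- The homomorphism induced by an inclusion of subcategories. -/
noncomputable def map (hAB : A ≤ B) : KGroup A →+ KGroup B :=
  QuotientAddGroup.lift _ (FreeAbelianGroup.lift fun X => mk X.obj (hAB _ X.property)) <| by
    rw [AddSubgroup.closure_le]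
    rintro _ ⟨S, hS, h₁, h₂, h₃, rfl⟩
    change FreeAbelianGroup.lift _ _ = 0
    rw [map_sub, map_add, FreeAbelianGroup.lift_apply_of, FreeAbelianGroup.lift_apply_of,
      FreeAbelianGroup.lift_apply_of]
    exact sub_eq_zero.mpr (mk_eq_add hS (hAB _ h₁) (hAB _ h₂) (hAB _ h₃))

lemma map_mk (hAB : A ≤ B) (X : C) (hX : A X) : map hAB (mk X hX) = mk X (hAB _ hX) :=
  FreeAbelianGroup.lift_apply_of _ _

lemma finite_support_ofComplex {K : CochainComplex C ℤ} (hb : IsBoundedComplex K)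
    (hK : ∀ i, A (K.X i)) :
    (Function.support fun i : ℤ => (i.negOnePow : ℤ) • mk (K.X i) (hK i)).Finite := by
  obtain ⟨a, b, hab⟩ := hb
  refine (Set.finite_Icc a b).subset fun i hi => ?_
  by_contra h
  refine hi ?_
  simp only [Set.mem_Icc, not_and_or, not_le] at h
  simp only [mk_eq_zero (hK i) (hab i h), smul_zero]

lemma map_ofComplex (hAB : A ≤ B) {K : CochainComplex C ℤ} (hb : IsBoundedComplex K)
    (hK : ∀ i, A (K.X i)) : map hAB (ofComplex K hK) = ofComplex K fun i => hAB _ (hK i) := by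
  unfold ofComplex
  rw [AddMonoidHom.map_finsum _ (finite_support_ofComplex hb hK)]
  simp only [map_zsmul, map_mk]

lemma ofComplex_congr {K L : CochainComplex C ℤ} (hK : ∀ i, A (K.X i)) (hL : ∀ i, A (L.X i))
    (hK' : IsBoundedComplex K) (e : ∀ i, K.X i ≅ L.X i) : ofComplex K hK = ofComplex L hL := by
  obtain ⟨a, b, hab⟩ := hK'
  exact finsum_congr fun i => by
    -- The term in degree `a - 1`, below the lower bound, serves as the zero object.
    rw [mk_congr (hK i) (hL i) (hK (a - 1)) (hab _ (Or.inl (by omega))) (e i)]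

/-- With `g i = (-1) ^ i [Z i]`, the summand in degree `i` is `g i - g (i + 1)`, and shifting the
index does not change the finite sum of `g`. -/
lemma ofComplex_eq_zero_of_cycles {K : CochainComplex C ℤ} (hb : IsBoundedComplex K)
    (hK : ∀ i, A (K.X i)) (Z : ℤ → C) (hZ : ∀ i, A (Z i))
    (hZ0 : ∀ i, Limits.IsZero (K.X i) → Limits.IsZero (Z i))
    (h : ∀ i, mk (K.X i) (hK i) = mk (Z i) (hZ i) + mk (Z (i + 1)) (hZ (i + 1))) :
    ofComplex K hK = 0 := by
  let g : ℤ → KGroup A := fun i => (i.negOnePow : ℤ) • mk (Z i) (hZ i)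
  have hg : (Function.support g).Finite := by
    obtain ⟨a, b, hab⟩ := hb
    refine (Set.finite_Icc a b).subset fun i hi => ?_
    by_contra h
    refine hi ?_
    simp only [Set.mem_Icc, not_and_or, not_le] at h
    simp only [g, mk_eq_zero (hZ i) (hZ0 i (hab i h)), smul_zero]
  have h1 : ∀ i : ℤ, (i.negOnePow : ℤ) • mk (K.X i) (hK i) = g i - g (i + 1) := by
    intro i
    simp only [g, h, smul_add, Int.negOnePow_succ, Units.val_neg, neg_smul, sub_neg_eq_add]
  unfold ofComplex
  rw [finsum_congr h1, finsum_sub_distrib hg (hg.preimage (add_left_injective 1).injOn)]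
  exact sub_eq_zero.mpr (finsum_comp_equiv (Equiv.addRight (1 : ℤ))).symm

/-- The class of the cone is the difference of the classes. -/
lemma ofComplex_sub_eq {K L Q : CochainComplex C ℤ} (hbK : IsBoundedComplex K)
    (hbL : IsBoundedComplex L)
    (hK : ∀ i, A (K.X i)) (hL : ∀ i, A (L.X i)) (hQ : ∀ i, A (Q.X i))
    (h : ∀ i, mk (Q.X i) (hQ i) = mk (K.X (i + 1)) (hK (i + 1)) + mk (L.X i) (hL i)) :
    ofComplex Q hQ = ofComplex L hL - ofComplex K hK := by
  let g : ℤ → KGroup A := fun i => (i.negOnePow : ℤ) • mk (K.X i) (hK i)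
  have hg : (Function.support g).Finite := finite_support_ofComplex hbK hK
  unfold ofComplex
  have h1 : ∀ i : ℤ, (i.negOnePow : ℤ) • mk (Q.X i) (hQ i) =
      (i.negOnePow : ℤ) • mk (L.X i) (hL i) - g (i + 1) := by
    intro i
    simp only [g, h, smul_add, Int.negOnePow_succ, Units.val_neg, neg_smul, sub_neg_eq_add]
    exact add_comm _ _
  rw [finsum_congr h1, finsum_sub_distrib (finite_support_ofComplex hbL hL)
    (hg.preimage (add_left_injective 1).injOn)]
  exact congrArg _ (finsum_comp_equiv (f := g) (Equiv.addRight (1 : ℤ)))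

end KGroup

/-! ### Mapping cones -/

section Cone

variable {C : Type*} [Category* C] [Abelian C] {K L : CochainComplex C ℤ}

/-- In the homotopy category, the quasi-isomorphisms are the morphisms whose cone is acyclic. -/
lemma acyclic_mappingCone (f : K ⟶ L) [QuasiIso f] :
    (CochainComplex.mappingCone f).Acyclic := by
  have h := (HomotopyCategory.subcategoryAcyclic C).trW_iff_of_distinguished _
    (HomotopyCategory.mappingCone_triangleh_distinguished f)
  rw [← HomotopyCategory.quasiIso_eq_trW_subcategoryAcyclic] at h
  rw [← HomotopyCategory.quotient_obj_mem_subcategoryAcyclic_iff_acyclic]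
  refine h.mp ?_
  change HomotopyCategory.quasiIso C _ ((HomotopyCategory.quotient C _).map f)
  rwa [HomotopyCategory.quotient_map_mem_quasiIso_iff]

/-- The terms of a mapping cone. -/
noncomputable def mappingConeXIso (f : K ⟶ L) (i : ℤ) :
    (CochainComplex.mappingCone f).X i ≅ K.X (i + 1) ⊞ L.X i :=
  HomologicalComplex.homotopyCofiber.XIsoBiprod f i (i + 1) rfl

lemma isBoundedComplex_mappingCone (f : K ⟶ L) (hK : IsBoundedComplex K)
    (hL : IsBoundedComplex L) : IsBoundedComplex (CochainComplex.mappingCone f) := by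
  obtain ⟨a, b, h⟩ := hK
  obtain ⟨a', b', h'⟩ := hL
  refine ⟨min (a - 1) a', max b b', fun i hi => ?_⟩
  refine Limits.IsZero.of_iso ?_ (mappingConeXIso f i)
  rw [Limits.biprod_isZero_iff]
  exact ⟨h _ (by omega), h' _ (by omega)⟩

end Cone

/-! ### Invariance of the class under quasi-isomorphisms -/

section VectorBundles

variable {M : Scheme.{0}}

lemma isVectorBundle.biprod {E F : M.Modules} (hE : isVectorBundle M E) (hF : isVectorBundle M F) :
    isVectorBundle M (E ⊞ F) :=
  (isVectorBundle_iff _).mpr (ModuleFamily.IsLocallyFree.extension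
    (ShortComplex.Splitting.ofHasBinaryBiproduct E F).shortExact ((isVectorBundle_iff _).mp hE)
    ((isVectorBundle_iff _).mp hF))

lemma isVectorBundle.of_iso {E F : M.Modules} (hE : isVectorBundle M E) (e : E ≅ F) :
    isVectorBundle M F :=
  (isVectorBundle_iff _).mpr (((isVectorBundle_iff _).mp hE).of_iso e)

variable {K L : CochainComplex M.Modules ℤ}

/-- The cycles are vector bundles, so the sequences `0 → Z^i → K^i → Z^{i+1} → 0` give relations in
the Grothendieck group, and the alternating sum telescopes. -/
lemma KGroup.ofComplex_eq_zero_of_acyclic (hK : K.Acyclic) (hb : IsBoundedComplex K)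
    (h : ∀ i, isVectorBundle M (K.X i)) : KGroup.ofComplex K h = 0 :=
  KGroup.ofComplex_eq_zero_of_cycles hb h (fun i => K.cycles i)
    (fun i => (isVectorBundle_iff _).mpr (ModuleFamily.isLocallyFree_cycles hK hb
      (fun i => (isVectorBundle_iff _).mp (h i)) i))
    (fun _ => ModuleFamily.isZero_cycles)
    (fun i => KGroup.mk_eq_add (ModuleFamily.shortExact_cycles hK i (i + 1) rfl) _ _ _)

lemma isVectorBundle_mappingCone (f : K ⟶ L) (hK : ∀ i, isVectorBundle M (K.X i))
    (hL : ∀ i, isVectorBundle M (L.X i)) (i : ℤ) :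
    isVectorBundle M ((CochainComplex.mappingCone f).X i) :=
  ((hK (i + 1)).biprod (hL i)).of_iso (mappingConeXIso f i).symm

/-- Quasi-isomorphic bounded complexes of vector bundles have the same class. -/
lemma KGroup.ofComplex_eq_of_quasiIso (f : K ⟶ L) [QuasiIso f]
    (hbK : IsBoundedComplex K) (hbL : IsBoundedComplex L)
    (hK : ∀ i, isVectorBundle M (K.X i)) (hL : ∀ i, isVectorBundle M (L.X i)) :
    KGroup.ofComplex K hK = KGroup.ofComplex L hL := by
  have hQ := isVectorBundle_mappingCone f hK hL
  have hbQ := isBoundedComplex_mappingCone f hbK hbL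
  have h0 := KGroup.ofComplex_eq_zero_of_acyclic (acyclic_mappingCone f) hbQ hQ
  obtain ⟨a, b, hab⟩ := hbK
  rw [KGroup.ofComplex_sub_eq ⟨a, b, hab⟩ hbL hK hL hQ fun i => ?_, sub_eq_zero] at h0
  · exact h0.symm
  · rw [KGroup.mk_congr (hQ i) ((hK (i + 1)).biprod (hL i)) (hK (a - 1))
      (hab _ (Or.inl (by omega))) (mappingConeXIso f i)]
    exact KGroup.mk_biprod _ _ _

end VectorBundles

namespace SchurComplex

/-! ### Functoriality of Schur complexes and of their terms -/

section Functoriality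

open ModuleFamily Opposite

variable {M : Scheme.{0}} [M.Over (Spec (CommRingCat.of ℂ))]
  {n : ℕ} {V : Type} [AddCommGroup V] [Module ℂ V]
  (ρ : Representation ℂ (Equiv.Perm (Fin n)) V) {P Q T : CochainComplex M.Modules ℤ}

/-- The maps on sections of a family of morphisms between the terms of two complexes. -/
noncomputable def sectionsMap (r : ∀ a, P.X a ⟶ Q.X a) (U : M.Opens) (a : ℤ) :
    (sections P U).X a →ₛₗ[((AlgHom.id ℂ Γ(M, U) : Γ(M, U) →ₐ[ℂ] Γ(M, U)) : Γ(M, U) →+* Γ(M, U))]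
      (sections Q U).X a :=
  mapSections (r a) U

/-- The map on the terms of Schur complexes induced by morphisms of the terms. -/
noncomputable def presheafTermMap (r : ∀ a, P.X a ⟶ Q.X a) (j : ℤ) :
    presheafTerm ρ P j ⟶ presheafTerm ρ Q j :=
  PresheafOfModules.homMk
    { app := fun U => AddCommGrpCat.ofHom
        (schurMap ρ j (AlgHom.id ℂ _) (sectionsMap r U.unop)).toAddMonoidHom
      naturality := fun U W i => AddCommGrpCat.hom_ext <| AddMonoidHom.ext fun x => by
        have : RingHomCompTriple (resAlgHom i.unop : Γ(M, U.unop) →+* Γ(M, W.unop))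
          ((AlgHom.id ℂ Γ(M, W.unop) : Γ(M, W.unop) →ₐ[ℂ] Γ(M, W.unop)) :
            Γ(M, W.unop) →+* Γ(M, W.unop))
          (resAlgHom i.unop : Γ(M, U.unop) →+* Γ(M, W.unop)) := ⟨rfl⟩
        -- Both ways around the naturality square are induced by the same semilinear maps:
        -- restriction followed by `r`.
        have h1 := schurMap_comp ρ j (resAlgHom i.unop) (AlgHom.id ℂ _) (resAlgHom i.unop) rfl
          (sectionsRes P i.unop) (sectionsMap r W.unop)
          (fun a => (sectionsMap r W.unop a).comp (sectionsRes P i.unop a)) (fun _ _ => rfl) x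
        have h2 := schurMap_comp ρ j (AlgHom.id ℂ _) (resAlgHom i.unop) (resAlgHom i.unop) rfl
          (sectionsMap r U.unop) (sectionsRes Q i.unop)
          (fun a => (sectionsMap r W.unop a).comp (sectionsRes P i.unop a))
          (fun a x => mapSections_res (r a) (leOfHom i.unop) x) x
        exact h1.symm.trans h2 }
    fun U c x => (schurMap ρ j (AlgHom.id ℂ _) (sectionsMap r U.unop)).map_smulₛₗ c x

lemma presheafTermMap_id (j : ℤ) :
    presheafTermMap ρ (fun a => 𝟙 (P.X a)) j = 𝟙 _ := by
  ext U x
  exact schurMap_id ρ j _ rfl (sectionsMap (fun a => 𝟙 (P.X a)) U.unop) (fun _ _ => rfl) x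

lemma presheafTermMap_comp (r : ∀ a, P.X a ⟶ Q.X a) (s : ∀ a, Q.X a ⟶ T.X a) (j : ℤ) :
    presheafTermMap ρ (fun a => r a ≫ s a) j = presheafTermMap ρ r j ≫ presheafTermMap ρ s j := by
  ext U x
  exact schurMap_comp ρ j (AlgHom.id ℂ _) (AlgHom.id ℂ _) (AlgHom.id ℂ _) rfl
    (sectionsMap r U.unop) (sectionsMap s U.unop) (sectionsMap (fun a => r a ≫ s a) U.unop)
    (fun _ _ => rfl) x

/-- The terms of a Schur complex depend only on the terms of the complex. -/
noncomputable def presheafTermIso (e : ∀ a, P.X a ≅ Q.X a) (j : ℤ) :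
    presheafTerm ρ P j ≅ presheafTerm ρ Q j where
  hom := presheafTermMap ρ (fun a => (e a).hom) j
  inv := presheafTermMap ρ (fun a => (e a).inv) j
  hom_inv_id := by rw [← presheafTermMap_comp]; simp [presheafTermMap_id]
  inv_hom_id := by rw [← presheafTermMap_comp]; simp [presheafTermMap_id]

/-- The terms of a Schur complex depend only on the terms of the complex. -/
noncomputable def invariantComplexXIso (e : ∀ a, P.X a ≅ Q.X a) (j : ℤ) :
    (invariantComplex ρ P).X j ≅ (invariantComplex ρ Q).X j :=
  (sheafify M).mapIso (presheafTermIso ρ e j)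

lemma presheafComplex_d (P : CochainComplex M.Modules ℤ) (j : ℤ) :
    (presheafComplex ρ P).d j (j + 1) = presheafDiff ρ P j :=
  CochainComplex.of_d _ _ _

/-- The map between Schur complexes induced by a morphism of complexes. -/
noncomputable def presheafMap (s : P ⟶ Q) : presheafComplex ρ P ⟶ presheafComplex ρ Q :=
  CochainComplex.ofHom (presheafTermMap ρ s.f) fun j => by
    rw [presheafComplex_d, presheafComplex_d]
    ext U x
    refine (schurMap_diff ρ j (AlgHom.id ℂ _) (sectionsMap s.f U.unop) (fun a b x => ?_) x).symm
    exact congrArg (fun f => mapSections f U.unop x) (s.comm a b).symm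

lemma presheafMap_id : presheafMap ρ (𝟙 P) = 𝟙 _ := by
  ext1 j
  exact presheafTermMap_id ρ j

lemma presheafMap_comp (s : P ⟶ Q) (t : Q ⟶ T) :
    presheafMap ρ (s ≫ t) = presheafMap ρ s ≫ presheafMap ρ t := by
  ext1 j
  exact presheafTermMap_comp ρ s.f t.f j

end Functoriality

end SchurComplex

/-! ### Detecting zero maps in homology by local boundaries -/

section LocallyBoundary

open ModuleFamily

variable {M : Scheme.{0}}

lemma ModuleFamily.toSheafify_naturality {G G' : M.PresheafOfModules} (f : G ⟶ G') :
    f ≫ toSheafify G' =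
      toSheafify G ≫ (Scheme.Modules.toPresheafOfModules M).map ((SchurComplex.sheafify M).map f) :=
  (PresheafOfModules.sheafificationAdjunction (𝟙 M.ringCatSheaf.obj)).unit.naturality f

lemma ModuleFamily.hom_ext_of_mapSections {E E' : M.Modules} {f g : E ⟶ E'}
    (h : ∀ V x, mapSections f V x = mapSections g V x) : f = g := by
  refine Scheme.Modules.hom_ext _ _ fun V => ?_
  ext x
  exact h V x

/-- A morphism of complexes which locally maps cycles to boundaries is zero in homology. -/
lemma homologyMap_eq_zero_of_locally {K L : CochainComplex M.Modules ℤ} (f : K ⟶ L) (j : ℤ)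
    (h : ∀ V (z : (ofModules (K.X (j + 1))).obj V), mapSections (K.d (j + 1) (j + 1 + 1)) V z = 0 →
      ∀ p ∈ V, ∃ (W : M.Opens) (hW : W ≤ V), p ∈ W ∧ ∃ y, mapSections (L.d j (j + 1)) W y =
        (ofModules (L.X (j + 1))).res hW (mapSections (f.f (j + 1)) V z)) :
    HomologicalComplex.homologyMap f (j + 1) = 0 := by
  rw [← cancel_epi (K.homologyπ (j + 1)), Limits.comp_zero,
    HomologicalComplex.homologyπ_naturality]
  refine hom_ext_of_mapSections fun V z => ?_
  rw [mapSections_comp, mapSections_zero]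
  refine ofModules_eq_zero _ _ fun p hp => ?_
  obtain ⟨W, hW, hpW, y, hy⟩ := h V (mapSections (K.iCycles (j + 1)) V z) (by
    rw [← mapSections_comp, K.iCycles_d, mapSections_zero]) p hp
  refine ⟨W, hW, hpW, ?_⟩
  -- The image cycle is locally the boundary of `y`, so its homology class is locally zero, hence
  -- zero in the homology sheaf.
  have h1 : (ofModules (L.cycles (j + 1))).res hW
      (mapSections (HomologicalComplex.cyclesMap f (j + 1)) V z) =
        mapSections (L.toCycles j (j + 1)) W y := by
    refine mapSections_injective (L.iCycles (j + 1)) W ?_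
    rw [← mapSections_comp, L.toCycles_i, hy, mapSections_res, ← mapSections_comp,
      HomologicalComplex.cyclesMap_i, mapSections_comp]
  rw [← mapSections_res, h1, ← mapSections_comp, L.toCycles_comp_homologyπ, mapSections_zero]

/-- The map on sections of a morphism of presheaves of modules. -/
noncomputable def ModuleFamily.mapPresheafSections {G G' : M.PresheafOfModules} (g : G ⟶ G')
    (V : M.Opens) : (ofPresheaf G).obj V →ₗ[Γ(M, V)] (ofPresheaf G').obj V :=
  (g.app (.op V)).hom

lemma ModuleFamily.mapPresheafSections_res {G G' : M.PresheafOfModules} (g : G ⟶ G')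
    {V W : M.Opens} (h : W ≤ V) (x : (ofPresheaf G).obj V) :
    mapPresheafSections g W ((ofPresheaf G).res h x) =
      (ofPresheaf G').res h (mapPresheafSections g V x) :=
  PresheafOfModules.naturality_apply g (homOfLE h).op x

/-- The map on sections from a presheaf of modules to its sheafification. -/
noncomputable def ModuleFamily.toSheafifySections (G : M.PresheafOfModules) (V : M.Opens) :
    (ofPresheaf G).obj V →ₗ[Γ(M, V)] (ofModules ((SchurComplex.sheafify M).obj G)).obj V :=
  ((ModuleFamily.toSheafify G).app (.op V)).hom

lemma ModuleFamily.toSheafifySections_res (G : M.PresheafOfModules) {V W : M.Opens} (h : W ≤ V)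
    (x : (ofPresheaf G).obj V) :
    toSheafifySections G W ((ofPresheaf G).res h x) =
      (ofModules ((SchurComplex.sheafify M).obj G)).res h (toSheafifySections G V x) :=
  PresheafOfModules.naturality_apply (ModuleFamily.toSheafify G) (homOfLE h).op x

lemma ModuleFamily.mapSections_toSheafifySections {G G' : M.PresheafOfModules} (g : G ⟶ G')
    (V : M.Opens) (x : (ofPresheaf G).obj V) :
    mapSections ((SchurComplex.sheafify M).map g) V (toSheafifySections G V x) =
      toSheafifySections G' V (mapPresheafSections g V x) :=
  (congrArg (fun t => t.app (.op V) x) (toSheafify_naturality g)).symm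

lemma ModuleFamily.exists_toSheafifySections_eq (G : M.PresheafOfModules) {V : M.Opens}
    (y : (ofModules ((SchurComplex.sheafify M).obj G)).obj V) (p : M) (hp : p ∈ V) :
    ∃ (W : M.Opens) (hW : W ≤ V), p ∈ W ∧ ∃ x : (ofPresheaf G).obj W,
      toSheafifySections G W x = (ofModules ((SchurComplex.sheafify M).obj G)).res hW y :=
  exists_toSheafify_eq G y p hp

/-- A morphism of complexes of presheaves of modules which locally maps cycles to boundaries is zero
in homology after sheafification. -/
lemma homologyMap_sheafify_eq_zero {D D' : CochainComplex M.PresheafOfModules ℤ} (f : D ⟶ D')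
    (j : ℤ)
    (h : ∀ V (x : (ofPresheaf (D.X (j + 1))).obj V),
      mapPresheafSections (D.d (j + 1) (j + 1 + 1)) V x = 0 →
      ∀ p ∈ V, ∃ (W : M.Opens) (hW : W ≤ V), p ∈ W ∧
        ∃ y, mapPresheafSections (D'.d j (j + 1)) W y =
          (ofPresheaf (D'.X (j + 1))).res hW (mapPresheafSections (f.f (j + 1)) V x)) :
    HomologicalComplex.homologyMap
      (((SchurComplex.sheafify M).mapHomologicalComplex _).map f) (j + 1) = 0 := by
  refine homologyMap_eq_zero_of_locally _ j fun V z hz p hp => ?_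
  change mapSections ((SchurComplex.sheafify M).map (D.d (j + 1) (j + 1 + 1))) V z = 0 at hz
  change (ofModules ((SchurComplex.sheafify M).obj (D.X (j + 1)))).obj V at z
  obtain ⟨W, hW, hpW, x, hx⟩ := exists_toSheafifySections_eq _ z p hp
  have h1 : toSheafifySections _ W (mapPresheafSections (D.d (j + 1) (j + 1 + 1)) W x) = 0 := by
    rw [← mapSections_toSheafifySections, hx, mapSections_res, hz, map_zero]
  -- The presheaf lift `x` of `z` has a differential which vanishes only in the sheafification, so a
  -- further shrinking is needed to make `x` a cycle.
  obtain ⟨W', hW', hpW', h2⟩ := exists_res_eq_zero_of_toSheafify _ _ h1 p hpW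
  obtain ⟨W'', hW'', hpW'', y, hy⟩ := h W' ((ofPresheaf _).res hW' x)
    (by rw [mapPresheafSections_res, h2]) p hpW'
  refine ⟨W'', hW''.trans (hW'.trans hW), hpW'', toSheafifySections _ W'' y, ?_⟩
  change mapSections ((SchurComplex.sheafify M).map (D'.d j (j + 1))) W'' _ =
    (ofModules ((SchurComplex.sheafify M).obj (D'.X (j + 1)))).res _
      (mapSections ((SchurComplex.sheafify M).map (f.f (j + 1))) V z)
  rw [mapSections_toSheafifySections, hy, mapPresheafSections_res, ModuleFamily.res_res,
    toSheafifySections_res, ← mapSections_toSheafifySections, hx, mapSections_res,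
    ModuleFamily.res_res]

end LocallyBoundary

namespace SchurComplex

open ModuleFamily

variable {M : Scheme.{0}} [M.Over (Spec (CommRingCat.of ℂ))]
  {n : ℕ} {V : Type} [AddCommGroup V] [Module ℂ V]
  (ρ : Representation ℂ (Equiv.Perm (Fin n)) V)

/-! ### Adding an acyclic complex -/

section QuasiIso

variable {P B C : CochainComplex M.Modules ℤ}

instance sheafify_additive : (sheafify M).Additive :=
  have : Limits.PreservesBinaryBiproducts (sheafify M) :=
    Limits.preservesBinaryBiproducts_of_preservesBinaryCoproducts _
  Functor.additive_of_preservesBinaryBiproducts _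

/-- The map between Schur complexes induced by a morphism of complexes. -/
noncomputable def invariantMap (s : P ⟶ B) : invariantComplex ρ P ⟶ invariantComplex ρ B :=
  ((sheafify M).mapHomologicalComplex _).map (presheafMap ρ s)

lemma invariantMap_id : invariantMap ρ (𝟙 P) = 𝟙 _ := by
  rw [invariantMap, presheafMap_id, CategoryTheory.Functor.map_id]
  rfl

lemma invariantMap_comp (s : P ⟶ B) (t : B ⟶ C) :
    invariantMap ρ (s ≫ t) = invariantMap ρ s ≫ invariantMap ρ t := by
  rw [invariantMap, presheafMap_comp, Functor.map_comp]
  rfl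

/-- If the identity of a complex differs from an endomorphism `e` by a morphism factoring through an
acyclic complex of vector bundles, then `e` induces the identity on the homology of Schur
complexes. -/
lemma homologyMap_invariantMap_eq_id (e : B ⟶ B) (snd : B ⟶ C) (inr : C ⟶ B)
    (h : e + snd ≫ inr = 𝟙 B) (hC : C.Acyclic) (hb : IsBoundedComplex C)
    (hC' : ∀ i, (ofModules (C.X i)).IsLocallyFree) (j : ℤ) :
    HomologicalComplex.homologyMap (invariantMap ρ e) j = 𝟙 _ := by
  -- Boundaries in this degree come from the preceding one, so the degree is written as `j + 1`.
  obtain ⟨j, rfl⟩ : ∃ i, j = i + 1 := ⟨j - 1, by ring⟩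
  have key := homologyMap_sheafify_eq_zero (𝟙 _ - presheafMap ρ e) j fun V
      (x : (ofPresheaf (presheafTerm ρ B (j + 1))).obj V) hx p hp => by
    obtain ⟨U, hpU, hU⟩ := exists_contraction hC hb hC' p
    let W := V ⊓ U
    obtain ⟨h₀, hh₀⟩ : ∃ h₀ : ∀ a b, (ofModules (C.X a)).obj W →ₗ[Γ(M, W)]
          (ofModules (C.X b)).obj W,
        ∀ a z, mapSections (C.d (a - 1) a) W (h₀ a (a - 1) z) +
          h₀ (a + 1) a (mapSections (C.d a (a + 1)) W z) = z := hU W inf_le_right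
    refine ⟨W, inf_le_left, ⟨hp, hpU⟩, ?_⟩
    have hdec : ∀ a (z : (ofModules (B.X a)).obj W),
        mapSections (inr.f a) W (mapSections (snd.f a) W z) = z - mapSections (e.f a) W z := by
      intro a z
      have := congrArg (fun t : B ⟶ B => mapSections (t.f a) W z) h
      simp only [HomologicalComplex.add_f_apply, mapSections_add, HomologicalComplex.comp_f,
        HomologicalComplex.id_f, mapSections_comp] at this
      exact eq_sub_of_add_eq' this
    have hcomm : ∀ {K L : CochainComplex M.Modules ℤ} (f : K ⟶ L) (a b : ℤ)
        (z : (ofModules (K.X a)).obj W), mapSections (f.f b) W (mapSections (K.d a b) W z) =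
          mapSections (L.d a b) W (mapSections (f.f a) W z) := fun f a b z =>
      (congrArg (fun t => mapSections t W z) (f.comm a b)).symm
    have hx' : (presheafDiff ρ B (j + 1)).app (.op V) x = 0 := by
      rw [← presheafComplex_d]
      exact hx
    -- The contraction `h₀` of `C`, conjugated by `snd` and `inr`, is a homotopy on `B` over `W`
    -- between `e` and the identity, because `1 - e` factors through `C`.
    have hB : ∀ a (z : (ofModules (B.X a)).obj W),
        mapSections (B.d (a - 1) a) W (mapSections (inr.f (a - 1)) W
            (h₀ a (a - 1) (mapSections (snd.f a) W z))) +
          mapSections (inr.f a) W (h₀ (a + 1) a (mapSections (snd.f (a + 1)) W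
            (mapSections (B.d a (a + 1)) W z))) = z - mapSections (e.f a) W z := by
      intro a z
      rw [← hcomm inr, hcomm snd, ← map_add, hh₀, hdec]
    obtain ⟨y, hy⟩ := exists_schurDiff_eq ρ j (K := sections B W) (fun a => mapSections (e.f a) W)
      (sectionsMap e.f W) (fun _ _ => rfl) (fun a b z => hcomm e a b z)
      (fun a b => mapSections (inr.f b) W ∘ₗ h₀ a b ∘ₗ mapSections (snd.f a) W) hB
      ((ofPresheaf (presheafTerm ρ B (j + 1))).res inf_le_left x)
      (by
        refine (PresheafOfModules.naturality_apply (presheafDiff ρ B (j + 1))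
          (homOfLE (inf_le_left : W ≤ V)).op x).trans ?_
        exact (congrArg _ hx').trans (map_zero _))
    refine ⟨y, ?_⟩
    rw [presheafComplex_d]
    refine hy.trans ?_
    have h1 : (ofPresheaf (presheafTerm ρ B (j + 1))).res inf_le_left x -
        mapPresheafSections (presheafTermMap ρ e.f (j + 1)) W
          ((ofPresheaf (presheafTerm ρ B (j + 1))).res inf_le_left x) =
        (ofPresheaf (presheafTerm ρ B (j + 1))).res inf_le_left
          (x - mapPresheafSections (presheafTermMap ρ e.f (j + 1)) V x) := by
      rw [map_sub, mapPresheafSections_res]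
    exact h1
  have h1 : ((sheafify M).mapHomologicalComplex (ComplexShape.up ℤ)).map (𝟙 _ - presheafMap ρ e) =
      𝟙 (invariantComplex ρ B) - invariantMap ρ e := by
    rw [Functor.map_sub, CategoryTheory.Functor.map_id]
    rfl
  rw [h1] at key
  have h2 := (HomologicalComplex.homologyMap_sub (𝟙 (invariantComplex ρ B)) (invariantMap ρ e)
    (j + 1)).symm.trans key
  exact (sub_eq_zero.mp h2).symm.trans (HomologicalComplex.homologyMap_id _ _)

/-- On homology `fst` induces the inverse: one composite is the identity already on complexes, the
other by the local homotopies. -/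
lemma quasiIso_invariantMap (inl : P ⟶ B) (fst : B ⟶ P) (snd : B ⟶ C) (inr : C ⟶ B)
    (h₁ : inl ≫ fst = 𝟙 P) (h₂ : fst ≫ inl + snd ≫ inr = 𝟙 B) (hC : C.Acyclic)
    (hb : IsBoundedComplex C) (hC' : ∀ i, (ofModules (C.X i)).IsLocallyFree) :
    QuasiIso (invariantMap ρ inl) := by
  rw [quasiIso_iff]
  intro j
  rw [quasiIsoAt_iff_isIso_homologyMap]
  refine ⟨HomologicalComplex.homologyMap (invariantMap ρ fst) j, ?_, ?_⟩
  · rw [← HomologicalComplex.homologyMap_comp, ← invariantMap_comp, h₁, invariantMap_id,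
      HomologicalComplex.homologyMap_id]
  · rw [← HomologicalComplex.homologyMap_comp, ← invariantMap_comp]
    exact homologyMap_invariantMap_eq_id ρ _ snd inr h₂ hC hb hC' j

end QuasiIso

/-! ### Boundedness and local freeness of Schur complexes -/

section Bounded

/-- If `n` degrees have a sum of absolute value above `n * c`, one of them exceeds `c` in absolute
value, so every homogeneous tensor has a zero entry. -/
lemma subsingleton_tensorPower {R : Type} [CommRing R] {K : CochainComplex (ModuleCat.{0} R) ℤ}
    {c : ℤ} (hK : ∀ a, c < |a| → Subsingleton (K.X a)) {j : ℤ} (hj : n * c < |j|) :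
    Subsingleton (TensorPower K n j) := by
  have h : (LinearMap.id : TensorPower K n j →ₗ[R] TensorPower K n j) = 0 := by
    refine linearMap_ext fun y hy => ?_
    obtain ⟨k, hk⟩ : ∃ k, c < |(y k).1| := by
      by_contra! hc
      refine hj.not_ge ?_
      rw [← hy]
      refine (Finset.abs_sum_le_sum_abs _ _).trans ((Finset.sum_le_sum fun k _ => hc k).trans ?_)
      simp
    have := hK _ hk
    exact homog_eq_zero hy k (a := (y k).1) (Sigma.ext rfl (heq_of_eq (Subsingleton.elim _ _)))
  exact subsingleton_of_forall_eq 0 fun x => LinearMap.congr_fun h x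

lemma isBoundedComplex_invariantComplex {P : CochainComplex M.Modules ℤ} (hP : IsBoundedComplex P) :
    IsBoundedComplex (invariantComplex ρ P) := by
  obtain ⟨a, b, hab⟩ := hP
  let c := max |a| |b|
  have hc : ∀ i, c < |i| → Limits.IsZero (P.X i) := fun i hi => hab i (by
    by_contra! h
    exact hi.not_ge (abs_le_max_abs_abs h.1 h.2))
  refine ⟨-(n * c), n * c, fun j hj => ?_⟩
  have hj' : n * c < |j| := by
    rw [lt_abs]
    omega
  have h0 : Limits.IsZero (presheafTerm ρ P j) := by
    rw [Limits.IsZero.iff_id_eq_zero]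
    ext U x
    have h1 := subsingleton_tensorPower (n := n) (K := sections P U.unop)
      (fun a ha => subsingleton_of_isZero (hc a ha) U.unop) hj'
    have h2 : Subsingleton (TwistedPower V (sections P U.unop) n j) :=
      inferInstanceAs (Subsingleton (_ ⊗[Γ(M, U.unop)] TensorPower (sections P U.unop) n j))
    exact Subsingleton.elim (α := schurTerm ρ (sections P U.unop) j) _ _
  exact (sheafify M).map_isZero h0

end Bounded

instance finite_specht (μ : YoungDiagram) : Module.Finite ℂ (Specht μ) := by
  have : Module.Finite ℂ (MonoidAlgebra ℂ (Equiv.Perm (Fin μ.card))) := by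
    infer_instance
  exact Module.Finite.of_injective
    ((Ideal.span {youngSymmetrizer μ}).subtype.restrictScalars ℂ) Subtype.val_injective

lemma isVectorBundle_schurComplex (μ : YoungDiagram) {P : CochainComplex M.Modules ℤ}
    (hb : IsBoundedComplex P) (hP : ∀ i, isVectorBundle M (P.X i)) (j : ℤ) :
    isVectorBundle M ((schurComplex μ P).X j) :=
  (isVectorBundle_iff _).mpr (IsLocallyFree.sheafify
    (isLocallyFree_presheafTerm P (spechtRep μ) j hb fun a => (isVectorBundle_iff _).mp (hP a)))

end SchurComplex

/-! ### Comparing the terms of two direct sums -/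

section Biprod

variable {C : Type*} [Category* C] [Abelian C] {K L : CochainComplex C ℤ}

lemma isBoundedComplex_biprod (hK : IsBoundedComplex K) (hL : IsBoundedComplex L) :
    IsBoundedComplex (K ⊞ L) := by
  obtain ⟨a, b, h⟩ := hK
  obtain ⟨a', b', h'⟩ := hL
  refine ⟨min a a', max b b', fun i hi => ?_⟩
  refine Limits.IsZero.of_iso ?_ (HomologicalComplex.biprodXIso K L i)
  rw [Limits.biprod_isZero_iff]
  exact ⟨h _ (by omega), h' _ (by omega)⟩

/-- Reversal of the order of the three summands of a direct sum. -/
noncomputable def biprodRotateIso (X Y Z : C) : X ⊞ (Y ⊞ Z) ≅ Z ⊞ (Y ⊞ X) :=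
  Limits.biprod.braiding _ _ ≪≫
    Limits.biprod.mapIso (Limits.biprod.braiding _ _) (Iso.refl _) ≪≫ Limits.biprod.associator _ _ _

/-- The terms of `K ⊞ cone s` and of `L ⊞ cone (𝟙 K)` are isomorphic, for `s : K ⟶ L`. -/
noncomputable def biprodMappingConeXIso (s : K ⟶ L) (i : ℤ) :
    (K ⊞ CochainComplex.mappingCone s).X i ≅ (L ⊞ CochainComplex.mappingCone (𝟙 K)).X i :=
  -- The rotation takes `K^i ⊞ (K^{i+1} ⊞ L^i)` to `L^i ⊞ (K^{i+1} ⊞ K^i)`.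
  HomologicalComplex.biprodXIso _ _ i ≪≫
    Limits.biprod.mapIso (Iso.refl _) (mappingConeXIso s i) ≪≫ biprodRotateIso _ _ _ ≪≫
    Limits.biprod.mapIso (Iso.refl _) (mappingConeXIso (𝟙 K) i).symm ≪≫
    (HomologicalComplex.biprodXIso _ _ i).symm

end Biprod

/-! ### Conclusion -/

section Main

open SchurComplex

variable {M : Scheme.{0}} [M.Over (Spec (CommRingCat.of ℂ))] {P Q C : CochainComplex M.Modules ℤ}

omit [M.Over (Spec (CommRingCat.of ℂ))] in
lemma isVectorBundle_biprod (hP : ∀ i, isVectorBundle M (P.X i))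
    (hC : ∀ i, isVectorBundle M (C.X i)) (i : ℤ) : isVectorBundle M ((P ⊞ C).X i) :=
  ((hP i).biprod (hC i)).of_iso (HomologicalComplex.biprodXIso P C i).symm

lemma ofComplex_schurComplex_biprod (μ : YoungDiagram) (hbP : IsBoundedComplex P)
    (hP : ∀ i, isVectorBundle M (P.X i)) (hbC : IsBoundedComplex C)
    (hC : ∀ i, isVectorBundle M (C.X i)) (hC' : C.Acyclic) :
    KGroup.ofComplex _ (isVectorBundle_schurComplex μ hbP hP) =
      KGroup.ofComplex _ (isVectorBundle_schurComplex μ (isBoundedComplex_biprod hbP hbC)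
        (isVectorBundle_biprod hP hC)) := by
  have : QuasiIso (invariantMap (spechtRep μ) (Limits.biprod.inl : P ⟶ P ⊞ C)) :=
    quasiIso_invariantMap _ _ Limits.biprod.fst Limits.biprod.snd Limits.biprod.inr
      Limits.biprod.inl_fst Limits.biprod.total hC' hbC fun i => (isVectorBundle_iff _).mp (hC i)
  exact KGroup.ofComplex_eq_of_quasiIso (invariantMap (spechtRep μ) Limits.biprod.inl)
    (isBoundedComplex_invariantComplex _ hbP)
    (isBoundedComplex_invariantComplex _ (isBoundedComplex_biprod hbP hbC)) _ _

/-- After adding `cone s` to `P` and `cone (𝟙 P)` to `Q`, the two complexes have isomorphic terms,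
though possibly different differentials. The quasi-isomorphism hypothesis enters through the
acyclicity of `cone s`. -/
lemma ofComplex_schurComplex_eq (μ : YoungDiagram) (hbP : IsBoundedComplex P)
    (hP : ∀ i, isVectorBundle M (P.X i)) (hbQ : IsBoundedComplex Q)
    (hQ : ∀ i, isVectorBundle M (Q.X i)) (s : P ⟶ Q) [QuasiIso s] :
    KGroup.ofComplex _ (isVectorBundle_schurComplex μ hbP hP) =
      KGroup.ofComplex _ (isVectorBundle_schurComplex μ hbQ hQ) := by
  rw [ofComplex_schurComplex_biprod μ hbP hP (isBoundedComplex_mappingCone s hbP hbQ)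
      (isVectorBundle_mappingCone s hP hQ) (acyclic_mappingCone s),
    ofComplex_schurComplex_biprod μ hbQ hQ (isBoundedComplex_mappingCone (𝟙 P) hbP hbP)
      (isVectorBundle_mappingCone (𝟙 P) hP hP) (acyclic_mappingCone (𝟙 P))]
  exact KGroup.ofComplex_congr _ _ (isBoundedComplex_invariantComplex _
    (isBoundedComplex_biprod hbP (isBoundedComplex_mappingCone s hbP hbQ)))
    (invariantComplexXIso (spechtRep μ) (biprodMappingConeXIso s))

end Main

theorem lemma3p6 (M : Scheme.{0}) [M.Over (Spec (CommRingCat.of ℂ))]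
    (P Q : CochainComplex M.Modules ℤ)
    (hP : IsBoundedComplex P) (hP' : ∀ i, isVectorBundle M (P.X i))
    (hQ : IsBoundedComplex Q) (hQ' : ∀ i, isVectorBundle M (Q.X i))
    (s : P ⟶ Q) (hs : QuasiIso s) (μ : YoungDiagram) :
    (IsBoundedComplex (SchurComplex.schurComplex μ P) ∧
      IsBoundedComplex (SchurComplex.schurComplex μ Q)) ∧
    (∃ (h₁ : ∀ i, isVectorBundle M ((SchurComplex.schurComplex μ P).X i))
        (h₂ : ∀ i, isVectorBundle M ((SchurComplex.schurComplex μ Q).X i)),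
      KGroup.ofComplex _ h₁ = KGroup.ofComplex _ h₂) ∧
    (IsLocallyNoetherian M →
      ∃ (h₁ : ∀ i, isCoherent M ((SchurComplex.schurComplex μ P).X i))
        (h₂ : ∀ i, isCoherent M ((SchurComplex.schurComplex μ Q).X i)),
      KGroup.ofComplex _ h₁ = KGroup.ofComplex _ h₂) := by
  have hbP : IsBoundedComplex (SchurComplex.schurComplex μ P) :=
    SchurComplex.isBoundedComplex_invariantComplex (SchurComplex.spechtRep μ) hP
  have hbQ : IsBoundedComplex (SchurComplex.schurComplex μ Q) :=
    SchurComplex.isBoundedComplex_invariantComplex (SchurComplex.spechtRep μ) hQ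
  have h := ofComplex_schurComplex_eq μ hP hP' hQ hQ' s
  have hle : isVectorBundle M ≤ isCoherent M := fun _ hE => hE.isCoherent
  refine ⟨⟨hbP, hbQ⟩, ⟨_, _, h⟩, fun _ => ⟨
    fun i => hle _ (SchurComplex.isVectorBundle_schurComplex μ hP hP' i),
    fun i => hle _ (SchurComplex.isVectorBundle_schurComplex μ hQ hQ' i), ?_⟩⟩
  -- Every exact sequence of vector bundles is one of coherent sheaves, so the equality is carried
  -- along the induced map of Grothendieck groups.
  have h' := congrArg (KGroup.map hle) h
  rwa [KGroup.map_ofComplex hle hbP, KGroup.map_ofComplex hle hbQ] at h'
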